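/- **Setting.** Fix the infinite set $\{0,1\}^*$ of *labels*. A *tree* $t$ is a nonempty finite unranked ordered tree, given by a tree domain $\mathrm{dom}(t)\subseteq\mathbb N^*$ with root $\varepsilon$, in which every vertex $v$ carries a label $\mathrm{lab}_t(v)$. A vertex $v\cdot i$ with $i\in\mathbb N$ is a *child* of $v$, and a vertex $v\cdot u$ with $u\in\mathbb N^*$, $u\neq\varepsilon$, is a *descendant* of $v$. The *XPath expressions* of $\mathrm{XP}(/,/\!/,[\,],*,|)$ are the location paths (lpath) of the grammar $$\text{lpath}::=\text{lstep}\ \big|\ \text{lpath}\,/\,\text{lpath}\ \big|\ \text{lpath}\,|\,\text{lpath},\qquad \text{lstep}::=\text{axis}::\text{node-test}\,([\text{fexpr}])^*,$$ $$\text{axis}::=\mathtt{self}\ \big|\ \mathtt{child}\ \big|\ \mathtt{descendant},\qquad \text{fexpr}::=\text{lpath}\ \big|\ \text{lpath or lpath},$$ where a node-test is a label or the wildcard $*$. For a tree $t$, a location path $p$ defines a relation $[\![p]\!]_t\subseteq \mathrm{dom}(t)^2$: * $(u,v)\in[\![a::n[e_1]\cdots[e_k]]\!]_t$ iff $v=u$,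 $v$ is a child of $u$, or $v$ is a descendant of $u$, according to whether $a$ is $\mathtt{self}$, $\mathtt{child}$ or $\mathtt{descendant}$; moreover $n=*$ or $\mathrm{lab}_t(v)=n$; and each $e_i$ is true at $v$. Here a location path $r$ is true at $v$ iff $(v,w)\in[\![r]\!]_t$ for some $w$, and "$r$ or $r'$" is true at $v$ iff $r$ or $r'$ is. * $[\![p/q]\!]_t=[\![p]\!]_t\circ[\![q]\!]_t$ (first $p$, then $q$) and $[\![p\,|\,q]\!]_t=[\![p]\!]_t\cup[\![q]\!]_t$. Write $t\models p$ if $(\varepsilon,v)\in[\![p]\!]_t$ for some vertex $v$ of $t$. **Problem.** An instance of $\mathrm{XFContainment}$ is a triple $(S,p,q)$, where $S$ is a finite set of labels (given as a list) and $p,q$ are expressions of $\mathrm{XP}(/,/\!/,[\,],*,|)$. It is a yes-instance iff every tree $t$ all of whose labels belong to $S$ satisfies: $t\models p$ implies $t\models q$. Instances are written as strings over a fixed finite alphabet: labels are spelled out bit by bit, and expressions are written in prefix notation. **Theorem.** $\mathrm{XFContainment}$ for $\mathrm{XP}(/,/\!/,[\,],*,|)$ is in PSPACE. That is, there are a deterministic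 Turing machine and a polynomial $s$ such that on every input string $w$ the machine halts, uses space at most $s(|w|)$, and accepts if and only if $w$ encodes a yes-instance. -/

import Mathlib

namespace XPathContainment

/-! ### XML trees -/

/-- Labels (element names) are finite bit strings; this is the fixed infinite set of labels. -/
abbrev Label : Type := List Bool

/-- Vertices are finite sequences of natural numbers; the `i`-th child of `v` is `v ++ [i]`
and the root is `[]`. Children are numbered from `0`. -/
abbrev Vertex : Type := List ℕ

/-- A finite unranked ordered labelled tree, given by a nonempty finite tree domain
and a labelling of its vertices (only the values of `lab` on `dom` matter). -/
structure XMLTree where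
  dom : Finset Vertex
  root_mem : [] ∈ dom
  parent_mem : ∀ (v : Vertex) (i : ℕ), v ++ [i] ∈ dom → v ∈ dom
  sibling_mem : ∀ (v : Vertex) (i : ℕ), v ++ [i + 1] ∈ dom → v ++ [i] ∈ dom
  lab : Vertex → Label

/-! ### Syntax of XPath expressions -/

inductive Axis
  | self
  | child
  | descendant

inductive NodeTest
  | label (a : Label)
  | wildcard

/- The grammar of location paths, location steps and filter expressions:
  `lpath ::= lstep | lpath '/' lpath | lpath '|' lpath`,
  `lstep ::= axis '::' node-test ('[' fexpr ']')*`,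
  `fexpr ::= lpath | lpath 'or' lpath`.
The list of filters of a step is built one filter at a time, `filter s e` being `s[e]`. -/
mutual
inductive LPath
  | step (s : LStep)
  | seq (p q : LPath)
  | union (p q : LPath)
inductive LStep
  | base (a : Axis) (n : NodeTest)
  | filter (s : LStep) (e : FExpr)
inductive FExpr
  | path (p : LPath)
  | or (p q : LPath)
end

/-! ### Semantics -/

/-- `a.Rel u v`: the vertex `v` is reached from `u` along the axis `a`. -/
def Axis.Rel : Axis → Vertex → Vertex → Prop
  | .self, u, v => v = u
  | .child, u, v => ∃ i : ℕ, v = u ++ [i]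
  | .descendant, u, v => ∃ w : Vertex, w ≠ [] ∧ v = u ++ w

def NodeTest.Holds : NodeTest → Label → Prop
  | .label a, b => b = a
  | .wildcard, _ => True

/- `p.Sem t` is the binary relation on the vertices of `t` defined by a location path (step),
and `e.Holds t v` says that the filter expression `e` is true at `v`. -/
mutual
def LPath.Sem (t : XMLTree) : LPath → Vertex → Vertex → Prop
  | .step s, u, v => s.Sem t u v
  | .seq p q, u, v => ∃ w : Vertex, p.Sem t u w ∧ q.Sem t w v
  | .union p q, u, v => p.Sem t u v ∨ q.Sem t u v
def LStep.Sem (t : XMLTree) : LStep → Vertex → Vertex → Prop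
  | .base a n, u, v => u ∈ t.dom ∧ v ∈ t.dom ∧ a.Rel u v ∧ n.Holds (t.lab v)
  | .filter s e, u, v => s.Sem t u v ∧ e.Holds t v
def FExpr.Holds (t : XMLTree) : FExpr → Vertex → Prop
  | .path p, v => ∃ w : Vertex, p.Sem t v w
  | .or p q, v => (∃ w : Vertex, p.Sem t v w) ∨ (∃ w : Vertex, q.Sem t v w)
end

/-- `t ⊨ p`: some vertex is selected from the root. -/
def XMLTree.Matches (t : XMLTree) (p : LPath) : Prop :=
  ∃ v : Vertex, p.Sem t [] v

/-- All labels of `t` belong to the finite alphabet listed by `S`. -/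
def XMLTree.LabelledIn (t : XMLTree) (S : List Label) : Prop :=
  ∀ v ∈ t.dom, t.lab v ∈ S

/-- Boolean containment of `p` in `q` over trees with labels from the finite alphabet `S`. -/
def ContainedOver (S : List Label) (p q : LPath) : Prop :=
  ∀ t : XMLTree, t.LabelledIn S → t.Matches p → t.Matches q

/-! ### Instances as strings over a fixed finite alphabet -/

/-- The input alphabet. Expressions are written in prefix notation. -/
inductive Token
  | self | child | descendant
  | star
  | bit (b : Bool)
  | endLabel
  | endAlphabet
  | filter | slash | bar | or
  deriving DecidableEq, Fintype

def encodeLabel (a : Label) : List Token := a.map Token.bit ++ [Token.endLabel]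

def Axis.token : Axis → Token
  | .self => .self
  | .child => .child
  | .descendant => .descendant

def NodeTest.encode : NodeTest → List Token
  | .label a => encodeLabel a
  | .wildcard => [.star]

mutual
def LPath.encode : LPath → List Token
  | .step s => s.encode
  | .seq p q => .slash :: (p.encode ++ q.encode)
  | .union p q => .bar :: (p.encode ++ q.encode)
def LStep.encode : LStep → List Token
  | .base a n => a.token :: n.encode
  | .filter s e => .filter :: (s.encode ++ e.encode)
def FExpr.encode : FExpr → List Token
  | .path p => p.encode
  | .or p q => .or :: (p.encode ++ q.encode)
end

def encodeAlphabet (S : List Label) : List Token :=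
  S.flatMap encodeLabel ++ [Token.endAlphabet]

/-- The string encoding an instance `(S, p, q)`. -/
def encodeInstance (S : List Label) (p q : LPath) : List Token :=
  encodeAlphabet S ++ (p.encode ++ q.encode)

/-- The containment problem with a finite alphabet given in the input, as a language: the
encodings of the triples `(S, p, q)` such that `p` is contained in `q` over `S`. -/
def XFContainment : Language Token :=
  {w | ∃ (S : List Label) (p q : LPath), w = encodeInstance S p q ∧ ContainedOver S p q}

/-! The encoding is uniquely readable. -/

theorem encodeLabel_append_inj {a b : Label} {r s : List Token}
    (h : encodeLabel a ++ r = encodeLabel b ++ s) : a = b ∧ r = s := by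
  induction a generalizing b with
  | nil => cases b <;> simp_all [encodeLabel]
  | cons x a ih =>
    cases b with
    | nil => simp [encodeLabel] at h
    | cons y b =>
      simp only [encodeLabel, List.map_cons, List.cons_append, List.cons.injEq,
        Token.bit.injEq] at h
      obtain ⟨rfl, h⟩ := h
      exact ⟨congrArg _ (ih h).1, (ih h).2⟩

theorem NodeTest.encode_append_inj {m n : NodeTest} {r s : List Token}
    (h : m.encode ++ r = n.encode ++ s) : m = n ∧ r = s := by
  cases m with
  | label a =>
    cases n with
    | label b => simpa using encodeLabel_append_inj h
    | wildcard => cases a <;> simp [NodeTest.encode, encodeLabel] at h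
  | wildcard =>
    cases n with
    | label b => cases b <;> simp [NodeTest.encode, encodeLabel] at h
    | wildcard => simpa [NodeTest.encode] using h

mutual
theorem LPath.encode_append_inj : ∀ (p q : LPath) (r s : List Token),
    p.encode ++ r = q.encode ++ s → p = q ∧ r = s
  | .step a, .step b, r, s, h => by
    simpa using LStep.encode_append_inj a b r s (by simpa [LPath.encode] using h)
  | .seq p q, .seq p' q', r, s, h => by
    simp only [LPath.encode, List.cons_append, List.append_assoc, List.cons.injEq,
      true_and] at h
    obtain ⟨rfl, k⟩ := LPath.encode_append_inj p p' _ _ h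
    obtain ⟨rfl, l⟩ := LPath.encode_append_inj q q' _ _ k
    exact ⟨rfl, l⟩
  | .union p q, .union p' q', r, s, h => by
    simp only [LPath.encode, List.cons_append, List.append_assoc, List.cons.injEq,
      true_and] at h
    obtain ⟨rfl, k⟩ := LPath.encode_append_inj p p' _ _ h
    obtain ⟨rfl, l⟩ := LPath.encode_append_inj q q' _ _ k
    exact ⟨rfl, l⟩
  | .step a, .seq _ _, r, s, h => by
    rcases a with ⟨_ | _ | _, _⟩ | _ <;> simp [LPath.encode, LStep.encode, Axis.token] at h
  | .step a, .union _ _, r, s, h => by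
    rcases a with ⟨_ | _ | _, _⟩ | _ <;> simp [LPath.encode, LStep.encode, Axis.token] at h
  | .seq _ _, .step b, r, s, h => by
    rcases b with ⟨_ | _ | _, _⟩ | _ <;> simp [LPath.encode, LStep.encode, Axis.token] at h
  | .union _ _, .step b, r, s, h => by
    rcases b with ⟨_ | _ | _, _⟩ | _ <;> simp [LPath.encode, LStep.encode, Axis.token] at h
  | .seq _ _, .union _ _, r, s, h => by simp [LPath.encode] at h
  | .union _ _, .seq _ _, r, s, h => by simp [LPath.encode] at h
theorem LStep.encode_append_inj : ∀ (p q : LStep) (r s : List Token),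
    p.encode ++ r = q.encode ++ s → p = q ∧ r = s
  | .base a m, .base b n, r, s, h => by
    simp only [LStep.encode, List.cons_append, List.cons.injEq] at h
    obtain ⟨h1, h2⟩ := h
    obtain ⟨rfl, h3⟩ := NodeTest.encode_append_inj h2
    refine ⟨?_, h3⟩
    cases a <;> cases b <;> simp_all [Axis.token]
  | .filter p e, .filter p' e', r, s, h => by
    simp only [LStep.encode, List.cons_append, List.append_assoc, List.cons.injEq,
      true_and] at h
    obtain ⟨rfl, k⟩ := LStep.encode_append_inj p p' _ _ h
    obtain ⟨rfl, l⟩ := FExpr.encode_append_inj e e' _ _ k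
    exact ⟨rfl, l⟩
  | .base a m, .filter _ _, r, s, h => by cases a <;> simp [LStep.encode, Axis.token] at h
  | .filter _ _, .base a m, r, s, h => by cases a <;> simp [LStep.encode, Axis.token] at h
theorem FExpr.encode_append_inj : ∀ (p q : FExpr) (r s : List Token),
    p.encode ++ r = q.encode ++ s → p = q ∧ r = s
  | .path p, .path q, r, s, h => by
    simpa using LPath.encode_append_inj p q r s (by simpa [FExpr.encode] using h)
  | .or p q, .or p' q', r, s, h => by
    simp only [FExpr.encode, List.cons_append, List.append_assoc, List.cons.injEq,
      true_and] at h
    obtain ⟨rfl, k⟩ := LPath.encode_append_inj p p' _ _ h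
    obtain ⟨rfl, l⟩ := LPath.encode_append_inj q q' _ _ k
    exact ⟨rfl, l⟩
  | .path p, .or _ _, r, s, h => by
    rcases p with ⟨⟨_ | _ | _, _⟩ | _⟩ | _ | _ <;>
      simp [FExpr.encode, LPath.encode, LStep.encode, Axis.token] at h
  | .or _ _, .path p, r, s, h => by
    rcases p with ⟨⟨_ | _ | _, _⟩ | _⟩ | _ | _ <;>
      simp [FExpr.encode, LPath.encode, LStep.encode, Axis.token] at h
end

theorem encodeAlphabet_append_inj {S T : List Label} {r s : List Token}
    (h : encodeAlphabet S ++ r = encodeAlphabet T ++ s) : S = T ∧ r = s := by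
  induction S generalizing T with
  | nil =>
    rcases T with _ | ⟨_ | _, T⟩
    · simpa [encodeAlphabet] using h
    · simp [encodeAlphabet, encodeLabel] at h
    · simp [encodeAlphabet, encodeLabel] at h
  | cons a S ih =>
    cases T with
    | nil => cases a <;> simp [encodeAlphabet, encodeLabel] at h
    | cons b T =>
      simp only [encodeAlphabet, List.flatMap_cons, List.append_assoc] at h
      obtain ⟨rfl, k⟩ := encodeLabel_append_inj h
      obtain ⟨rfl, l⟩ := ih (T := T) (by simpa [encodeAlphabet] using k)
      exact ⟨rfl, l⟩

theorem encodeInstance_inj {S T : List Label} {p q p' q' : LPath}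
    (h : encodeInstance S p q = encodeInstance T p' q') : S = T ∧ p = p' ∧ q = q' := by
  obtain ⟨rfl, k⟩ := encodeAlphabet_append_inj h
  obtain ⟨rfl, l⟩ := LPath.encode_append_inj p p' _ _ k
  obtain ⟨rfl, -⟩ := LPath.encode_append_inj q q' [] [] (by simpa using l)
  exact ⟨rfl, rfl, rfl⟩

/-! ### Polynomial space -/

/-- The space used by a configuration of a deterministic (multi-stack) Turing machine: the
total number of symbols stored, the input included. -/
def cfgSpace (M : Turing.FinTM2) (c : M.Cfg) : ℕ :=
  letI := M.kFin
  ∑ k, (c.stk k).length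

/-- `M`, with input symbols `A` embedded in its input alphabet by `e` and with accepting states
`acc`, decides `L` in space `s`: on every input word `w` the run of `M` uses space at most
`s |w|` throughout, halts, and halts in an accepting state if and only if `w ∈ L`. -/
def DecidesInSpace {A : Type} (M : Turing.FinTM2) (e : A ↪ M.Γ M.k₀) (acc : Set M.σ)
    (L : Language A) (s : ℕ → ℕ) : Prop :=
  ∀ w : List A,
    (∀ c : M.Cfg, StateTransition.Reaches M.step (Turing.initList M (w.map e)) c →
      cfgSpace M c ≤ s w.length) ∧
    ∃ c : M.Cfg, StateTransition.Reaches M.step (Turing.initList M (w.map e)) c ∧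
      c.l = none ∧ (c.var ∈ acc ↔ w ∈ L)

/-- The class PSPACE of languages decided by a deterministic Turing machine in polynomial space. -/
def InPSPACE {A : Type} (L : Language A) : Prop :=
  ∃ (M : Turing.FinTM2) (e : A ↪ M.Γ M.k₀) (acc : Set M.σ) (s : Polynomial ℕ),
    (∀ k : M.K, Finite (M.Γ k)) ∧ DecidesInSpace M e acc L (fun n => s.eval n)

end XPathContainment

namespace XPathContainment

-- Suppose that a tree satisfies `p` but not `q`. About each of its vertices only two things matter:
-- the label, and which atoms are false there. An atom is an axis, a node test and a continuation,
-- that is, what remains of `q` to be matched after the step. The expression `q` has linearly many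
-- atoms of linear size (`LPath.length_atoms_le`, `LPath.size_atom_le`), and they are closed under
-- taking atoms of continuations (`LPath.contAtoms_of_mem`). A state, consisting of a label and a
-- list of atoms with a proper axis, thus has polynomial size. The state of a vertex suffices to
-- refute expressions there, and the state of a child suffices to check the false atoms of a parent
-- with no other child.
--
-- A countermodel can be assembled along `p` from its end to its start, with states as the only
-- information passed between the pieces. A state claims that its listed atoms are false and says
-- nothing about the others. Hence two trees whose roots have the same state can be glued at the
-- root: an atom with a proper axis that is true in the glued tree is true in one of the parts
-- (`RT.rel_append`), whereas everything achieved for `p` survives, as there is no negation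
-- (`LPath.growClosed_pre`). This is how filters are treated (`Meaning.eval_filter`). A descendant
-- step may need an exponentially long chain of states. Repeated states are cut out
-- (`exists_short_walk`) and the chain is found by halving, as in Savitch's theorem
-- (`der_chain_of_walk`).
--
-- All this, including the parsing of the input, is a Horn clause program `clauses` over binary
-- trees. It is sound because every clause preserves the intended meaning of the goals
-- (`meaning_clauses`). It is complete within polynomial bounds because the true states of the
-- vertices of a countermodel give a derivation of polynomial height with values of polynomial size
-- (`der_nonContained`). Membership therefore amounts to one bounded derivability and one bounded
-- underivability (`mem_XFContainment_iff`).
--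
-- Bounded derivability is alternating polynomial time: a clause and its values are guessed bit by
-- bit, then one of the two body goals is chosen universally. The resulting and-or tree has
-- polynomial height and is evaluated depth first in polynomial space (`psf_win`, `psf_solve`). To
-- obtain an actual machine, such functions are written in a while language on binary trees,
-- compiled to stack programs (`Ev.run`) and then to Turing machines (`inPSPACE_of_run`).

/-! ### Structured stack programs -/

/-- The stacks of the machines constructed below. -/
inductive Reg
  | inp | main | cnt
  | tmp (d : Bool)
  deriving DecidableEq, Fintype

abbrev Sto : Type := Reg → List Token

/-- Structured programs over the stacks `Reg`; the finite state is the last symbol popped. -/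
inductive Prog
  | skip
  | push (k : Reg) (f : Option Token → Token)
  | pop (k : Reg)
  | seq (p q : Prog)
  | ite (f : Option Token → Bool) (p q : Prog)
  | loop (f : Option Token → Bool) (p : Prog)

def space (S : Sto) : ℕ := ∑ k, (S k).length

/-- `Run B p v S v' S'`: from state `v` and stacks `S` the program `p` terminates in `v'` and `S'`
and uses space at most `B`. -/
inductive Run (B : ℕ) : Prog → Option Token → Sto → Option Token → Sto → Prop
  | skip {v S} : space S ≤ B → Run B .skip v S v S
  | push {k f v S} : space S ≤ B → space (Function.update S k (f v :: S k)) ≤ B →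
      Run B (.push k f) v S v (Function.update S k (f v :: S k))
  | pop {k v S} : space S ≤ B → space (Function.update S k (S k).tail) ≤ B →
      Run B (.pop k) v S (S k).head? (Function.update S k (S k).tail)
  | seq {p q v S v' S' v'' S''} : Run B p v S v' S' → Run B q v' S' v'' S'' →
      Run B (.seq p q) v S v'' S''
  | ite_true {f p q v S v' S'} : f v = true → Run B p v S v' S' → Run B (.ite f p q) v S v' S'
  | ite_false {f p q v S v' S'} : f v = false → Run B q v S v' S' → Run B (.ite f p q) v S v' S'
  | loop_true {f p v S v' S' v'' S''} : f v = true → Run B p v S v' S' →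
      Run B (.loop f p) v' S' v'' S'' → Run B (.loop f p) v S v'' S''
  | loop_false {f p v S} : f v = false → space S ≤ B → Run B (.loop f p) v S v S

theorem Run.space_le {B p v S v' S'} (h : Run B p v S v' S') : space S ≤ B ∧ space S' ≤ B := by
  induction h <;> tauto

/-! ### Compilation to multi-stack Turing machines -/

/-- Program points. -/
def Prog.Lab : Prog → Type
  | .skip => Unit
  | .push _ _ => Unit
  | .pop _ => Unit
  | .seq p q => p.Lab ⊕ q.Lab
  | .ite _ p q => Unit ⊕ (p.Lab ⊕ q.Lab)
  | .loop _ p => Unit ⊕ p.Lab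

@[reducible]
noncomputable def Prog.fintypeLab : (p : Prog) → Fintype p.Lab
  | .skip => inferInstanceAs (Fintype Unit)
  | .push _ _ => inferInstanceAs (Fintype Unit)
  | .pop _ => inferInstanceAs (Fintype Unit)
  | .seq p q =>
    letI := p.fintypeLab
    letI := q.fintypeLab
    inferInstanceAs (Fintype (p.Lab ⊕ q.Lab))
  | .ite _ p q =>
    letI := p.fintypeLab
    letI := q.fintypeLab
    inferInstanceAs (Fintype (Unit ⊕ (p.Lab ⊕ q.Lab)))
  | .loop _ p =>
    letI := p.fintypeLab
    inferInstanceAs (Fintype (Unit ⊕ p.Lab))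

def Prog.entry : (p : Prog) → p.Lab
  | .skip => ()
  | .push _ _ => ()
  | .pop _ => ()
  | .seq p _ => Sum.inl p.entry
  | .ite _ _ _ => Sum.inl ()
  | .loop _ _ => Sum.inl ()

abbrev MStmt (Λ : Type) : Type :=
  Turing.TM2.Stmt (fun _ : Reg => Token) Λ (Option Token)

abbrev MCfg (Λ : Type) : Type :=
  Turing.TM2.Cfg (fun _ : Reg => Token) Λ (Option Token)

/-- The statement at each program point, where `exit` is the label to go to at the end. -/
def Prog.code {Λ : Type} : (p : Prog) → (p.Lab → Λ) → Λ → p.Lab → MStmt Λ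
  | .skip, _, exit, _ => .goto fun _ => exit
  | .push k f, _, exit, _ => .push k f (.goto fun _ => exit)
  | .pop k, _, exit, _ => .pop k (fun _ x => x) (.goto fun _ => exit)
  | .seq p q, inj, _, .inl l => p.code (fun x => inj (.inl x)) (inj (.inr q.entry)) l
  | .seq _ q, inj, exit, .inr l => q.code (fun x => inj (.inr x)) exit l
  | .ite f p q, inj, _, .inl _ =>
    .branch f (.goto fun _ => inj (.inr (.inl p.entry))) (.goto fun _ => inj (.inr (.inr q.entry)))
  | .ite _ p _, inj, exit, .inr (.inl l) => p.code (fun x => inj (.inr (.inl x))) exit l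
  | .ite _ _ q, inj, exit, .inr (.inr l) => q.code (fun x => inj (.inr (.inr x))) exit l
  | .loop f p, inj, exit, .inl _ =>
    .branch f (.goto fun _ => inj (.inr p.entry)) (.goto fun _ => exit)
  | .loop _ p, inj, _, .inr l => p.code (fun x => inj (.inr x)) (inj (.inl ())) l

/-- Paths of configurations of space at most `B`. -/
def BPath {Λ : Type} (M : Λ → MStmt Λ) (B : ℕ) : MCfg Λ → MCfg Λ → Prop :=
  Relation.ReflTransGen fun c c' =>
    Turing.TM2.step M c = some c' ∧ space c.stk ≤ B ∧ space c'.stk ≤ B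

/-- The simulation is local: `inj` places the program points of `p` among the labels of the whole
machine. Keeping `inj` and `exit` arbitrary lets the induction pass to a subprogram, whose exit is
the entry of whatever follows it. -/
theorem Run.bpath {B p v S v' S'} (h : Run B p v S v' S') {Λ : Type} (M : Λ → MStmt Λ)
    (inj : p.Lab → Λ) (exit : Λ) (hM : ∀ l, M (inj l) = p.code inj exit l) :
    BPath M B ⟨some (inj p.entry), v, S⟩ ⟨some exit, v', S'⟩ := by
  induction h generalizing exit with
  | skip h =>
    exact .single ⟨by simp [Turing.TM2.step, hM, Prog.code], h, h⟩
  | push h h' =>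
    exact .single ⟨by simp [Turing.TM2.step, hM, Prog.code], h, h'⟩
  | pop h h' =>
    exact .single ⟨by simp [Turing.TM2.step, hM, Prog.code], h, h'⟩
  | seq _ _ ih1 ih2 =>
    exact (ih1 (fun x => inj (.inl x)) (inj (.inr (Prog.entry _))) fun l => hM _).trans
      (ih2 (fun x => inj (.inr x)) exit fun l => hM _)
  | ite_true hf h1 ih =>
    refine .head ⟨?_, h1.space_le.1, h1.space_le.1⟩
      (ih (fun x => inj (.inr (.inl x))) exit fun l => hM _)
    exact (congrArg (fun s => some (Turing.TM2.stepAux s _ _)) (hM (.inl ()))).trans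
      (by simp [Prog.code, hf])
  | ite_false hf h1 ih =>
    refine .head ⟨?_, h1.space_le.1, h1.space_le.1⟩
      (ih (fun x => inj (.inr (.inr x))) exit fun l => hM _)
    exact (congrArg (fun s => some (Turing.TM2.stepAux s _ _)) (hM (.inl ()))).trans
      (by simp [Prog.code, hf])
  | loop_true hf h1 h2 ih1 ih2 =>
    refine .head ⟨?_, h1.space_le.1, h1.space_le.1⟩
      ((ih1 (fun x => inj (.inr x)) (inj (.inl ())) fun l => hM _).trans (ih2 inj exit hM))
    exact (congrArg (fun s => some (Turing.TM2.stepAux s _ _)) (hM (.inl ()))).trans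
      (by simp [Prog.code, hf])
  | loop_false hf h =>
    exact .single ⟨(congrArg (fun s => some (Turing.TM2.stepAux s _ _)) (hM (.inl ()))).trans
      (by simp [Prog.code, hf]), h, h⟩

theorem BPath.reaches {Λ : Type} {M : Λ → MStmt Λ} {B : ℕ} {c c' : MCfg Λ} (h : BPath M B c c') :
    StateTransition.Reaches (Turing.TM2.step M) c c' :=
  Relation.ReflTransGen.mono (fun _ _ h => h.1) _ _ h

/-- By determinism every configuration reachable from the start of a halting path lies on that path,
so a bound along one run bounds all reachable configurations. -/
theorem BPath.space_le {Λ : Type} {M : Λ → MStmt Λ} {B : ℕ} {c c' : MCfg Λ} (h : BPath M B c c')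
    (hc : space c.stk ≤ B) (hend : Turing.TM2.step M c' = none) {d : MCfg Λ}
    (hd : StateTransition.Reaches (Turing.TM2.step M) c d) : space d.stk ≤ B := by
  induction h using Relation.ReflTransGen.head_induction_on with
  | refl =>
    rcases Relation.ReflTransGen.cases_head hd with rfl | ⟨e, he, _⟩
    · exact hc
    · simp [hend] at he
  | head h1 _ ih =>
    rcases Relation.ReflTransGen.cases_head hd with rfl | ⟨e, he, h3⟩
    · exact hc
    · rw [h1.1] at he
      cases Option.mem_some_iff.1 he
      exact ih h1.2.2 h3

/-- The machine of a program, started with its input on the stack `Reg.inp`. -/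
noncomputable def Prog.machine (p : Prog) : Turing.FinTM2 :=
  letI := p.fintypeLab
  { K := Reg
    k₀ := .inp
    k₁ := .inp
    Γ := fun _ => Token
    Λ := Option p.Lab
    main := some p.entry
    σ := Option Token
    initialState := none
    m := fun
      | none => .halt
      | some l => p.code some none l }

def initSto (w : List Token) : Sto := fun k => if k = .inp then w else []

/-- A language decided by a program in polynomial space is in PSPACE. -/
theorem inPSPACE_of_run (p : Prog) (L : Language Token) (s : Polynomial ℕ)
    (h : ∀ w : List Token, ∃ v S, Run (s.eval w.length) p none (initSto w) v S ∧
      (v = some (.bit true) ↔ w ∈ L)) : InPSPACE L := by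
  refine ⟨p.machine, .refl Token, {some (.bit true)}, s, fun k => ?_, fun w => ?_⟩
  · exact inferInstanceAs (Finite Token)
  obtain ⟨v, S, hrun, hv⟩ := h w
  have hinit : ∀ u : List (p.machine.Γ p.machine.k₀), u = w → Turing.initList p.machine u =
      (⟨some (some p.entry), none, initSto w⟩ : MCfg (Option p.Lab)) := by
    rintro u rfl
    unfold Turing.initList
    congr 1
  have hu := hinit _ (List.map_id w)
  have hp := hrun.bpath (Λ := Option p.Lab) p.machine.m some none fun l => rfl
  -- The label `none` of the machine carries `halt`; executing it leaves state and stacks unchanged.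
  have hp' : BPath p.machine.m (s.eval w.length)
      (⟨some (some p.entry), none, initSto w⟩ : MCfg (Option p.Lab)) ⟨none, v, S⟩ :=
    hp.tail ⟨rfl, hrun.space_le.2, hrun.space_le.2⟩
  refine ⟨fun c hc => ?_, ⟨none, v, S⟩, ?_, rfl, hv⟩
  · exact hp'.space_le hrun.space_le.1 rfl
      (Eq.subst (motive := fun x => StateTransition.Reaches p.machine.step x c) hu hc)
  · exact Eq.subst (motive := fun x => StateTransition.Reaches p.machine.step x _) hu.symm
      hp'.reaches

/-! ### Binary trees and their string representation -/

/-- Binary trees, the data type of the algorithms below. -/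
inductive V
  | nil
  | cons (a b : V)
  deriving DecidableEq

namespace V

def fst : V → V
  | nil => nil
  | cons a _ => a

def snd : V → V
  | nil => nil
  | cons _ b => b

def size : V → ℕ
  | nil => 1
  | cons a b => a.size + b.size + 1

/-- Preorder encoding. -/
def enc : V → List Token
  | nil => [.bit false]
  | cons a b => .bit true :: (a.enc ++ b.enc)

@[simp] theorem fst_nil : fst nil = nil := rfl
@[simp] theorem snd_nil : snd nil = nil := rfl
@[simp] theorem fst_cons (a b : V) : fst (cons a b) = a := rfl
@[simp] theorem snd_cons (a b : V) : snd (cons a b) = b := rfl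
@[simp] theorem size_nil : size nil = 1 := rfl
@[simp] theorem size_cons (a b : V) : size (cons a b) = a.size + b.size + 1 := rfl

@[simp] theorem length_enc (v : V) : v.enc.length = v.size := by
  induction v with
  | nil => rfl
  | cons a b iha ihb => simp [enc, iha, ihb]

theorem size_pos (v : V) : 0 < v.size := by cases v <;> simp

theorem size_fst_le (v : V) : v.fst.size ≤ v.size := by
  cases v <;> simp; omega

theorem size_snd_le (v : V) : v.snd.size ≤ v.size := by
  cases v <;> simp; omega

end V

/-! ### Stack contents -/

def sto (d : Bool) (i m c x y : List Token) : Sto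
  | .inp => i
  | .main => m
  | .cnt => c
  | .tmp e => if e = d then x else y

section sto
variable (d : Bool) (i m c x y l : List Token)

@[simp] theorem sto_inp : sto d i m c x y .inp = i := rfl
@[simp] theorem sto_main : sto d i m c x y .main = m := rfl
@[simp] theorem sto_cnt : sto d i m c x y .cnt = c := rfl
@[simp] theorem sto_tmp : sto d i m c x y (.tmp d) = x := by simp [sto]
@[simp] theorem sto_tmp_not : sto d i m c x y (.tmp !d) = y := by simp [sto]

theorem sto_not : sto (!d) i m c x y = sto d i m c y x := by
  funext k
  cases k with
  | tmp e => cases d <;> cases e <;> rfl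
  | _ => rfl

@[simp] theorem sto_update_inp :
    Function.update (sto d i m c x y) .inp l = sto d l m c x y := by
  funext k; cases k <;> simp [Function.update, sto]
@[simp] theorem sto_update_main :
    Function.update (sto d i m c x y) .main l = sto d i l c x y := by
  funext k; cases k <;> simp [Function.update, sto]
@[simp] theorem sto_update_cnt :
    Function.update (sto d i m c x y) .cnt l = sto d i m l x y := by
  funext k; cases k <;> simp [Function.update, sto]
@[simp] theorem sto_update_tmp :
    Function.update (sto d i m c x y) (.tmp d) l = sto d i m c l y := by
  funext k
  cases k with
  | tmp e => cases d <;> cases e <;> simp [Function.update, sto]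
  | _ => simp [Function.update, sto]
@[simp] theorem sto_update_tmp_not :
    Function.update (sto d i m c x y) (.tmp !d) l = sto d i m c x l := by
  funext k
  cases k with
  | tmp e => cases d <;> cases e <;> simp [Function.update, sto]
  | _ => simp [Function.update, sto]

theorem space_sto :
    space (sto d i m c x y) = i.length + m.length + c.length + x.length + y.length := by
  have h : (Finset.univ : Finset Reg) = {.inp, .main, .cnt, .tmp d, .tmp !d} := by
    ext k
    cases k with
    | tmp e => cases d <;> cases e <;> simp
    | _ => simp
  unfold space
  rw [h]
  rw [Finset.sum_insert (by simp), Finset.sum_insert (by simp), Finset.sum_insert (by simp),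
    Finset.sum_insert (by simp), Finset.sum_singleton]
  simp
  omega
end sto

theorem Run.push' {B : ℕ} {k : Reg} {f : Option Token → Token} {v : Option Token} {S S' : Sto}
    (h : Function.update S k (f v :: S k) = S') (hs : space S ≤ B)
    (hs' : space S' ≤ B) : Run B (.push k f) v S v S' := by
  subst h; exact .push hs hs'

theorem Run.pop' {B : ℕ} {k : Reg} {v v' : Option Token} {S S' : Sto}
    (hv : (S k).head? = v') (h : Function.update S k (S k).tail = S')
    (hs : space S ≤ B) (hs' : space S' ≤ B) : Run B (.pop k) v S v' S' := by
  subst h hv; exact .pop hs hs'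

theorem Run.mono {B B' p v S v' S'} (h : Run B p v S v' S') (hB : B ≤ B') :
    Run B' p v S v' S' := by
  induction h with
  | skip h => exact .skip (h.trans hB)
  | push h h' => exact .push (h.trans hB) (h'.trans hB)
  | pop h h' => exact .pop (h.trans hB) (h'.trans hB)
  | seq _ _ ih1 ih2 => exact .seq ih1 ih2
  | ite_true hf _ ih => exact .ite_true hf ih
  | ite_false hf _ ih => exact .ite_false hf ih
  | loop_true hf _ _ ih1 ih2 => exact .loop_true hf ih1 ih2
  | loop_false hf h => exact .loop_false hf (h.trans hB)

/-! ### Moving data between stacks -/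

/-- Pop the stack `k` until it is empty, running `p` after each pop. -/
def Prog.drain (k : Reg) (p : Prog) : Prog :=
  .seq (.pop k) (.loop Option.isSome (.seq p (.pop k)))

/-- The family `F` is a loop invariant: `l` is still on the stack `k`, and `acc` lists the symbols
already processed, the latest first, whatever `p` has done with them. Moving, copying, discarding
and translating a stack are all instances. -/
theorem run_drain {B : ℕ} {k : Reg} {p : Prog} {F : List Token → List Token → Sto} {n : ℕ}
    (hk : ∀ l acc, F l acc k = l) (hu : ∀ l l' acc, Function.update (F l acc) k l' = F l' acc)
    (hB : ∀ l acc, l.length + acc.length ≤ n → space (F l acc) ≤ B)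
    (hp : ∀ t l acc, l.length + acc.length + 1 ≤ n →
      Run B p (some t) (F l acc) (some t) (F l (t :: acc)))
    (l acc : List Token) (v : Option Token) (hn : l.length + acc.length ≤ n) :
    Run B (.drain k p) v (F l acc) none (F [] (l.reverse ++ acc)) := by
  induction l generalizing acc v with
  | nil =>
    exact .seq (.pop' (by rw [hk]; rfl) (by rw [hk, hu]; rfl) (hB _ _ hn) (hB _ _ hn))
      (.loop_false rfl (hB _ _ hn))
  | cons t l ih =>
    simp only [List.length_cons] at hn
    have h1 := ih (t :: acc) (some t) (by simp only [List.length_cons]; omega)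
    cases h1 with
    | seq h2 h3 =>
      refine .seq (.pop' (v' := some t) (S' := F l acc) (by rw [hk]; rfl) (by rw [hk, hu]; rfl)
        (hB _ _ (by simp only [List.length_cons]; omega)) (hB _ _ (by omega))) ?_
      refine .loop_true rfl (.seq (hp t l acc (by omega)) h2) ?_
      simpa using h3

def topTok (v : Option Token) : Token := v.getD .star

def isOne (v : Option Token) : Bool := v = some (.bit true)

/-- Move the stack `.tmp d` onto the main stack. -/
def Prog.restore (d : Bool) : Prog := .drain (.tmp d) (.push .main topTok)

theorem run_restore {B : ℕ} {d : Bool} {i m c x y : List Token} {v : Option Token}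
    (hB : i.length + m.length + c.length + x.length + y.length ≤ B) :
    Run B (.restore d) v (sto d i m c x y) none (sto d i (x.reverse ++ m) c [] y) := by
  refine run_drain (F := fun l acc => sto d i acc c l y) (n := x.length + m.length)
    (by simp) (by simp) ?_ ?_ x m v (by omega)
  · intro l acc h
    rw [space_sto]; omega
  · intro t l acc h
    exact .push' (by simp [topTok]) (by rw [space_sto]; omega)
      (by rw [space_sto]; simp only [List.length_cons]; omega)

/-- Move the top term of the main stack to `.tmp d`, reversing it. -/
def Prog.take (d : Bool) : Prog :=
  .seq (.push .cnt fun _ => .bit true) (.seq (.pop .cnt)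
    (.loop Option.isSome (.seq (.pop .main) (.seq (.push (.tmp d) topTok)
      (.seq (.ite isOne (.seq (.push .cnt fun _ => .bit true) (.push .cnt fun _ => .bit true))
        .skip) (.pop .cnt))))))

/-- The end of a term in preorder is found by counting the subterms still owed: each symbol settles
one, and a `cons` adds two. The count is the stack `.cnt` together with the symbol just popped from
it. The claim is relative to the rest of the run, so that the two components of a `cons` can be
chained. -/
theorem run_take_loop {B : ℕ} {d : Bool} {i y : List Token} {v' : Option Token} {S' : Sto}
    (t : V) {m c x : List Token} {u : Option Token} (hu : u.isSome = true)
    (hB : i.length + (t.size + m.length) + (c.length + t.size + 1) + x.length + y.length ≤ B)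
    (h : Run B (.loop Option.isSome (.seq (.pop .main) (.seq (.push (.tmp d) topTok)
      (.seq (.ite isOne (.seq (.push .cnt fun _ => .bit true) (.push .cnt fun _ => .bit true))
        .skip) (.pop .cnt))))) c.head? (sto d i m c.tail (t.enc.reverse ++ x) y) v' S') :
    Run B (.loop Option.isSome (.seq (.pop .main) (.seq (.push (.tmp d) topTok)
      (.seq (.ite isOne (.seq (.push .cnt fun _ => .bit true) (.push .cnt fun _ => .bit true))
        .skip) (.pop .cnt))))) u (sto d i (t.enc ++ m) c x y) v' S' := by
  induction t generalizing m c x u with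
  | nil =>
    simp only [V.size_nil] at hB
    refine .loop_true hu (.seq (.pop' (v' := some (.bit false)) (S' := sto d i m c x y) ?_ ?_ ?_ ?_)
      (.seq (.push' (S' := sto d i m c (.bit false :: x) y) ?_ ?_ ?_)
        (.seq (.ite_false (by simp [isOne]) (.skip ?_)) (.pop' rfl rfl ?_ ?_)))) ?_
    case refine_11 => simpa [V.enc] using h
    all_goals try simp [V.enc, topTok]
    all_goals
      rw [space_sto]
      try simp only [List.length_cons, List.length_tail]
      omega
  | cons a b iha ihb =>
    simp only [V.size_cons] at hB
    refine .loop_true hu (.seq (.pop' (v' := some (.bit true))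
      (S' := sto d i (a.enc ++ b.enc ++ m) c x y) ?_ ?_ ?_ ?_)
      (.seq (.push' (S' := sto d i (a.enc ++ b.enc ++ m) c (.bit true :: x) y) ?_ ?_ ?_)
        (.seq (.ite_true rfl (.seq
          (.push' (S' := sto d i (a.enc ++ b.enc ++ m) (.bit true :: c) (.bit true :: x) y)
            ?_ ?_ ?_)
          (.push' (S' := sto d i (a.enc ++ b.enc ++ m) (.bit true :: .bit true :: c)
            (.bit true :: x) y) ?_ ?_ ?_)))
          (.pop' (v' := some (.bit true))
            (S' := sto d i (a.enc ++ b.enc ++ m) (.bit true :: c) (.bit true :: x) y)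
            ?_ ?_ ?_ ?_)))) ?_
    case refine_18 =>
      rw [List.append_assoc]
      refine iha rfl ?_ ?_
      · simp only [List.length_append, List.length_cons, V.length_enc]
        omega
      · refine ihb rfl ?_ ?_
        · simp only [List.length_append, List.length_cons, V.length_enc, List.length_tail,
            List.length_reverse]
          omega
        · simpa [V.enc] using h
    all_goals try simp [V.enc, topTok]
    all_goals
      rw [space_sto]
      simp only [List.length_cons, List.length_append, V.length_enc]
      omega

theorem run_take {B : ℕ} {d : Bool} (t : V) {i m x y : List Token} {v : Option Token}
    (hB : i.length + m.length + 2 * t.size + x.length + y.length + 1 ≤ B) :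
    Run B (.take d) v (sto d i (t.enc ++ m) [] x y) none
      (sto d i m [] (t.enc.reverse ++ x) y) := by
  -- Pushing and popping one symbol starts the count at one, held in the state.
  refine .seq (.push' (S' := sto d i (t.enc ++ m) [.bit true] x y) (by simp) ?_ ?_)
    (.seq (.pop' (v' := some (.bit true)) (S' := sto d i (t.enc ++ m) [] x y) (by simp) (by simp)
      ?_ ?_) (run_take_loop t rfl ?_ ?_))
  case refine_6 =>
    refine .loop_false rfl ?_
    rw [space_sto]
    simp only [List.length_append, List.length_reverse, V.length_enc, List.tail_nil,
      List.length_nil]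
    omega
  all_goals try rw [space_sto]
  all_goals
    have := t.size_pos
    simp only [List.length_append, V.length_enc, List.length_cons, List.length_nil]
    omega

/-- The standard shape of the stacks between operations: only `.main` is nonempty. -/
abbrev stk (m : List Token) : Sto := sto true [] m [] [] []

def Prog.drop : Prog := .seq (.take true) (.drain (.tmp true) .skip)

theorem run_drop {B : ℕ} (t : V) {m : List Token} {v : Option Token}
    (hB : m.length + 2 * t.size + 1 ≤ B) :
    Run B .drop v (stk (t.enc ++ m)) none (stk m) := by
  refine .seq (run_take t (by simpa using hB)) ?_
  refine run_drain (F := fun l _ => sto true [] m [] l []) (n := t.size)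
    (by simp) (by simp) ?_ ?_ _ [] _ (by simp)
  · intro l acc h
    rw [space_sto]; simp; omega
  · intro u l acc h
    refine .skip ?_
    rw [space_sto]; simp; omega

def Prog.swap : Prog :=
  .seq (.take true) (.seq (.take false) (.seq (.restore true) (.restore false)))

theorem run_swap {B : ℕ} (s t : V) {m : List Token} {v : Option Token}
    (hB : m.length + 2 * s.size + 2 * t.size + 1 ≤ B) :
    Run B .swap v (stk (s.enc ++ (t.enc ++ m))) none (stk (t.enc ++ (s.enc ++ m))) := by
  refine .seq (run_take s (by simp; omega)) (.seq (v' := none)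
    (S' := sto true [] m [] s.enc.reverse t.enc.reverse)
    ?_ (.seq (v' := none) (S' := sto true [] (s.enc ++ m) [] [] t.enc.reverse) ?_ ?_))
  · have h := sto_not true
    simp only [Bool.not_true] at h
    rw [← h, ← h]
    simpa using run_take (B := B) (d := false) (x := []) (y := s.enc.reverse) (i := []) t
      (by simp; omega)
  · simpa using run_restore (B := B) (d := true) (i := []) (m := m) (c := []) (x := s.enc.reverse)
      (y := t.enc.reverse) (by simp; omega)
  · have h := sto_not true
    simp only [Bool.not_true] at h
    unfold stk
    rw [← h, ← h]
    simpa using run_restore (B := B) (d := false) (i := []) (m := s.enc ++ m) (c := [])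
      (x := t.enc.reverse) (y := []) (by simp; omega)

def Prog.dup : Prog :=
  .seq (.take true) (.seq
    (.drain (.tmp true) (.seq (.push .main topTok) (.push (.tmp !true) topTok)))
    (.seq (.drain (.tmp !true) (.push (.tmp true) topTok)) (.restore true)))

theorem run_dup {B : ℕ} (t : V) {m : List Token} {v : Option Token}
    (hB : m.length + 2 * t.size + 1 ≤ B) :
    Run B .dup v (stk (t.enc ++ m)) none (stk (t.enc ++ (t.enc ++ m))) := by
  refine .seq (run_take t (by simp; omega)) (.seq (v' := none)
    (S' := sto true [] (t.enc ++ m) [] [] t.enc)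
    ?_ (.seq (v' := none) (S' := sto true [] (t.enc ++ m) [] t.enc.reverse []) ?_ ?_))
  · have := run_drain (B := B) (F := fun l acc => sto true [] (acc ++ m) [] l acc) (n := t.size)
      (k := .tmp true) (p := .seq (.push .main topTok) (.push (.tmp !true) topTok))
      (by simp) (by simp) ?_ ?_ (t.enc.reverse ++ []) [] none (by simp)
    · simpa using this
    · intro l acc h
      rw [space_sto]; simp; omega
    · intro u l acc h
      refine .seq (.push' (S' := sto true [] (u :: acc ++ m) [] l acc) (by simp [topTok]) ?_ ?_)
        (.push' (by rw [sto_update_tmp_not, sto_tmp_not]; rfl) ?_ ?_) <;>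
      · rw [space_sto]; simp; omega
  · have := run_drain (B := B) (F := fun l acc => sto true [] (t.enc ++ m) [] acc l) (n := t.size)
      (k := .tmp !true) (p := .push (.tmp true) topTok)
      (fun _ _ => sto_tmp_not ..) (fun _ _ _ => sto_update_tmp_not ..) ?_ ?_ t.enc [] none (by simp)
    · simpa using this
    · intro l acc h
      rw [space_sto]; simp; omega
    · intro u l acc h
      refine .push' (by rw [sto_update_tmp, sto_tmp]; rfl) ?_ ?_ <;>
      · rw [space_sto]; simp; omega
  · simpa using run_restore (B := B) (d := true) (i := []) (m := t.enc ++ m) (c := [])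
      (x := t.enc.reverse) (y := []) (by simp; omega)

/-! ### A while language on binary trees -/

inductive Code
  | id | nil | fst | snd
  | pair (c d : Code)
  | comp (c d : Code)
  | branch (c d : Code)
  | loop (c : Code)

/-- `Ev c x y B`: the program `c` started on `x` terminates with `y`, within space `B`. -/
inductive Ev : Code → V → V → ℕ → Prop
  | id {x B} : x.size ≤ B → Ev .id x x B
  | nil {x B} : 2 * x.size + 1 ≤ B → Ev .nil x .nil B
  | fst {x B} : 4 * x.size + 1 ≤ B → Ev .fst x x.fst B
  | snd {x B} : 4 * x.size + 1 ≤ B → Ev .snd x x.snd B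
  -- A copy of `x` lies underneath while `d` runs, and the result `z` lies underneath while `c`
  -- runs; hence the reduced bounds.
  | pair {c d x y z B} : Ev c x y (B - z.size) → Ev d x z (B - x.size) →
      2 * x.size + 2 * z.size + y.size + 1 ≤ B → Ev (.pair c d) x (.cons y z) B
  | comp {c d x y z B} : Ev d x y B → Ev c y z B → Ev (.comp c d) x z B
  | branch_nil {c d x y B} : Ev c x y B → 2 + x.size + 1 ≤ B → 3 + x.size ≤ B →
      Ev (.branch c d) (.cons .nil x) y B
  | branch_cons {c d a b x y B} : Ev d x y B → x.size + 2 * (V.cons a b).size + 1 ≤ B →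
      Ev (.branch c d) (.cons (.cons a b) x) y B
  | loop_nil {c x B} : x.fst = .nil → x.size ≤ B → Ev (.loop c) x x B
  | loop_cons {c x y z B} : x.fst ≠ .nil → x.size ≤ B → Ev c x y B → Ev (.loop c) y z B →
      Ev (.loop c) x z B

theorem Ev.mono {c x y B B'} (h : Ev c x y B) (hB : B ≤ B') : Ev c x y B' := by
  induction h generalizing B' with
  | id h => exact .id (by omega)
  | nil h => exact .nil (by omega)
  | fst h => exact .fst (by omega)
  | snd h => exact .snd (by omega)
  | pair _ _ h ih1 ih2 => exact .pair (ih1 (by omega)) (ih2 (by omega)) (by omega)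
  | comp _ _ ih1 ih2 => exact .comp (ih1 hB) (ih2 hB)
  | branch_nil _ h h' ih => exact .branch_nil (ih hB) (by omega) (by omega)
  | branch_cons _ h ih => exact .branch_cons (ih hB) (by omega)
  | loop_nil h h' => exact .loop_nil h (by omega)
  | loop_cons h h' _ _ ih1 ih2 => exact .loop_cons h (by omega) (ih1 hB) (ih2 hB)

/-- Pop the leading symbol of a term, and run `p` if there are components, else put it back. -/
def Prog.open (p : Prog) : Prog :=
  .seq (.pop .main) (.ite isOne p (.push .main fun _ => .bit false))

/-- Set the state to `some (.bit true)` iff the first component of the top term is not `nil`. -/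
def Prog.test : Prog :=
  .seq (.pop .main) (.ite isOne
    (.seq (.pop .main) (.seq (.push .main topTok) (.push .main fun _ => .bit true)))
    (.push .main topTok))

def Code.prog : Code → Prog
  | .id => .skip
  | .nil => .seq .drop (.push .main fun _ => .bit false)
  | .fst => Prog.open (.seq .swap .drop)
  | .snd => Prog.open .drop
  | .pair c d => .seq .dup (.seq d.prog (.seq .swap (.seq c.prog (.push .main fun _ => .bit true))))
  | .comp c d => .seq d.prog c.prog
  | .branch c d => .seq (.pop .main) (.seq (.pop .main) (.seq (.push .main topTok)
      (.ite isOne (.seq .drop d.prog) (.seq .drop c.prog))))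
  | .loop c => .seq .test (.loop isOne (.seq c.prog .test))

theorem stk_push {B : ℕ} {f : Option Token → Token} {t : Token} {v : Option Token}
    {m : List Token} (hf : f v = t) (h : m.length + 1 ≤ B) :
    Run B (.push .main f) v (stk m) v (stk (t :: m)) :=
  .push' (by simp [hf]) (by rw [space_sto]; simp; omega) (by rw [space_sto]; simp; omega)

theorem stk_pop {B : ℕ} {t : Token} {v : Option Token} {m : List Token}
    (h : m.length + 1 ≤ B) : Run B (.pop .main) v (stk (t :: m)) (some t) (stk m) :=
  .pop' (by simp) (by simp) (by rw [space_sto]; simp; omega) (by rw [space_sto]; simp; omega)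

theorem stk_skip {B : ℕ} {v : Option Token} {m : List Token}
    (h : m.length ≤ B) : Run B .skip v (stk m) v (stk m) :=
  .skip (by rw [space_sto]; simp; omega)

theorem run_test_true {B : ℕ} {x : V} (hx : x.fst ≠ .nil) {m : List Token} {v : Option Token}
    (h : x.size + m.length ≤ B) :
    Run B .test v (stk (x.enc ++ m)) (some (.bit true)) (stk (x.enc ++ m)) := by
  match x, hx with
  | .cons (.cons a b) c, _ =>
    simp only [V.size_cons] at h
    simp only [V.enc, List.cons_append, List.append_assoc]
    refine .seq (stk_pop ?_) (.ite_true rfl (.seq (stk_pop ?_) (.seq (stk_push rfl ?_)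
      (stk_push rfl ?_)))) <;> simp <;> omega

theorem run_test_false {B : ℕ} {x : V} (hx : x.fst = .nil) {m : List Token} {v : Option Token}
    (h : x.size + m.length ≤ B) :
    Run B .test v (stk (x.enc ++ m)) (some (.bit false)) (stk (x.enc ++ m)) := by
  match x, hx with
  | .nil, _ =>
    simp only [V.size_nil] at h
    simp only [V.enc, List.cons_append, List.nil_append]
    exact .seq (stk_pop (by omega)) (.ite_false (by simp [isOne]) (stk_push rfl (by omega)))
  | .cons .nil c, _ =>
    simp only [V.size_cons, V.size_nil] at h
    simp only [V.enc, List.cons_append, List.nil_append]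
    refine .seq (stk_pop ?_) (.ite_true rfl (.seq (stk_pop ?_) (.seq (stk_push rfl ?_)
      (stk_push rfl ?_)))) <;> simp <;> omega

/-- A program never looks below the top term, so the rest `m` of the stack only adds its length to
the space. In the case of `pair` this rest contains the value that waits. -/
theorem Ev.run {c x y B} (h : Ev c x y B) (m : List Token) (v : Option Token) :
    ∃ v', Run (B + m.length) c.prog v (stk (x.enc ++ m)) v' (stk (y.enc ++ m)) := by
  induction h generalizing m v with
  | id h => exact ⟨_, stk_skip (by simp; omega)⟩
  | nil h =>
    exact ⟨_, .seq (run_drop _ (by omega)) (stk_push rfl (by omega))⟩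
  | @fst x B h =>
    cases x with
    | nil =>
      simp only [V.size_nil] at h
      exact ⟨_, .seq (stk_pop (by simp; omega)) (.ite_false (by simp [isOne])
        (stk_push rfl (by simp; omega)))⟩
    | cons a b =>
      simp only [V.size_cons] at h
      refine ⟨none, .seq (stk_pop (by simp; omega)) (.ite_true rfl (.seq (v' := none)
        (S' := stk (b.enc ++ (a.enc ++ m))) ?_ (run_drop b (by simp; omega))))⟩
      change Run _ _ _ (stk (a.enc ++ b.enc ++ m)) _ _
      rw [List.append_assoc]
      exact run_swap a b (by omega)
  | @snd x B h =>
    cases x with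
    | nil =>
      simp only [V.size_nil] at h
      exact ⟨_, .seq (stk_pop (by simp; omega)) (.ite_false (by simp [isOne])
        (stk_push rfl (by simp; omega)))⟩
    | cons a b =>
      simp only [V.size_cons] at h
      refine ⟨none, .seq (stk_pop (by simp; omega)) (.ite_true rfl ?_)⟩
      change Run _ _ _ (stk (a.enc ++ b.enc ++ m)) _ _
      rw [List.append_assoc]
      exact run_drop a (by simp; omega)
  | @pair c d x y z B h1 h2 h ih1 ih2 =>
    obtain ⟨v2, r2⟩ := ih2 (x.enc ++ m) none
    obtain ⟨v1, r1⟩ := ih1 (z.enc ++ m) none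
    refine ⟨v1, .seq (run_dup x (by omega)) (.seq (r2.mono (by simp; omega)) (.seq
      (run_swap z x (by omega)) (.seq (r1.mono (by simp; omega)) ?_)))⟩
    simp only [V.enc, List.cons_append, List.append_assoc]
    exact stk_push rfl (by simp; omega)
  | comp _ _ ih1 ih2 =>
    obtain ⟨v1, r1⟩ := ih1 m v
    obtain ⟨v2, r2⟩ := ih2 m v1
    exact ⟨v2, .seq r1 r2⟩
  | @branch_nil c d x y B _ h h' ih =>
    obtain ⟨v', r⟩ := ih m none
    refine ⟨v', ?_⟩
    simp only [V.enc, List.cons_append, List.nil_append]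
    refine .seq (stk_pop ?_) (.seq (stk_pop ?_) (.seq (stk_push rfl ?_) (.ite_false
      (by simp [isOne]) (.seq (run_drop .nil ?_) r)))) <;> simp <;> omega
  | @branch_cons c d a b x y B _ h ih =>
    obtain ⟨v', r⟩ := ih m none
    simp only [V.size_cons] at h
    refine ⟨v', ?_⟩
    simp only [V.enc, List.cons_append, List.append_assoc]
    refine .seq (stk_pop ?_) (.seq (stk_pop ?_) (.seq (stk_push rfl ?_) (.ite_true rfl
      (.seq (v' := none) (S' := stk (x.enc ++ m)) ?_ r))))
    case refine_4 =>
      have := run_drop (B := B + m.length) (.cons a b) (m := x.enc ++ m)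
        (v := some (.bit true)) (by simp; omega)
      simpa [V.enc, topTok] using this
    all_goals simp; omega
  | loop_nil h h' =>
    exact ⟨_, .seq (run_test_false h (by omega))
      (.loop_false (by simp [isOne]) (by rw [space_sto]; simp; omega))⟩
  | loop_cons h h' _ _ ih1 ih2 =>
    obtain ⟨v1, r1⟩ := ih1 m (some (.bit true))
    obtain ⟨v2, r2⟩ := ih2 m v1
    cases r2 with
    | seq r3 r4 =>
      exact ⟨v2, .seq (run_test_true h (by omega)) (.loop_true rfl (.seq r1 r3) r4)⟩

theorem Ev.size_le {c x y B} (h : Ev c x y B) : x.size ≤ B ∧ y.size ≤ B := by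
  induction h with
  | fst h =>
    have := V.size_fst_le ‹V›
    omega
  | snd h =>
    have := V.size_snd_le ‹V›
    omega
  | _ => simp_all <;> omega

/-! ### Functions computable in polynomial space -/

theorem eval_le_eval (P : Polynomial ℕ) {m n : ℕ} (h : m ≤ n) : P.eval m ≤ P.eval n := by
  rw [Polynomial.eval_eq_sum_range, Polynomial.eval_eq_sum_range]
  gcongr

/-- Functions on binary trees computed by programs in polynomial space. -/
def PSF (f : V → V) : Prop :=
  ∃ (c : Code) (P : Polynomial ℕ), ∀ x, Ev c x (f x) (P.eval x.size)

open Polynomial in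
theorem psf_id : PSF fun x => x := ⟨.id, X, fun x => .id (by simp)⟩

open Polynomial in
theorem psf_nil : PSF fun _ => .nil := ⟨.nil, 2 * X + 1, fun x => .nil (by simp)⟩

open Polynomial in
-- An output is no larger than the space used to produce it, so the outer program starts on a tree
-- of polynomial size.
theorem PSF.comp {f g : V → V} (hf : PSF f) (hg : PSF g) : PSF fun x => f (g x) := by
  obtain ⟨c, P, hc⟩ := hf
  obtain ⟨d, Q, hd⟩ := hg
  refine ⟨.comp c d, P.comp Q + Q, fun x => ?_⟩
  have h1 := hd x
  have h2 := hc (g x)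
  simp only [eval_add, eval_comp]
  exact .comp (h1.mono (by omega)) (h2.mono ((eval_le_eval P h1.size_le.2).trans (by omega)))

open Polynomial in
theorem PSF.fst {f : V → V} (hf : PSF f) : PSF fun x => (f x).fst :=
  PSF.comp (f := V.fst) ⟨.fst, 4 * X + 1, fun x => .fst (by simp)⟩ hf

open Polynomial in
theorem PSF.snd {f : V → V} (hf : PSF f) : PSF fun x => (f x).snd :=
  PSF.comp (f := V.snd) ⟨.snd, 4 * X + 1, fun x => .snd (by simp)⟩ hf

open Polynomial in
theorem PSF.cons {f g : V → V} (hf : PSF f) (hg : PSF g) : PSF fun x => .cons (f x) (g x) := by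
  obtain ⟨c, P, hc⟩ := hf
  obtain ⟨d, Q, hd⟩ := hg
  refine ⟨.pair c d, 2 * X + 2 * Q + P + 1, fun x => ?_⟩
  have h1 := hd x
  have h2 := hc x
  have h3 := h1.size_le
  have h4 := h2.size_le
  simp only [eval_add, eval_mul, eval_X, eval_one, eval_ofNat]
  exact .pair (h2.mono (by omega)) (h1.mono (by omega)) (by omega)

open Polynomial in
theorem PSF.ite {f g h : V → V} (hf : PSF f) (hg : PSF g) (hh : PSF h) :
    PSF fun x => if f x = .nil then g x else h x := by
  obtain ⟨c, P, hc⟩ := hf.cons psf_id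
  obtain ⟨d, Q, hd⟩ := hg
  obtain ⟨e, R, he⟩ := hh
  refine ⟨.comp (.branch d e) c, 2 * P + Q + R + 1, fun x => ?_⟩
  have h1 := hc x
  have h2 := h1.size_le
  simp only [V.size_cons] at h2
  have h3 := (hd x).size_le
  simp only [eval_add, eval_mul, eval_one, eval_ofNat]
  refine .comp (y := .cons (f x) x) (h1.mono (by omega)) ?_
  cases hfx : f x with
  | nil =>
    simp only [hfx, V.size_nil] at h2
    rw [if_pos rfl]
    refine .branch_nil ((hd x).mono ?_) ?_ ?_ <;> omega
  | cons a b =>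
    rw [hfx] at h2
    rw [if_neg (by simp)]
    have h4 := (he x).size_le
    refine .branch_cons ((he x).mono ?_) ?_ <;> omega

theorem psf_const (v : V) : PSF fun _ => v := by
  induction v with
  | nil => exact psf_nil
  | cons a b iha ihb => exact iha.cons ihb

/-- Iterating `g` from `x` until the first component is `nil` ends at `y`, through trees of size
at most `N`. -/
inductive LoopTo (g : V → V) (N : ℕ) : V → V → Prop
  | halt {x} : x.fst = .nil → x.size ≤ N → LoopTo g N x x
  | step {x y} : x.fst ≠ .nil → x.size ≤ N → LoopTo g N (g x) y → LoopTo g N x y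

/-- The number of rounds is unrestricted: each round reuses the same space, so only the sizes of the
trees passed through count. -/
theorem PSF.loop {g i h : V → V} (hg : PSF g) (hi : PSF i) (P : Polynomial ℕ)
    (hh : ∀ x, LoopTo g (P.eval x.size) (i x) (h x)) : PSF h := by
  obtain ⟨c, Q, hc⟩ := hg
  obtain ⟨d, R, hd⟩ := hi
  refine ⟨.comp (.loop c) d, P + Q.comp P + R, fun x => ?_⟩
  have hx := hh x
  simp only [Polynomial.eval_add, Polynomial.eval_comp]
  refine .comp ((hd x).mono (by omega)) ?_
  generalize P.eval x.size = N at hx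
  generalize h x = y at hx
  generalize i x = z at hx
  induction hx with
  | halt h h' => exact .loop_nil h (by omega)
  | @step x y h h' _ ih =>
    exact .loop_cons h (by omega) ((hc x).mono ((eval_le_eval Q h').trans (by omega))) ih

/-! ### Equality of trees -/

namespace V

/-- The truth value `true`. -/
abbrev tt : V := cons nil nil

def ofBool (b : Bool) : V := if b then tt else nil

/-- Numbers in unary. -/
def num : ℕ → V
  | 0 => nil
  | n + 1 => cons nil (num n)

/-- The length of the right spine. -/
def len : V → ℕ
  | nil => 0
  | cons _ b => b.len + 1

@[simp] theorem size_num (n : ℕ) : (num n).size = 2 * n + 1 := by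
  induction n with
  | zero => rfl
  | succ n ih => simp [num, ih]; omega

@[simp] theorem len_num (n : ℕ) : (num n).len = n := by
  induction n with
  | zero => rfl
  | succ n ih => simp [num, len, ih]

theorem len_le_size (v : V) : 2 * v.len + 1 ≤ v.size := by
  induction v with
  | nil => simp [len]
  | cons a b _ ih =>
    have := a.size_pos
    simp only [len, size_cons]; omega

end V

open V

/-- The state holds a flag, the result and a stack of pairs still to be compared. -/
def eqStep (s : V) : V :=
  if s.snd.snd = nil then cons nil (cons tt nil)
  else if s.snd.snd.fst.fst = nil then
    (if s.snd.snd.fst.snd = nil then cons tt (cons nil s.snd.snd.snd) else cons nil (cons nil nil))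
  else if s.snd.snd.fst.snd = nil then cons nil (cons nil nil)
  else cons tt (cons nil (cons (cons s.snd.snd.fst.fst.fst s.snd.snd.fst.snd.fst)
    (cons (cons s.snd.snd.fst.fst.snd s.snd.snd.fst.snd.snd) s.snd.snd.snd)))

theorem psf_eqStep : PSF eqStep := by
  unfold eqStep
  repeat' first
    | exact psf_id | exact psf_const _ | refine PSF.ite ?_ ?_ ?_ | refine PSF.cons ?_ ?_
    | refine PSF.fst ?_ | refine PSF.snd ?_

theorem loopTo_eqStep {N : ℕ} {y : V} (a b work : V) (hN : a.size + b.size + work.size + 10 ≤ N)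
    (heq : a = b → LoopTo eqStep N (cons tt (cons nil work)) y)
    (hne : a ≠ b → y = cons nil (cons nil nil)) :
    LoopTo eqStep N (cons tt (cons nil (cons (cons a b) work))) y := by
  induction a generalizing b work with
  | nil =>
    cases b with
    | nil =>
      refine .step (by simp) (by simp at hN ⊢; omega) ?_
      simpa [eqStep] using heq rfl
    | cons b1 b2 =>
      refine .step (by simp) (by simp at hN ⊢; omega) ?_
      obtain rfl := hne (by simp)
      simp only [size_cons, size_nil] at hN
      exact .halt (by simp [eqStep]) (by simp [eqStep]; omega)
  | cons a1 a2 ih1 ih2 =>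
    cases b with
    | nil =>
      refine .step (by simp) (by simp at hN ⊢; omega) ?_
      obtain rfl := hne (by simp)
      simp only [size_cons, size_nil] at hN
      exact .halt (by simp [eqStep]) (by simp [eqStep]; omega)
    | cons b1 b2 =>
      refine .step (by simp) (by simp at hN ⊢; omega) ?_
      have : eqStep (cons tt (cons nil (cons (cons (cons a1 a2) (cons b1 b2)) work))) =
        cons tt (cons nil (cons (cons a1 b1) (cons (cons a2 b2) work))) := by simp [eqStep]
      rw [this]
      simp only [size_cons] at hN
      refine ih1 _ _ (by simp; omega) (fun h1 => ih2 _ _ (by omega) (fun h2 => ?_) fun h2 => ?_)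
        fun h1 => ?_
      · exact heq (by rw [h1, h2])
      · exact hne (by simp [h2])
      · exact hne (by simp [h1])

theorem psf_eq {f g : V → V} (hf : PSF f) (hg : PSF g) :
    PSF fun x => if f x = g x then tt else nil := by
  have h : PSF fun x => (cons nil (cons (if x.fst = x.snd then tt else nil) nil)) := by
    refine PSF.loop psf_eqStep (i := fun x => cons tt (cons nil (cons (cons x.fst x.snd) nil)))
      ?_ (2 * Polynomial.X + 20) fun x => ?_
    · exact (psf_const _).cons (psf_nil.cons ((psf_id.fst.cons psf_id.snd).cons psf_nil))
    · have h1 := x.size_fst_le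
      have h2 := x.size_snd_le
      simp only [Polynomial.eval_add, Polynomial.eval_mul, Polynomial.eval_ofNat, Polynomial.eval_X]
      refine loopTo_eqStep _ _ _ (by simp; omega) (fun h => ?_) fun h => by rw [if_neg h]
      rw [if_pos h]
      refine .step (by simp) (by simp) ?_
      exact .halt (by simp [eqStep]) (by simp [eqStep])
  exact (h.comp (hf.cons hg)).snd.fst

theorem PSF.ite_eq {f f' g h : V → V} (hf : PSF f) (hf' : PSF f') (hg : PSF g) (hh : PSF h) :
    PSF fun x => if f x = f' x then g x else h x := by
  have := PSF.ite (psf_eq hf hf') hh hg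
  refine cast (congrArg PSF (funext fun x => ?_)) this
  by_cases hx : f x = f' x <;> simp [hx]

/-! ### Multiplication in unary -/

/-- The state holds a flag, the outer counter, the inner counter, the second factor and a unary
accumulator. The inner counter is reloaded with the second factor once for each element of the outer
one. -/
def mulStep (s : V) : V :=
  if s.snd.snd.fst = nil then
    (if s.snd.fst = nil then cons nil s.snd.snd.snd.snd
    else cons tt (cons s.snd.fst.snd (cons s.snd.snd.snd.fst s.snd.snd.snd)))
  else cons tt (cons s.snd.fst (cons s.snd.snd.fst.snd
    (cons s.snd.snd.snd.fst (cons nil s.snd.snd.snd.snd))))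

theorem psf_mulStep : PSF mulStep := by
  unfold mulStep
  repeat' first
    | exact psf_id | exact psf_const _ | refine PSF.ite ?_ ?_ ?_ | refine PSF.cons ?_ ?_
    | refine PSF.fst ?_ | refine PSF.snd ?_

theorem loopTo_mulStep_inner {N : ℕ} {y u v : V} (w : V) (k : ℕ)
    (hN : u.size + v.size + w.size + 2 * (k + w.len) + 10 ≤ N)
    (h : LoopTo mulStep N (cons tt (cons u (cons nil (cons v (num (k + w.len)))))) y) :
    LoopTo mulStep N (cons tt (cons u (cons w (cons v (num k))))) y := by
  induction w generalizing k with
  | nil => simpa [len] using h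
  | cons a b _ ih =>
    simp only [len, size_cons] at hN h
    refine .step (by simp) (by simp; omega) ?_
    have := ih (k + 1) (by omega) (by rwa [show k + 1 + b.len = k + (b.len + 1) by omega])
    simpa [mulStep, num] using this

theorem loopTo_mulStep {N : ℕ} {y v : V} (u : V) (k : ℕ)
    (hN : u.size + 2 * v.size + 2 * (k + u.len * v.len) + 20 ≤ N)
    (h : LoopTo mulStep N (cons nil (num (k + u.len * v.len))) y) :
    LoopTo mulStep N (cons tt (cons u (cons nil (cons v (num k))))) y := by
  induction u generalizing k with
  | nil =>
    simp only [len, size_nil, zero_mul] at hN h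
    refine .step (by simp) (by simp; omega) ?_
    simpa [mulStep] using h
  | cons a b _ ih =>
    have e : (b.len + 1) * v.len = v.len + b.len * v.len := by ring
    simp only [len, size_cons, e] at hN h
    refine .step (by simp) (by simp; omega) ?_
    have := loopTo_mulStep_inner (u := b) (v := v) v k (by omega)
      (ih (k + v.len) (by omega) (by rwa [add_assoc]))
    simpa [mulStep] using this

theorem psf_mul {f g : V → V} (hf : PSF f) (hg : PSF g) :
    PSF fun x => num ((f x).len * (g x).len) := by
  have h : PSF fun x => cons nil (num (x.fst.len * x.snd.len)) := by
    refine PSF.loop psf_mulStep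
      (i := fun x => cons tt (cons x.fst (cons nil (cons x.snd nil))))
      ?_ (3 * Polynomial.X + 2 * (Polynomial.X * Polynomial.X) + 20) fun x => ?_
    · exact (psf_const _).cons (psf_id.fst.cons (psf_nil.cons (psf_id.snd.cons psf_nil)))
    · have h1 := x.size_fst_le
      have h2 := x.size_snd_le
      have h3 := x.fst.len_le_size
      have h4 := x.snd.len_le_size
      have h5 : x.fst.len * x.snd.len ≤ x.size * x.size := Nat.mul_le_mul (by omega) (by omega)
      simp only [Polynomial.eval_add, Polynomial.eval_mul, Polynomial.eval_ofNat, Polynomial.eval_X]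
      refine loopTo_mulStep (v := x.snd) x.fst 0 (by omega) ?_
      rw [zero_add]
      exact .halt (by simp) (by simp; omega)
  have h' := (h.comp (hf.cons hg)).snd
  simpa using h'

/-! ### Evaluation of and-or trees -/

/-- The value of the and-or tree of height `n` at `z`, with successors `f₀ z` and `f₁ z`; the node
`z` is a conjunction if `op z = nil`. -/
def win (op base f₀ f₁ : V → V) : ℕ → V → Bool
  | 0, z => base z ≠ nil
  | n + 1, z => if op z = nil then win op base f₀ f₁ n (f₀ z) && win op base f₀ f₁ n (f₁ z)
    else win op base f₀ f₁ n (f₀ z) || win op base f₀ f₁ n (f₁ z)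

section win
variable (op base f₀ f₁ : V → V)

/-- One step of the depth-first evaluation. The state consists of a mode (evaluate or return),
the returned value, the current node, its height and the stack of unfinished ancestors. -/
def winStep (s : V) : V :=
  if s.fst.fst = nil then
    (if s.snd.snd.snd.fst = nil then
      cons (cons tt nil) (cons (if base s.snd.snd.fst = nil then nil else tt)
        (cons nil (cons nil s.snd.snd.snd.snd)))
    else cons tt (cons nil (cons (f₀ s.snd.snd.fst) (cons s.snd.snd.snd.fst.snd
      (cons (cons s.snd.snd.snd.fst.snd s.snd.snd.fst) s.snd.snd.snd.snd)))))
  else if s.snd.snd.snd.snd = nil then cons nil s.snd.fst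
  else if op s.snd.snd.snd.snd.fst.snd = nil then
    (if s.snd.fst = nil then
      cons (cons tt nil) (cons nil (cons nil (cons nil s.snd.snd.snd.snd.snd)))
    -- The frame is removed before the second successor is evaluated. The first value was neutral,
    -- so the second one is the value of the parent, and a frame needs no mark telling which
    -- successor is in progress.
    else cons tt (cons nil (cons (f₁ s.snd.snd.snd.snd.fst.snd)
      (cons s.snd.snd.snd.snd.fst.fst s.snd.snd.snd.snd.snd))))
  else
    (if s.snd.fst = nil then
      cons tt (cons nil (cons (f₁ s.snd.snd.snd.snd.fst.snd)
        (cons s.snd.snd.snd.snd.fst.fst s.snd.snd.snd.snd.snd)))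
    else cons (cons tt nil) (cons tt (cons nil (cons nil s.snd.snd.snd.snd.snd))))

variable {op base f₀ f₁}

theorem psf_winStep (ho : PSF op) (hb : PSF base) (h₀ : PSF f₀) (h₁ : PSF f₁) :
    PSF (winStep op base f₀ f₁) := by
  unfold winStep
  repeat' first
    | exact psf_id | exact psf_const _ | refine PSF.ite ?_ ?_ ?_ | refine PSF.cons ?_ ?_
    | refine PSF.fst ?_ | refine PSF.snd ?_ | refine ho.comp ?_ | refine hb.comp ?_
    | refine h₀.comp ?_ | refine h₁.comp ?_

/-- At most `n` frames are pushed above `stk` at any time, each made of a node of size at most `Z`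
and a height, whence the product in the bound. It suffices to treat the return of the value of `z`
over the same stack. -/
theorem loopTo_winStep {N Z : ℕ} {Inv : V → Prop} (hI₀ : ∀ z, Inv z → Inv (f₀ z))
    (hI₁ : ∀ z, Inv z → Inv (f₁ z)) (hZ : ∀ z, Inv z → z.size ≤ Z) {y : V} (n : ℕ) (z stk : V)
    (hz : Inv z) (hN : stk.size + (n + 1) * (Z + 2 * n + 20) ≤ N)
    (h : LoopTo (winStep op base f₀ f₁) N
      (cons (cons tt nil) (cons (ofBool (win op base f₀ f₁ n z)) (cons nil (cons nil stk)))) y) :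
    LoopTo (winStep op base f₀ f₁) N (cons tt (cons nil (cons z (cons (num n) stk)))) y := by
  induction n generalizing z stk with
  | zero =>
    have := hZ z hz
    refine .step (by simp) (by simp at hN ⊢; omega) ?_
    by_cases hb : base z = nil <;> simpa [winStep, num, hb, win, ofBool] using h
  | succ n ih =>
    have hz' := hZ z hz
    have e : (n + 1 + 1) * (Z + 2 * (n + 1) + 20) =
      (n + 1) * (Z + 2 * n + 20) + 2 * (n + 1) + (Z + 2 * n + 22) := by ring
    rw [e] at hN
    have e2 : (n + 1) * (Z + 2 * n + 20) = n * (Z + 2 * n + 20) + Z + 2 * n + 20 := by ring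
    refine .step (by simp) (by simp; omega) ?_
    have hs : winStep op base f₀ f₁ (cons tt (cons nil (cons z (cons (num (n + 1)) stk)))) =
        cons tt (cons nil (cons (f₀ z) (cons (num n) (cons (cons (num n) z) stk)))) := by
      simp [winStep, num]
    rw [hs]
    refine ih _ _ (hI₀ z hz) (by simp; omega) ?_
    have h2 : LoopTo (winStep op base f₀ f₁) N
        (cons (cons tt nil) (cons (ofBool (win op base f₀ f₁ n (f₁ z)))
          (cons nil (cons nil stk)))) y →
        LoopTo (winStep op base f₀ f₁) N
          (cons tt (cons nil (cons (f₁ z) (cons (num n) stk)))) y :=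
      ih _ _ (hI₁ z hz) (by omega)
    refine .step (by simp) ?_ ?_
    · have : (ofBool (win op base f₀ f₁ n (f₀ z))).size ≤ 3 := by
        unfold ofBool; split_ifs <;> simp
      simp; omega
    · cases hw : win op base f₀ f₁ n (f₀ z) <;> by_cases hop : op z = nil <;>
        simp [win, hw, hop, ofBool] at h h2 <;> simp [winStep, hop, ofBool]
      · exact h
      · exact h2 h
      · exact h2 h
      · exact h

/-- And-or trees of polynomial height and with nodes of polynomial size can be evaluated in
polynomial space. -/
theorem psf_win {z₀ k : V → V} (ho : PSF op) (hb : PSF base) (h₀ : PSF f₀) (h₁ : PSF f₁)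
    (hz : PSF z₀) (hk : PSF k) (n : V → ℕ) (hn : ∀ x, k x = num (n x)) (Inv : V → V → Prop)
    (hI : ∀ x, Inv x (z₀ x)) (hI₀ : ∀ x z, Inv x z → Inv x (f₀ z))
    (hI₁ : ∀ x z, Inv x z → Inv x (f₁ z)) (Z : Polynomial ℕ)
    (hZ : ∀ x z, Inv x z → z.size ≤ Z.eval x.size) :
    PSF fun x => ofBool (win op base f₀ f₁ (n x) (z₀ x)) := by
  obtain ⟨c, Q, hc⟩ := id hk
  have h : PSF fun x => cons nil (ofBool (win op base f₀ f₁ (n x) (z₀ x))) := by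
    refine PSF.loop (psf_winStep ho hb h₀ h₁)
      (i := fun x => cons tt (cons nil (cons (z₀ x) (cons (k x) nil)))) ?_
      (1 + (Q + 1) * (Z + 2 * Q + 20)) fun x => ?_
    · exact (psf_const _).cons (psf_nil.cons (hz.cons (hk.cons psf_nil)))
    · have h1 := (hc x).size_le.2
      rw [hn x, size_num] at h1
      rw [hn x]
      simp only [Polynomial.eval_add, Polynomial.eval_mul, Polynomial.eval_ofNat,
        Polynomial.eval_one]
      refine loopTo_winStep (hI₀ x) (hI₁ x) (hZ x) (n x) _ _ (hI x) ?_ ?_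
      · simp only [size_nil]
        gcongr <;> omega
      · have : (ofBool (win op base f₀ f₁ (n x) (z₀ x))).size ≤ 3 := by
          unfold ofBool; split_ifs <;> simp
        have h3 : 1 * 20 ≤ (Q.eval x.size + 1) * (Z.eval x.size + 2 * Q.eval x.size + 20) :=
          Nat.mul_le_mul (by omega) (by omega)
        refine .step (by simp) (by simp; omega) ?_
        simpa [winStep] using LoopTo.halt (by simp) (by simp; omega)
  simpa using h.snd

end win

open V

/-! ### Horn clauses over binary trees -/

/-- Terms with variables. -/
inductive Tm
  | var (i : ℕ)
  | nil
  | cons (a b : Tm)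

def V.nth : V → ℕ → V
  | v, 0 => v.fst
  | v, i + 1 => v.snd.nth i

namespace Tm

/-- The instance of a term, the value of the variable `i` being the `i`-th entry of `θ`. -/
def inst : Tm → V → V
  | var i, θ => θ.nth i
  | nil, _ => .nil
  | cons a b, θ => .cons (a.inst θ) (b.inst θ)

def size : Tm → ℕ
  | var _ => 1
  | nil => 1
  | cons a b => a.size + b.size + 1

end Tm

theorem V.size_nth_le (v : V) (i : ℕ) : (v.nth i).size ≤ v.size := by
  induction i generalizing v with
  | zero => exact v.size_fst_le
  | succ i ih => exact (ih _).trans v.size_snd_le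

theorem Tm.size_inst_le (t : Tm) (θ : V) : (t.inst θ).size ≤ t.size * θ.size := by
  have hθ := θ.size_pos
  induction t with
  | var i => simpa [Tm.inst, Tm.size] using V.size_nth_le _ _
  | nil => simpa [Tm.inst, Tm.size, Nat.one_le_iff_ne_zero] using hθ.ne'
  | cons a b iha ihb =>
    simp only [Tm.inst, Tm.size, V.size_cons, add_mul, one_mul]
    omega

theorem PSF.nth {f : V → V} (hf : PSF f) (i : ℕ) : PSF fun x => (f x).nth i := by
  induction i generalizing f with
  | zero => exact hf.fst
  | succ i ih => exact ih hf.snd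

theorem PSF.inst {f : V → V} (hf : PSF f) (t : Tm) : PSF fun x => t.inst (f x) := by
  induction t with
  | var i => exact hf.nth i
  | nil => exact psf_nil
  | cons a b iha ihb => exact iha.cons ihb

/-- The clause `head :- body₁, body₂`. -/
structure Clause where
  head : Tm
  body₁ : Tm
  body₂ : Tm

def Clause.body (c : Clause) (b : Bool) : Tm := if b then c.body₂ else c.body₁

/-- `Drv cs m n g`: the goal `g` has a derivation of height exactly `n` from the axiom `V.tt`,
by instances of clauses of `cs` with values of size at most `m`. -/
inductive Drv (cs : List Clause) (m : ℕ) : ℕ → V → Prop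
  | axm : Drv cs m 0 tt
  | step {n : ℕ} {c : Clause} {θ : V} (hc : c ∈ cs) (hθ : θ.size + 2 * cs.length + 2 ≤ m)
      (h₁ : Drv cs m n (c.body₁.inst θ)) (h₂ : Drv cs m n (c.body₂.inst θ)) :
      Drv cs m (n + 1) (c.head.inst θ)

/-! ### Bounded derivability as an and-or tree -/

/-- The body of the instance by `θ` of the clause with number `i`, if its head is `g`. -/
def bodyOf (b : Bool) : List Clause → V → V → V → V
  | [], _, _, _ => .nil
  | c :: cs, i, θ, g =>
    if i = .nil then (if c.head.inst θ = g then (c.body b).inst θ else .nil)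
    else bodyOf b cs i.snd θ g

theorem psf_bodyOf (b : Bool) (cs : List Clause) {f₁ f₂ f₃ : V → V} (h₁ : PSF f₁) (h₂ : PSF f₂)
    (h₃ : PSF f₃) : PSF fun x => bodyOf b cs (f₁ x) (f₂ x) (f₃ x) := by
  induction cs generalizing f₁ with
  | nil => exact psf_nil
  | cons c cs ih =>
    exact h₁.ite (PSF.ite_eq (h₂.inst _) h₃ (h₂.inst _) psf_nil) (ih h₁.snd)

theorem bodyOf_num {cs : List Clause} {i : ℕ} {c : Clause} (h : cs[i]? = some c) (b : Bool)
    (θ : V) : bodyOf b cs (num i) θ (c.head.inst θ) = (c.body b).inst θ := by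
  induction cs generalizing i with
  | nil => simp at h
  | cons d cs ih =>
    cases i with
    | zero =>
      simp only [List.getElem?_cons_zero, Option.some.injEq] at h
      simp [bodyOf, num, h]
    | succ i => simpa [bodyOf, num] using ih (by simpa using h)

/-- The value `nil` marks a guess that does not fit. It is not a goal with a meaning, so such a
guess loses the game. -/
theorem bodyOf_cases (cs : List Clause) (i θ g : V) :
    (∀ b, bodyOf b cs i θ g = .nil) ∨
      ∃ c ∈ cs, c.head.inst θ = g ∧ ∀ b, bodyOf b cs i θ g = (c.body b).inst θ := by
  induction cs generalizing i with
  | nil => exact .inl fun b => rfl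
  | cons c cs ih =>
    by_cases hi : i = .nil
    · by_cases hc : c.head.inst θ = g
      · exact .inr ⟨c, by simp, hc, fun b => by simp [bodyOf, hi, hc]⟩
      · exact .inl fun b => by simp [bodyOf, hi, hc]
    · rcases ih i.snd with h | ⟨d, hd, hg, hb⟩
      · exact .inl fun b => by simpa [bodyOf, hi] using h b
      · exact .inr ⟨d, by simp [hd], hg, fun b => by simpa [bodyOf, hi] using hb b⟩

/-- Building a tree bit by bit on a stack. -/
def pushBit (b : Bool) (st : V) : V :=
  if b then .cons (.cons st.fst st.snd.fst) st.snd.snd else .cons .nil st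

/-- This is postfix order with the second component first: when the final `true` is read, `a` is on
top of the stack and `b` just below it, as `pushBit` expects. -/
def V.bits : V → List Bool
  | .nil => [false]
  | .cons a b => b.bits ++ (a.bits ++ [true])

theorem V.length_bits (v : V) : v.bits.length = v.size := by
  induction v with
  | nil => rfl
  | cons a b iha ihb => simp [V.bits, iha, ihb]; omega

theorem foldl_pushBit (v st : V) : v.bits.foldl (fun s b => pushBit b s) st = .cons v st := by
  induction v generalizing st with
  | nil => rfl
  | cons a b iha ihb => simp only [V.bits, List.foldl_append, iha, ihb]; simp [pushBit]

/-- Positions of the game: a clause instance refuting or confirming the goal `g` is guessed bit by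
bit, `j` bits being left, and then one of its two body goals is chosen. -/
def pos (M j : ℕ) (st g : V) : V := .cons (num M) (.cons (num j) (.cons st g))

/-- This is the number of bits still to be guessed. When it is zero the node is a conjunction, where
the opponent picks a body goal; all other nodes are guesses, hence disjunctions. -/
def posOp (z : V) : V := z.snd.fst

def posBase (z : V) : V := if z.snd.snd.snd = tt then tt else .nil

/-- Once all bits are guessed, the top of the stack is read as a pair of a clause number and a
substitution, and the bit counter is reset for the next round. -/
def posNext (cs : List Clause) (b : Bool) (z : V) : V :=
  if z.snd.fst = .nil then
    .cons z.fst (.cons z.fst (.cons .nil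
      (bodyOf b cs z.snd.snd.fst.fst.fst z.snd.snd.fst.fst.snd z.snd.snd.snd)))
  else .cons z.fst (.cons z.snd.fst.snd (.cons (pushBit b z.snd.snd.fst) z.snd.snd.snd))

theorem posNext_succ (cs : List Clause) (b : Bool) (M j : ℕ) (st g : V) :
    posNext cs b (pos M (j + 1) st g) = pos M j (pushBit b st) g := by
  simp [posNext, pos, num]

theorem posNext_zero (cs : List Clause) (b : Bool) (M : ℕ) (st g : V) :
    posNext cs b (pos M 0 st g) = pos M M .nil (bodyOf b cs st.fst.fst st.fst.snd g) := by
  simp [posNext, pos, num]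

theorem psf_posOp : PSF posOp := psf_id.snd.fst

theorem psf_posBase : PSF posBase :=
  PSF.ite_eq psf_id.snd.snd.snd (psf_const _) (psf_const _) psf_nil

theorem psf_posNext (cs : List Clause) (b : Bool) : PSF (posNext cs b) := by
  refine PSF.ite psf_id.snd.fst ?_ ?_
  · exact psf_id.fst.cons (psf_id.fst.cons (psf_nil.cons
      (psf_bodyOf b cs psf_id.snd.snd.fst.fst.fst psf_id.snd.snd.fst.fst.snd psf_id.snd.snd.snd)))
  · refine psf_id.fst.cons (psf_id.snd.fst.snd.cons (PSF.cons ?_ psf_id.snd.snd.snd))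
    cases b
    · exact psf_nil.cons psf_id.snd.snd.fst
    · exact (psf_id.snd.snd.fst.fst.cons psf_id.snd.snd.fst.snd.fst).cons
        psf_id.snd.snd.fst.snd.snd

abbrev game (cs : List Clause) : ℕ → V → Bool :=
  win posOp posBase (posNext cs false) (posNext cs true)

theorem game_guess (cs : List Clause) (M j k : ℕ) (st g : V) :
    game cs (j + k) (pos M j st g) = true ↔ ∃ l : List Bool, l.length = j ∧
      game cs k (pos M 0 (l.foldl (fun s b => pushBit b s) st) g) = true := by
  induction j generalizing st with
  | zero =>
    rw [zero_add]
    constructor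
    · exact fun h => ⟨[], rfl, h⟩
    · rintro ⟨l, hl, h⟩
      rw [List.length_eq_zero_iff.1 hl] at h
      exact h
  | succ j ih =>
    rw [show j + 1 + k = (j + k) + 1 by omega]
    have hop : posOp (pos M (j + 1) st g) ≠ .nil := by simp [posOp, pos, num]
    simp only [game, win, if_neg hop, posNext_succ, Bool.or_eq_true]
    rw [ih, ih]
    constructor
    · rintro (⟨l, hl, h⟩ | ⟨l, hl, h⟩)
      · exact ⟨false :: l, by simp [hl], h⟩
      · exact ⟨true :: l, by simp [hl], h⟩
    · rintro ⟨_ | ⟨b, l⟩, hl, h⟩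
      · simp at hl
      · simp only [List.length_cons, Nat.add_right_cancel_iff] at hl
        cases b
        · exact .inl ⟨l, hl, h⟩
        · exact .inr ⟨l, hl, h⟩

theorem game_choose (cs : List Clause) (M k : ℕ) (st g : V) :
    game cs (k + 1) (pos M 0 st g) = true ↔
      ∀ b, game cs k (pos M M .nil (bodyOf b cs st.fst.fst st.fst.snd g)) = true := by
  have hop : posOp (pos M 0 st g) = .nil := by simp [posOp, pos, num]
  simp only [game, win, if_pos hop, posNext_zero, Bool.and_eq_true, Bool.forall_bool]

/-- Decides derivability in height and size at most `M`. -/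
def solve (cs : List Clause) (M : ℕ) (g : V) : Bool :=
  game cs (M * (M + 1)) (pos M M .nil g)

theorem game_of_drv {cs : List Clause} {M n : ℕ} {g : V} (h : Drv cs M n g) :
    game cs (n * (M + 1)) (pos M M .nil g) = true := by
  induction h with
  | axm => simp [win, posBase, pos]
  | @step n c θ hc hθ h₁ h₂ ih₁ ih₂ =>
    obtain ⟨i, hi⟩ := List.mem_iff_getElem?.1 hc
    have hlen : i < cs.length := by
      by_contra hcon
      rw [List.getElem?_eq_none (by omega)] at hi
      simp at hi
    -- The term `2 * cs.length + 2` in `Drv.step` pays for the clause number paired with `θ`.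
    have hz : (V.cons (num i) θ).size ≤ M := by simp; omega
    rw [show (n + 1) * (M + 1) = M + (n * (M + 1) + 1) by ring, game_guess]
    -- Leading `false` bits bring the guess to exactly `M` bits. They leave copies of `nil` at the
    -- bottom of the stack, where nothing is read.
    refine ⟨List.replicate (M - (V.cons (num i) θ).size) false ++ (V.cons (num i) θ).bits, ?_, ?_⟩
    · rw [List.length_append, List.length_replicate, V.length_bits]
      omega
    · rw [List.foldl_append, foldl_pushBit, game_choose]
      intro b
      simp only [V.fst_cons, V.snd_cons]
      rw [bodyOf_num hi]
      cases b
      · exact ih₁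
      · exact ih₂

/-- Whatever was guessed, either it is a clause instance with head `g`, both of whose body goals are
won again, or the next goal is `nil`. Size bounds play no role in this direction. -/
theorem drv_sound_of_game {cs : List Clause} {D : V → Prop} (hnil : ¬ D .nil) (htt : D tt)
    (hD : ∀ c ∈ cs, ∀ θ, D (c.body₁.inst θ) → D (c.body₂.inst θ) → D (c.head.inst θ))
    {M n : ℕ} {g : V} (h : game cs (n * (M + 1)) (pos M M .nil g) = true) : D g := by
  induction n generalizing g with
  | zero =>
    by_cases hg : g = tt
    · exact hg ▸ htt
    · simp [win, posBase, pos, hg] at h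
  | succ n ih =>
    rw [show (n + 1) * (M + 1) = M + (n * (M + 1) + 1) by ring, game_guess] at h
    obtain ⟨l, -, h⟩ := h
    rw [game_choose] at h
    generalize (l.foldl (fun s b => pushBit b s) .nil) = st at h
    rcases bodyOf_cases cs st.fst.fst st.fst.snd g with h' | ⟨c, hc, hg, h'⟩
    · have := ih (h true)
      rw [h' true] at this
      exact absurd this hnil
    · rw [← hg]
      have h1 := ih (h false)
      have h2 := ih (h true)
      rw [h'] at h1 h2
      exact hD c hc _ h1 h2

theorem solve_sound {cs : List Clause} {D : V → Prop} (hnil : ¬ D .nil) (htt : D tt)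
    (hD : ∀ c ∈ cs, ∀ θ, D (c.body₁.inst θ) → D (c.body₂.inst θ) → D (c.head.inst θ))
    {M : ℕ} {g : V} (h : solve cs M g = true) : D g :=
  drv_sound_of_game hnil htt hD h

theorem size_bodyOf_le {cs : List Clause} {C : ℕ}
    (hC : ∀ c ∈ cs, c.body₁.size ≤ C ∧ c.body₂.size ≤ C) (b : Bool) (i θ g : V) :
    (bodyOf b cs i θ g).size ≤ C * θ.size + 1 := by
  rcases bodyOf_cases cs i θ g with h | ⟨c, hc, -, h⟩
  · simp [h]
  · rw [h]
    refine ((c.body b).size_inst_le θ).trans (Nat.le_succ_of_le (Nat.mul_le_mul_right _ ?_))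
    have := hC c hc
    cases b
    · exact this.1
    · exact this.2

/-- The worst case is `true` on the empty stack, where both missing components are supplied as
`nil`. -/
theorem size_pushBit_le (b : Bool) (st : V) : (pushBit b st).size ≤ st.size + 4 := by
  unfold pushBit
  cases b
  · simp; omega
  · match st with
    | .nil => simp
    | .cons a .nil => simp
    | .cons a (.cons c d) => simp; omega

theorem psf_solve (cs : List Clause) {f g : V → V} (hf : PSF f) (hg : PSF g) :
    PSF fun x => ofBool (solve cs (f x).len (g x)) := by
  obtain ⟨C, hC⟩ : ∃ C, ∀ c ∈ cs, c.body₁.size ≤ C ∧ c.body₂.size ≤ C := by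
    induction cs with
    | nil => exact ⟨0, by simp⟩
    | cons c cs ih =>
      obtain ⟨C, hC⟩ := ih
      refine ⟨C + c.body₁.size + c.body₂.size, fun d hd => ?_⟩
      rcases List.mem_cons.1 hd with rfl | hd
      · omega
      · have := hC d hd
        omega
  -- Multiplication by one turns an arbitrary list into the unary numeral of its length.
  have hn : PSF fun x => num (f x).len := by
    have := psf_mul hf (psf_const (num 1))
    simpa using this
  obtain ⟨_, P, hP⟩ := id hf
  obtain ⟨_, Q, hQ⟩ := id hg
  have hfu : PSF fun x => num ((f x).len * ((f x).len + 1)) := by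
    have := psf_mul hf (psf_nil.cons hf)
    simpa [len] using this
  refine psf_win (z₀ := fun x => pos (f x).len (f x).len .nil (g x))
    (n := fun x => (f x).len * ((f x).len + 1))
    psf_posOp psf_posBase (psf_posNext cs false) (psf_posNext cs true)
    (hn.cons (hn.cons (psf_nil.cons hg))) hfu (fun x => rfl)
    -- The stack grows by at most four per guessed bit. A new goal is an instance by the guessed
    -- substitution and does not depend on the size of the old goal, so sizes do not accumulate over
    -- the rounds.
    (fun x z => ∃ j st h, z = pos (f x).len j st h ∧ j ≤ (f x).len ∧
      st.size + 4 * j ≤ 4 * (f x).len + 1 ∧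
      h.size ≤ (g x).size + (C * (4 * (f x).len + 1) + 1)) ?_ ?_ ?_
    (4 * P + 4 * P + Q + (C : Polynomial ℕ) * (4 * P + 1) + 20) ?_
  · exact fun x => ⟨_, _, _, rfl, le_rfl, by simp; omega, by omega⟩
  · rintro x _ ⟨j, st, h, rfl, hj, hst, hh⟩
    cases j with
    | zero =>
      rw [posNext_zero]
      refine ⟨_, _, _, rfl, le_rfl, by simp; omega, (size_bodyOf_le hC _ _ _ _).trans ?_⟩
      have : st.fst.snd.size ≤ 4 * (f x).len + 1 :=
        (st.fst.size_snd_le.trans st.size_fst_le).trans (by omega)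
      have := Nat.mul_le_mul_left C this
      omega
    | succ j =>
      rw [posNext_succ]
      have := size_pushBit_le false st
      exact ⟨_, _, _, rfl, by omega, by omega, hh⟩
  · rintro x _ ⟨j, st, h, rfl, hj, hst, hh⟩
    cases j with
    | zero =>
      rw [posNext_zero]
      refine ⟨_, _, _, rfl, le_rfl, by simp; omega, (size_bodyOf_le hC _ _ _ _).trans ?_⟩
      have : st.fst.snd.size ≤ 4 * (f x).len + 1 :=
        (st.fst.size_snd_le.trans st.size_fst_le).trans (by omega)
      have := Nat.mul_le_mul_left C this
      omega
    | succ j =>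
      rw [posNext_succ]
      have := size_pushBit_le true st
      exact ⟨_, _, _, rfl, by omega, by omega, hh⟩
  · rintro x _ ⟨j, st, h, rfl, hj, hst, hh⟩
    have h1 := (hP x).size_le.2
    have h2 := (hQ x).size_le.2
    have h3 := (f x).len_le_size
    have h4 : C * (4 * (f x).len + 1) ≤ C * (4 * P.eval x.size + 1) := by gcongr; omega
    simp only [pos, size_cons, size_num, Polynomial.eval_add, Polynomial.eval_mul,
      Polynomial.eval_ofNat, Polynomial.eval_one, Polynomial.eval_natCast, Nat.cast_id]
    omega

/-- The game has a fixed length, so `Drv` demands that all branches have equal height. The trivial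
clause lengthens a derivation at its leaves. -/
theorem Drv.mono_height {cs : List Clause} {m n n' : ℕ} {g : V}
    (ht : ⟨.cons .nil .nil, .cons .nil .nil, .cons .nil .nil⟩ ∈ cs) (hm : 2 * cs.length + 3 ≤ m)
    (h : Drv cs m n g) (hn : n ≤ n') : Drv cs m n' g := by
  induction h generalizing n' with
  | axm =>
    clear hn
    induction n' with
    | zero => exact .axm
    | succ n ih => exact .step (θ := .nil) ht (by simp; omega) ih ih
  | step hc hθ _ _ ih₁ ih₂ =>
    obtain ⟨k, rfl⟩ : ∃ k, n' = k + 1 := ⟨n' - 1, by omega⟩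
    exact .step hc hθ (ih₁ (by omega)) (ih₂ (by omega))

/-! ### Rose trees -/

/-- Finite ordered labelled trees, as an inductive type. -/
inductive RT
  | node (a : Label) (cs : List RT)

namespace RT

def lab : RT → Label
  | node a _ => a

def children : RT → List RT
  | node _ cs => cs

def Child (T c : RT) : Prop := c ∈ T.children

def Rel : Axis → RT → RT → Prop
  | .self, T, c => c = T
  | .child, T, c => T.Child c
  | .descendant, T, c => Relation.TransGen Child T c

/-- The subtree at a vertex. -/
def sub : RT → Vertex → Option RT
  | T, [] => some T
  | T, i :: v => T.children[i]?.bind fun c => c.sub v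

theorem sub_append (T : RT) (u v : Vertex) : T.sub (u ++ v) = (T.sub u).bind fun c => c.sub v := by
  induction u generalizing T with
  | nil => rfl
  | cons i u ih =>
    simp only [List.cons_append, sub]
    cases T.children[i]? with
    | none => rfl
    | some c => exact ih c

theorem sub_concat (T : RT) (u : Vertex) (i : ℕ) :
    T.sub (u ++ [i]) = (T.sub u).bind fun c => c.children[i]? := by
  rw [sub_append]
  simp [sub]

theorem finite_sub : (T : RT) → {v | T.sub v ≠ none}.Finite
  | node a cs => by
    have h : ∀ i : Fin cs.length, {v | cs[i].sub v ≠ none}.Finite := fun i => finite_sub cs[i]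
    refine ((Set.finite_singleton []).union
      (Set.finite_iUnion fun i : Fin cs.length => (h i).image (List.cons (i : ℕ)))).subset ?_
    rintro (_ | ⟨i, v⟩) hv
    · exact .inl rfl
    · refine .inr (Set.mem_iUnion.2 ?_)
      simp only [sub, children, Set.mem_ofPred_eq] at hv
      by_cases hi : i < cs.length
      · refine ⟨⟨i, hi⟩, v, ?_, rfl⟩
        simpa [List.getElem?_eq_getElem hi] using hv
      · simp [List.getElem?_eq_none (not_lt.1 hi)] at hv
termination_by T => sizeOf T
decreasing_by
  have := List.sizeOf_lt_of_mem (List.getElem_mem i.2)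
  simp only [Fin.getElem_fin, node.sizeOf_spec]
  omega

/-- Only this direction is needed: countermodels built by the program are rose trees, whereas a
given countermodel is used directly through its vertices. -/
noncomputable def toXML (T : RT) : XMLTree where
  dom := T.finite_sub.toFinset
  root_mem := by simp [sub]
  parent_mem v i h := by
    simp only [Set.Finite.mem_toFinset, Set.mem_ofPred_eq, sub_concat] at h ⊢
    intro h'
    simp [h'] at h
  sibling_mem v i h := by
    simp only [Set.Finite.mem_toFinset, Set.mem_ofPred_eq, sub_concat] at h ⊢
    cases hv : T.sub v with
    | none => simp [hv] at h
    | some c =>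
      simp only [hv, Option.bind_some, ne_eq, List.getElem?_eq_none_iff, not_le] at h ⊢
      omega
  lab v := ((T.sub v).map RT.lab).getD []

theorem mem_toXML {T : RT} {v : Vertex} : v ∈ T.toXML.dom ↔ ∃ U, T.sub v = some U := by
  simp [toXML, Option.ne_none_iff_exists']

theorem lab_toXML {T U : RT} {v : Vertex} (h : T.sub v = some U) : T.toXML.lab v = U.lab := by
  simp [toXML, h]

theorem transGen_child_iff {T U : RT} :
    Relation.TransGen Child T U ↔ ∃ w : Vertex, w ≠ [] ∧ T.sub w = some U := by
  constructor
  · intro h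
    induction h with
    | single h =>
      obtain ⟨i, hi⟩ := List.mem_iff_getElem?.1 h
      exact ⟨[i], by simp, by simp [sub, hi]⟩
    | tail _ h ih =>
      obtain ⟨i, hi⟩ := List.mem_iff_getElem?.1 h
      obtain ⟨w, hw, hs⟩ := ih
      exact ⟨w ++ [i], by simp, by simp [sub_concat, hs, hi]⟩
  · rintro ⟨w, hw, hs⟩
    induction w using List.reverseRecOn generalizing U with
    | nil => exact absurd rfl hw
    | append_singleton w i ih =>
      rw [sub_concat] at hs
      cases hT : T.sub w with
      | none => simp [hT] at hs
      | some W =>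
        simp only [hT, Option.bind_some] at hs
        have hc : W.Child U := List.mem_of_getElem? hs
        by_cases hw' : w = []
        · subst hw'
          simp only [sub, Option.some.injEq] at hT
          subst hT
          exact .single hc
        · exact .tail (ih hw' hT) hc

theorem rel_iff {T U W : RT} {v : Vertex} (hv : T.sub v = some U) (ax : Axis) :
    Rel ax U W ↔ ∃ w, ax.Rel v w ∧ T.sub w = some W := by
  cases ax with
  | self =>
    simp only [Rel, Axis.Rel]
    constructor
    · rintro rfl; exact ⟨v, rfl, hv⟩
    · rintro ⟨w, rfl, hw⟩
      rw [hv] at hw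
      exact (Option.some.inj hw).symm
  | child =>
    simp only [Rel, Axis.Rel, Child]
    constructor
    · intro h
      obtain ⟨i, hi⟩ := List.mem_iff_getElem?.1 h
      exact ⟨_, ⟨i, rfl⟩, by simp [sub_concat, hv, hi]⟩
    · rintro ⟨_, ⟨i, rfl⟩, h⟩
      simp only [sub_concat, hv, Option.bind_some] at h
      exact List.mem_of_getElem? h
  | descendant =>
    simp only [Rel, Axis.Rel, transGen_child_iff]
    constructor
    · rintro ⟨w, hw, h⟩
      exact ⟨_, ⟨w, hw, rfl⟩, by simp [sub_append, hv, h]⟩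
    · rintro ⟨_, ⟨w, hw, rfl⟩, h⟩
      simp only [sub_append, hv, Option.bind_some] at h
      exact ⟨w, hw, h⟩

end RT

/-! ### Expressions as predicate transformers -/

mutual
/-- `p.Pre K T`: from the root of `T` the path `p` reaches a subtree satisfying `K`. -/
def LPath.Pre : LPath → (RT → Prop) → RT → Prop
  | .step s, K, T => s.Pre K T
  | .seq p q, K, T => p.Pre (fun c => q.Pre K c) T
  | .union p q, K, T => p.Pre K T ∨ q.Pre K T
def LStep.Pre : LStep → (RT → Prop) → RT → Prop
  | .base a n, K, T => ∃ c, RT.Rel a T c ∧ n.Holds c.lab ∧ K c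
  | .filter s e, K, T => s.Pre (fun c => K c ∧ e.Pre (fun _ => True) c) T
def FExpr.Pre : FExpr → (RT → Prop) → RT → Prop
  | .path p, K, T => p.Pre K T
  | .or p q, K, T => p.Pre K T ∨ q.Pre K T
end

mutual
theorem LPath.mem_dom_of_sem {t : XMLTree} : ∀ (p : LPath) {u v : Vertex}, p.Sem t u v → v ∈ t.dom
  | .step s, u, v, h => by
    simp only [LPath.Sem] at h
    exact s.mem_dom_of_sem h
  | .seq p q, u, v, h => by
    simp only [LPath.Sem] at h
    obtain ⟨w, -, h⟩ := h
    exact q.mem_dom_of_sem h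
  | .union p q, u, v, h => by
    simp only [LPath.Sem] at h
    exact h.elim p.mem_dom_of_sem q.mem_dom_of_sem
theorem LStep.mem_dom_of_sem {t : XMLTree} : ∀ (s : LStep) {u v : Vertex}, s.Sem t u v → v ∈ t.dom
  | .base a n, u, v, h => by
    simp only [LStep.Sem] at h
    exact h.2.1
  | .filter s e, u, v, h => by
    simp only [LStep.Sem] at h
    exact s.mem_dom_of_sem h.1
end

mutual
-- All axes lead downwards, so what is reached from a vertex depends only on the subtree there. This
-- replaces vertices by trees, which can be extended and glued freely.
theorem LPath.pre_iff {T : RT} : ∀ (p : LPath) {K : RT → Prop} {v : Vertex} {U : RT},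
    T.sub v = some U → (p.Pre K U ↔ ∃ w W, p.Sem T.toXML v w ∧ T.sub w = some W ∧ K W)
  | .step s, K, v, U, h => by
    simp only [LPath.Pre, LPath.Sem]
    exact s.pre_iff h
  | .seq p q, K, v, U, h => by
    simp only [LPath.Pre, LPath.Sem]
    rw [p.pre_iff h]
    constructor
    · rintro ⟨w, W, h1, h2, h3⟩
      rw [q.pre_iff h2] at h3
      obtain ⟨x, X, h4, h5, h6⟩ := h3
      exact ⟨x, X, ⟨w, h1, h4⟩, h5, h6⟩
    · rintro ⟨x, X, ⟨w, h1, h4⟩, h5, h6⟩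
      obtain ⟨W, hW⟩ := RT.mem_toXML.1 (p.mem_dom_of_sem h1)
      exact ⟨w, W, h1, hW, (q.pre_iff hW).2 ⟨x, X, h4, h5, h6⟩⟩
  | .union p q, K, v, U, h => by
    simp only [LPath.Pre, LPath.Sem]
    rw [p.pre_iff h, q.pre_iff h]
    simp only [or_and_right, exists_or]
theorem LStep.pre_iff {T : RT} : ∀ (s : LStep) {K : RT → Prop} {v : Vertex} {U : RT},
    T.sub v = some U → (s.Pre K U ↔ ∃ w W, s.Sem T.toXML v w ∧ T.sub w = some W ∧ K W)
  | .base a n, K, v, U, h => by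
    simp only [LStep.Pre, LStep.Sem, RT.rel_iff h]
    constructor
    · rintro ⟨W, ⟨w, h1, h2⟩, h3, h4⟩
      exact ⟨w, W, ⟨RT.mem_toXML.2 ⟨_, h⟩, RT.mem_toXML.2 ⟨_, h2⟩, h1, by rwa [RT.lab_toXML h2]⟩,
        h2, h4⟩
    · rintro ⟨w, W, ⟨-, -, h1, h3⟩, h2, h4⟩
      exact ⟨W, ⟨w, h1, h2⟩, by rwa [RT.lab_toXML h2] at h3, h4⟩
  | .filter s e, K, v, U, h => by
    simp only [LStep.Pre, LStep.Sem]
    rw [s.pre_iff h]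
    constructor
    · rintro ⟨w, W, h1, h2, h3, h4⟩
      exact ⟨w, W, ⟨h1, (e.pre_iff h2).1 h4⟩, h2, h3⟩
    · rintro ⟨w, W, ⟨h1, h4⟩, h2, h3⟩
      exact ⟨w, W, h1, h2, h3, (e.pre_iff h2).2 h4⟩
theorem FExpr.pre_iff {T : RT} : ∀ (e : FExpr) {v : Vertex} {U : RT},
    T.sub v = some U → (e.Pre (fun _ => True) U ↔ e.Holds T.toXML v)
  | .path p, v, U, h => by
    simp only [FExpr.Pre, FExpr.Holds]
    rw [p.pre_iff h]
    constructor
    · rintro ⟨w, _, h1, _⟩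
      exact ⟨w, h1⟩
    · rintro ⟨w, h1⟩
      obtain ⟨W, hW⟩ := RT.mem_toXML.1 (p.mem_dom_of_sem h1)
      exact ⟨w, W, h1, hW, trivial⟩
  | .or p q, v, U, h => by
    simp only [FExpr.Pre, FExpr.Holds]
    rw [p.pre_iff h, q.pre_iff h]
    constructor
    · rintro (⟨w, _, h1, _⟩ | ⟨w, _, h1, _⟩)
      · exact .inl ⟨w, h1⟩
      · exact .inr ⟨w, h1⟩
    · rintro (⟨w, h1⟩ | ⟨w, h1⟩)
      · obtain ⟨W, hW⟩ := RT.mem_toXML.1 (p.mem_dom_of_sem h1)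
        exact .inl ⟨w, W, h1, hW, trivial⟩
      · obtain ⟨W, hW⟩ := RT.mem_toXML.1 (q.mem_dom_of_sem h1)
        exact .inr ⟨w, W, h1, hW, trivial⟩
end

theorem RT.matches_iff {T : RT} {p : LPath} :
    T.toXML.Matches p ↔ p.Pre (fun _ => True) T := by
  have := FExpr.pre_iff (T := T) (.path p) (v := []) (U := T) rfl
  simp only [FExpr.Pre, FExpr.Holds] at this
  exact this.symm

-- Monotonicity under adding children, and axes in glued trees.

/-- Predicates preserved by adding children. -/
def GrowClosed (K : RT → Prop) : Prop := ∀ a cs ds, cs ⊆ ds → K (.node a cs) → K (.node a ds)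

theorem RT.rel_grow {a : Label} {cs ds : List RT} (h : cs ⊆ ds) {ax : Axis} (hax : ax ≠ .self)
    {c : RT} (hc : Rel ax (.node a cs) c) : Rel ax (.node a ds) c := by
  cases ax with
  | self => exact absurd rfl hax
  | child => exact h hc
  | descendant =>
    rcases Relation.TransGen.head'_iff.1 hc with ⟨d, h1, h2⟩
    exact Relation.TransGen.head'_iff.2 ⟨d, h h1, h2⟩

/-- A proper axis leaves the root through a child, and each child belongs to one of the two parts.
This fails for `self`, since the glued tree is in general neither part. -/
theorem RT.rel_append {a : Label} {cs ds : List RT} {ax : Axis} (hax : ax ≠ .self)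
    {c : RT} (hc : Rel ax (.node a (cs ++ ds)) c) :
    Rel ax (.node a cs) c ∨ Rel ax (.node a ds) c := by
  cases ax with
  | self => exact absurd rfl hax
  | child => exact List.mem_append.1 hc
  | descendant =>
    rcases Relation.TransGen.head'_iff.1 hc with ⟨d, h1, h2⟩
    rcases List.mem_append.1 h1 with h1 | h1
    · exact .inl (Relation.TransGen.head'_iff.2 ⟨d, h1, h2⟩)
    · exact .inr (Relation.TransGen.head'_iff.2 ⟨d, h1, h2⟩)

mutual
-- Paths and filters only assert existence, and there is no negation. The assumption on `K` is
-- needed for `self`, which hands the enlarged tree itself to `K`.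
theorem LPath.growClosed_pre : ∀ (p : LPath) {K : RT → Prop}, GrowClosed K → GrowClosed (p.Pre K)
  | .step s, K, hK => fun a cs ds h => by
    simp only [LPath.Pre]
    exact s.growClosed_pre hK a cs ds h
  | .seq p q, K, hK => fun a cs ds h => by
    simp only [LPath.Pre]
    exact p.growClosed_pre (q.growClosed_pre hK) a cs ds h
  | .union p q, K, hK => fun a cs ds h => by
    simp only [LPath.Pre]
    exact Or.imp (p.growClosed_pre hK a cs ds h) (q.growClosed_pre hK a cs ds h)
theorem LStep.growClosed_pre : ∀ (s : LStep) {K : RT → Prop}, GrowClosed K → GrowClosed (s.Pre K)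
  | .base ax n, K, hK => fun a cs ds h => by
    simp only [LStep.Pre]
    rintro ⟨c, h1, h2, h3⟩
    by_cases hax : ax = .self
    · subst hax
      simp only [RT.Rel] at h1
      subst h1
      exact ⟨_, rfl, h2, hK _ _ _ h h3⟩
    · exact ⟨c, RT.rel_grow h hax h1, h2, h3⟩
  | .filter s e, K, hK => fun a cs ds h => by
    simp only [LStep.Pre]
    refine s.growClosed_pre ?_ a cs ds h
    exact fun b cs' ds' h' h1 => ⟨hK b _ _ h' h1.1,
      e.growClosed_pre (fun _ _ _ _ h => h) b _ _ h' h1.2⟩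
theorem FExpr.growClosed_pre : ∀ (e : FExpr) {K : RT → Prop}, GrowClosed K → GrowClosed (e.Pre K)
  | .path p, K, hK => fun a cs ds h => by
    simp only [FExpr.Pre]
    exact p.growClosed_pre hK a cs ds h
  | .or p q, K, hK => fun a cs ds h => by
    simp only [FExpr.Pre]
    exact Or.imp (p.growClosed_pre hK a cs ds h) (q.growClosed_pre hK a cs ds h)
end

/-! ### Encoding expressions as binary trees -/

def Token.idx : Token → ℕ
  | .self => 0
  | .child => 1
  | .descendant => 2
  | .star => 3
  | .bit false => 4
  | .bit true => 5
  | .endLabel => 6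
  | .endAlphabet => 7
  | .filter => 8
  | .slash => 9
  | .bar => 10
  | .or => 11

theorem Token.idx_le (t : Token) : t.idx ≤ 11 := by
  rcases t with _ | _ | _ | _ | (_ | _) | _ | _ | _ | _ | _ | _ <;> decide

theorem Token.idx_injective : Function.Injective Token.idx := by
  have : ∀ a b : Token, a.idx = b.idx → a = b := by decide
  exact fun a b => this a b

theorem V.num_injective : Function.Injective V.num := by
  intro a b h
  simpa using congrArg V.len h

def Token.toV (t : Token) : V := num t.idx

@[simp] theorem Token.toV_inj {s t : Token} : s.toV = t.toV ↔ s = t :=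
  ⟨fun h => Token.idx_injective (V.num_injective h), fun h => h ▸ rfl⟩

def V.ofList : List V → V
  | [] => nil
  | a :: l => cons a (V.ofList l)

theorem V.ofList_injective : Function.Injective V.ofList := by
  intro l
  induction l with
  | nil => intro l' h; cases l' <;> simp [V.ofList] at h ⊢
  | cons a l ih =>
    intro l' h
    cases l' with
    | nil => simp [V.ofList] at h
    | cons b l' =>
      simp only [V.ofList, V.cons.injEq] at h
      rw [h.1, ih h.2]

def wordV (w : List Token) : V := V.ofList (w.map Token.toV)

theorem wordV_injective : Function.Injective wordV :=
  V.ofList_injective.comp (List.map_injective_iff.2 fun _ _ h => Token.toV_inj.1 h)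

@[simp] theorem wordV_nil : wordV [] = nil := rfl
@[simp] theorem wordV_cons (t : Token) (w : List Token) : wordV (t :: w) = cons t.toV (wordV w) :=
  rfl

theorem wordV_eq_nil {l : List Token} (h : nil = wordV l) : l = [] := by
  cases l with
  | nil => rfl
  | cons a l => simp at h

theorem wordV_eq_cons {l : List Token} {t : Token} {v : V} (h : cons t.toV v = wordV l) :
    ∃ l', l = t :: l' ∧ v = wordV l' := by
  cases l with
  | nil => simp at h
  | cons a l =>
    simp only [wordV_cons, V.cons.injEq, Token.toV_inj] at h
    exact ⟨l, by rw [h.1], h.2⟩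

def labV (a : Label) : V := wordV (a.map Token.bit)

theorem labV_injective : Function.Injective labV :=
  wordV_injective.comp (List.map_injective_iff.2 fun _ _ h => Token.bit.inj h)

def NodeTest.toV : NodeTest → V
  | .label a => cons (Token.toV .endLabel) (labV a)
  | .wildcard => cons (Token.toV .star) nil

mutual
-- The passages from steps to paths and from paths to filters leave no trace, so one predicate of
-- the logic program can serve all three kinds. The leading token still determines the constructor.
def LPath.toV : LPath → V
  | .step s => s.toV
  | .seq p q => cons (Token.toV .slash) (cons p.toV q.toV)
  | .union p q => cons (Token.toV .bar) (cons p.toV q.toV)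
def LStep.toV : LStep → V
  | .base a n => cons a.token.toV n.toV
  | .filter s e => cons (Token.toV .filter) (cons s.toV e.toV)
def FExpr.toV : FExpr → V
  | .path p => p.toV
  | .or p q => cons (Token.toV .or) (cons p.toV q.toV)
end

/-- What remains to be matched at a vertex: `thn p` continues along the path `p`, and `and e`
tests the filter `e`. -/
inductive Item
  | thn (p : LPath)
  | and (e : FExpr)

def contV : List Item → V
  | [] => nil
  | .thn p :: k => cons (cons (num 1) p.toV) (contV k)
  | .and e :: k => cons (cons (num 2) e.toV) (contV k)

def alphV (S : List Label) : V := V.ofList (S.map labV)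

/-- The statement that some vertex reached along `a` passes the test `n` and satisfies `k`. -/
def atomV (a : Axis) (n : NodeTest) (k : List Item) : V := cons a.token.toV (cons n.toV (contV k))

def V.Mem (a : V) : V → Prop
  | nil => False
  | cons b l => a = b ∨ V.Mem a l

theorem V.mem_ofList {a : V} {l : List V} : V.Mem a (V.ofList l) ↔ a ∈ l := by
  induction l with
  | nil => simp [V.ofList, V.Mem]
  | cons b l ih => simp [V.ofList, V.Mem, ih]

section inversion
variable {e : FExpr} {v : V}

theorem FExpr.toV_eq_slash (h : cons (Token.toV .slash) v = e.toV) :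
    ∃ p q, e = .path (.seq p q) ∧ v = cons p.toV q.toV := by
  rcases e with ⟨⟨_ | _ | _, _⟩ | _⟩ | _ | _ <;>
    simp_all [FExpr.toV, LPath.toV, LStep.toV, Axis.token]

theorem FExpr.toV_eq_bar (h : cons (Token.toV .bar) v = e.toV) :
    ∃ p q, e = .path (.union p q) ∧ v = cons p.toV q.toV := by
  rcases e with ⟨⟨_ | _ | _, _⟩ | _⟩ | _ | _ <;>
    simp_all [FExpr.toV, LPath.toV, LStep.toV, Axis.token]

theorem FExpr.toV_eq_or (h : cons (Token.toV .or) v = e.toV) :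
    ∃ p q, e = .or p q ∧ v = cons p.toV q.toV := by
  rcases e with ⟨⟨_ | _ | _, _⟩ | _⟩ | _ | _ <;>
    simp_all [FExpr.toV, LPath.toV, LStep.toV, Axis.token]

theorem FExpr.toV_eq_filter (h : cons (Token.toV .filter) v = e.toV) :
    ∃ s f, e = .path (.step (.filter s f)) ∧ v = cons s.toV f.toV := by
  rcases e with ⟨⟨_ | _ | _, _⟩ | _⟩ | _ | _ <;>
    simp_all [FExpr.toV, LPath.toV, LStep.toV, Axis.token]

theorem FExpr.toV_eq_axis {a : Axis} (h : cons a.token.toV v = e.toV) :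
    ∃ n : NodeTest, e = .path (.step (.base a n)) ∧ v = n.toV := by
  rcases e with ⟨⟨_ | _ | _, _⟩ | _⟩ | _ | _ <;> cases a <;>
    simp_all [FExpr.toV, LPath.toV, LStep.toV, Axis.token]

end inversion

theorem atomV_inj {a : Axis} {n' : V} {k : V} {a' : Axis} {m : NodeTest} {l : List Item}
    (h : cons a.token.toV (cons n' k) = atomV a' m l) : a = a' ∧ n' = m.toV ∧ k = contV l := by
  simp only [atomV, V.cons.injEq, Token.toV_inj] at h
  refine ⟨?_, h.2⟩
  cases a <;> cases a' <;> simp_all [Axis.token]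

/-! ### A logic program for non-containment -/

namespace Tm

def num : ℕ → Tm
  | 0 => nil
  | n + 1 => cons nil (num n)

def tok (t : Token) : Tm := num t.idx

def ofList : List Tm → Tm
  | [] => nil
  | a :: l => cons a (ofList l)

/-- The predicate with number `i` applied to `args`. -/
def goal (i : ℕ) (args : List Tm) : Tm := cons (num i) (ofList args)

end Tm

def V.goal (i : ℕ) (args : List V) : V := cons (num i) (V.ofList args)

section clauses
open Tm

/-- The trivial goal. -/
abbrev triv : Tm := .cons .nil .nil

/-- Parsing. The predicates 1 to 6 (`label`, `node test`, `step`, `path`, `filter`, `alphabet`)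
relate a word, what remains after reading an object from it, and the object; 7 is `word is an
instance`, 8 is `word is a pair of paths`. -/
def parseClauses : List Clause := [
  ⟨triv, triv, triv⟩,
  ⟨goal 1 [cons (tok .endLabel) (var 0), var 0, nil], triv, triv⟩,
  ⟨goal 1 [cons (tok (.bit false)) (var 0), var 1, cons (tok (.bit false)) (var 2)],
    goal 1 [var 0, var 1, var 2], triv⟩,
  ⟨goal 1 [cons (tok (.bit true)) (var 0), var 1, cons (tok (.bit true)) (var 2)],
    goal 1 [var 0, var 1, var 2], triv⟩,
  ⟨goal 2 [cons (tok .star) (var 0), var 0, cons (tok .star) nil], triv, triv⟩,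
  ⟨goal 2 [var 0, var 1, cons (tok .endLabel) (var 2)], goal 1 [var 0, var 1, var 2], triv⟩,
  ⟨goal 3 [cons (tok .self) (var 0), var 1, cons (tok .self) (var 2)],
    goal 2 [var 0, var 1, var 2], triv⟩,
  ⟨goal 3 [cons (tok .child) (var 0), var 1, cons (tok .child) (var 2)],
    goal 2 [var 0, var 1, var 2], triv⟩,
  ⟨goal 3 [cons (tok .descendant) (var 0), var 1, cons (tok .descendant) (var 2)],
    goal 2 [var 0, var 1, var 2], triv⟩,
  ⟨goal 3 [cons (tok .filter) (var 0), var 2, cons (tok .filter) (cons (var 3) (var 4))],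
    goal 3 [var 0, var 1, var 3], goal 5 [var 1, var 2, var 4]⟩,
  ⟨goal 4 [var 0, var 1, var 2], goal 3 [var 0, var 1, var 2], triv⟩,
  ⟨goal 4 [cons (tok .slash) (var 0), var 2, cons (tok .slash) (cons (var 3) (var 4))],
    goal 4 [var 0, var 1, var 3], goal 4 [var 1, var 2, var 4]⟩,
  ⟨goal 4 [cons (tok .bar) (var 0), var 2, cons (tok .bar) (cons (var 3) (var 4))],
    goal 4 [var 0, var 1, var 3], goal 4 [var 1, var 2, var 4]⟩,
  ⟨goal 5 [var 0, var 1, var 2], goal 4 [var 0, var 1, var 2], triv⟩,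
  ⟨goal 5 [cons (tok .or) (var 0), var 2, cons (tok .or) (cons (var 3) (var 4))],
    goal 4 [var 0, var 1, var 3], goal 4 [var 1, var 2, var 4]⟩,
  ⟨goal 6 [cons (tok .endAlphabet) (var 0), var 0, nil], triv, triv⟩,
  ⟨goal 6 [var 0, var 2, cons (var 3) (var 4)],
    goal 1 [var 0, var 1, var 3], goal 6 [var 1, var 2, var 4]⟩,
  ⟨goal 7 [var 0], goal 6 [var 0, var 1, var 2], goal 8 [var 1]⟩,
  ⟨goal 8 [var 0], goal 4 [var 0, var 1, var 2], goal 4 [var 1, nil, var 3]⟩]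

/-- 9 is `word is an instance without containment`, 10 and 11 are the same with the alphabet, and
the alphabet and the first path, already read, and 12 is non-containment. -/
def mainClauses : List Clause := [
  ⟨goal 9 [var 0], goal 6 [var 0, var 1, var 2], goal 10 [var 1, var 2]⟩,
  ⟨goal 10 [var 0, var 2], goal 4 [var 0, var 1, var 3], goal 11 [var 1, var 2, var 3]⟩,
  ⟨goal 11 [var 1, var 2, var 3], goal 4 [var 1, nil, var 4], goal 12 [var 2, var 3, var 4]⟩,
  ⟨goal 12 [var 0, var 1, var 2], goal 24 [var 0, var 1, var 3], goal 18 [var 3, var 2, nil]⟩]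

/-- 13 is membership, 14 inequality and 15 `the label passes the node test`. -/
def testClauses : List Clause := [
  ⟨goal 13 [var 0, cons (var 0) (var 1)], triv, triv⟩,
  ⟨goal 13 [var 0, cons (var 1) (var 2)], goal 13 [var 0, var 2], triv⟩,
  ⟨goal 14 [nil, cons (var 0) (var 1)], triv, triv⟩,
  ⟨goal 14 [cons (var 0) (var 1), nil], triv, triv⟩,
  ⟨goal 14 [cons (var 0) (var 1), cons (var 2) (var 3)], goal 14 [var 0, var 2], triv⟩,
  ⟨goal 14 [cons (var 0) (var 1), cons (var 2) (var 3)], goal 14 [var 1, var 3], triv⟩,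
  ⟨goal 15 [cons (tok .star) nil, var 0], triv, triv⟩,
  ⟨goal 15 [cons (tok .endLabel) (var 0), var 0], triv, triv⟩]

/-- A state consists of the label of a vertex and a list of atoms which are false there. The
predicates refute at a state: 16 a node test followed by a continuation, 17 a continuation,
18 an expression followed by a continuation. -/
def refuteClauses : List Clause := [
  ⟨goal 16 [cons (var 0) (var 1), cons (tok .endLabel) (var 2), var 3],
    goal 14 [var 0, var 2], triv⟩,
  ⟨goal 16 [var 0, var 1, var 2], goal 17 [var 0, var 2], triv⟩,
  ⟨goal 17 [var 0, cons (cons (num 1) (var 1)) (var 2)], goal 18 [var 0, var 1, var 2], triv⟩,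
  ⟨goal 17 [var 0, cons (cons (num 2) (var 1)) (var 2)], goal 18 [var 0, var 1, nil], triv⟩,
  ⟨goal 17 [var 0, cons (cons (num 2) (var 1)) (var 2)], goal 17 [var 0, var 2], triv⟩,
  ⟨goal 18 [var 0, cons (tok .or) (cons (var 1) (var 2)), var 3],
    goal 18 [var 0, var 1, var 3], goal 18 [var 0, var 2, var 3]⟩,
  ⟨goal 18 [var 0, cons (tok .bar) (cons (var 1) (var 2)), var 3],
    goal 18 [var 0, var 1, var 3], goal 18 [var 0, var 2, var 3]⟩,
  ⟨goal 18 [var 0, cons (tok .slash) (cons (var 1) (var 2)), var 3],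
    goal 18 [var 0, var 1, cons (cons (num 1) (var 2)) (var 3)], triv⟩,
  ⟨goal 18 [var 0, cons (tok .filter) (cons (var 1) (var 2)), var 3],
    goal 18 [var 0, var 1, cons (cons (num 2) (var 2)) (var 3)], triv⟩,
  ⟨goal 18 [var 0, cons (tok .self) (var 1), var 2], goal 16 [var 0, var 1, var 2], triv⟩,
  ⟨goal 18 [cons (var 0) (var 1), cons (tok .child) (var 2), var 3],
    goal 13 [cons (tok .child) (cons (var 2) (var 3)), var 1], triv⟩,
  ⟨goal 18 [cons (var 0) (var 1), cons (tok .descendant) (var 2), var 3],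
    goal 13 [cons (tok .descendant) (cons (var 2) (var 3)), var 1], triv⟩]

/-- 19 and 20: an atom, and all atoms of a list, are false at a vertex with a single child, given
the state of the child; 21 and 22: possible states of a vertex above a given one with a single
child, and of the start of a chain down to it; 23: possible states at the root of a tree from which
a path leads to a vertex in a given state; 24: possible states at the root of a tree satisfying
a filter. -/
def treeClauses : List Clause := [
  ⟨goal 19 [var 0, cons (tok .child) (cons (var 1) (var 2))],
    goal 16 [var 0, var 1, var 2], triv⟩,
  ⟨goal 19 [cons (var 3) (var 0), cons (tok .descendant) (cons (var 1) (var 2))],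
    goal 16 [cons (var 3) (var 0), var 1, var 2],
    goal 13 [cons (tok .descendant) (cons (var 1) (var 2)), var 0]⟩,
  ⟨goal 20 [var 0, nil], triv, triv⟩,
  ⟨goal 20 [var 0, cons (var 1) (var 2)], goal 19 [var 0, var 1], goal 20 [var 0, var 2]⟩,
  ⟨goal 21 [var 0, var 1, cons (var 2) (var 3)], goal 13 [var 2, var 0], goal 20 [var 1, var 3]⟩,
  ⟨goal 22 [var 0, var 1, var 2], goal 21 [var 0, var 1, var 2], triv⟩,
  ⟨goal 22 [var 0, var 1, var 2], goal 22 [var 0, var 1, var 3], goal 22 [var 0, var 3, var 2]⟩,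
  ⟨goal 23 [var 0, cons (tok .self) (var 1), cons (var 2) (var 3), cons (var 2) (var 3)],
    goal 15 [var 1, var 2], triv⟩,
  ⟨goal 23 [var 0, cons (tok .child) (var 1), cons (var 2) (var 3), var 4],
    goal 15 [var 1, var 2], goal 21 [var 0, cons (var 2) (var 3), var 4]⟩,
  ⟨goal 23 [var 0, cons (tok .descendant) (var 1), cons (var 2) (var 3), var 4],
    goal 15 [var 1, var 2], goal 22 [var 0, cons (var 2) (var 3), var 4]⟩,
  ⟨goal 23 [var 0, cons (tok .slash) (cons (var 1) (var 2)), var 3, var 4],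
    goal 23 [var 0, var 2, var 3, var 5], goal 23 [var 0, var 1, var 5, var 4]⟩,
  ⟨goal 23 [var 0, cons (tok .bar) (cons (var 1) (var 2)), var 3, var 4],
    goal 23 [var 0, var 1, var 3, var 4], triv⟩,
  ⟨goal 23 [var 0, cons (tok .bar) (cons (var 1) (var 2)), var 3, var 4],
    goal 23 [var 0, var 2, var 3, var 4], triv⟩,
  ⟨goal 23 [var 0, cons (tok .filter) (cons (var 1) (var 2)), var 3, var 4],
    goal 24 [var 0, var 2, var 3], goal 23 [var 0, var 1, var 3, var 4]⟩,
  ⟨goal 24 [var 0, var 1, var 2], goal 23 [var 0, var 1, cons (var 3) (var 4), var 2],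
    goal 13 [var 3, var 0]⟩,
  ⟨goal 24 [var 0, cons (tok .or) (cons (var 1) (var 2)), var 3],
    goal 24 [var 0, var 1, var 3], triv⟩,
  ⟨goal 24 [var 0, cons (tok .or) (cons (var 1) (var 2)), var 3],
    goal 24 [var 0, var 2, var 3], triv⟩]

def clauses : List Clause :=
  parseClauses ++ mainClauses ++ testClauses ++ refuteClauses ++ treeClauses

end clauses

/-! ### The meaning of the predicates -/

def SatK : List Item → RT → Prop
  | [], _ => True
  | .thn p :: k, T => p.Pre (SatK k) T
  | .and e :: k, T => SatK k T ∧ e.Pre (fun _ => True) T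

/-- The state `y` is correct at the root of `T`. -/
def StateOk (y : V) (T : RT) : Prop :=
  -- Only the falsity of listed atoms is claimed, not the truth of the others; this one-sidedness is
  -- what allows gluing. Atoms with axis `self` are excluded, since they inspect the root itself and
  -- may become true when children are added.
  y.fst = labV T.lab ∧ ∀ a n k, a ≠ .self → V.Mem (atomV a n k) y.snd →
    ¬ (LStep.base a n).Pre (SatK k) T

/-- All labels of `T` are in `S`. -/
def LabIn (S : List Label) (T : RT) : Prop := ∀ v U, T.sub v = some U → U.lab ∈ S

/-- `x` is a possible state at the root of a tree satisfying `R`. -/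
def Realizes (S : List Label) (x : V) (R : RT → Prop) : Prop :=
  ∃ T, LabIn S T ∧ StateOk x T ∧ R T

namespace Meaning

/-- The statement is vacuous on trees that do not encode words, and the meanings below are likewise
vacuous on ill-formed expressions and alphabets. So clauses stay sound without goals that check the
kinds of their variables. -/
def Reads {α : Type} (enc : α → List Token) (toV : α → V) (w r v : V) : Prop :=
  ∀ l, w = wordV l → ∃ x l', l = enc x ++ l' ∧ r = wordV l' ∧ v = toV x

def Instance (w : V) : Prop :=
  ∀ l, w = wordV l → ∃ S p q, l = encodeInstance S p q

def Paths (w : V) : Prop :=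
  ∀ l, w = wordV l → ∃ p q : LPath, l = p.encode ++ q.encode

def NonContained (S p q : V) : Prop :=
  ∀ S' p' q', S = alphV S' → p = LPath.toV p' → q = LPath.toV q' → ¬ ContainedOver S' p' q'

def Bad (w : V) : Prop :=
  ∀ l, w = wordV l → ∃ S p q, l = encodeInstance S p q ∧ ¬ ContainedOver S p q

def BadPaths (w S : V) : Prop :=
  ∀ l, w = wordV l → ∃ p q : LPath, l = p.encode ++ q.encode ∧
    ∀ S', S = alphV S' → ¬ ContainedOver S' p q

def BadPath (w S p : V) : Prop :=
  ∀ l, w = wordV l → ∃ q : LPath, l = q.encode ∧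
    ∀ S' p', S = alphV S' → p = LPath.toV p' → ¬ ContainedOver S' p' q

def Test (n a : V) : Prop :=
  ∀ m l, n = NodeTest.toV m → a = labV l → m.Holds l

def RefuteTest (y n k : V) : Prop :=
  ∀ T m l, StateOk y T → n = NodeTest.toV m → k = contV l → m.Holds T.lab → ¬ SatK l T

def RefuteCont (y k : V) : Prop :=
  ∀ T l, StateOk y T → k = contV l → ¬ SatK l T

def Refute (y e k : V) : Prop :=
  ∀ T e' l, StateOk y T → e = FExpr.toV e' → k = contV l → ¬ e'.Pre (SatK l) T

def UpAtom (y g : V) : Prop :=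
  ∀ T a n k b, StateOk y T → a ≠ .self → g = atomV a n k →
    ¬ (LStep.base a n).Pre (SatK k) (.node b [T])

def UpAtoms (y G : V) : Prop :=
  ∀ g, V.Mem g G → UpAtom y g

def Up (S y x : V) : Prop :=
  ∀ S' T, S = alphV S' → LabIn S' T → StateOk y T → Realizes S' x fun U => U.Child T

def Chain (S y x : V) : Prop :=
  ∀ S' T, S = alphV S' → LabIn S' T → StateOk y T → Realizes S' x fun U => RT.Rel .descendant U T

/-- A path is followed backwards: a tree for its end is turned into a tree for its start. The
predicate `K` is whatever is known at the end; it must survive the addition of children, because the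
end may be enlarged by gluing. -/
def Eval (S p y x : V) : Prop :=
  ∀ S' p' T, S = alphV S' → p = FExpr.toV p' → LabIn S' T → StateOk y T →
    Realizes S' x fun U => ∀ K, GrowClosed K → K T → p'.Pre K U

def Filter (S e x : V) : Prop :=
  ∀ S' e', S = alphV S' → e = FExpr.toV e' → Realizes S' x (e'.Pre fun _ => True)

end Meaning

/-- The meaning of a goal. -/
def Meaning (g : V) : Prop :=
  match g.fst.len with
  | 0 => g = tt
  | 1 => Meaning.Reads encodeLabel labV (g.snd.nth 0) (g.snd.nth 1) (g.snd.nth 2)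
  | 2 => Meaning.Reads NodeTest.encode NodeTest.toV (g.snd.nth 0) (g.snd.nth 1) (g.snd.nth 2)
  | 3 => Meaning.Reads LStep.encode LStep.toV (g.snd.nth 0) (g.snd.nth 1) (g.snd.nth 2)
  | 4 => Meaning.Reads LPath.encode LPath.toV (g.snd.nth 0) (g.snd.nth 1) (g.snd.nth 2)
  | 5 => Meaning.Reads FExpr.encode FExpr.toV (g.snd.nth 0) (g.snd.nth 1) (g.snd.nth 2)
  | 6 => Meaning.Reads encodeAlphabet alphV (g.snd.nth 0) (g.snd.nth 1) (g.snd.nth 2)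
  | 7 => Meaning.Instance (g.snd.nth 0)
  | 8 => Meaning.Paths (g.snd.nth 0)
  | 9 => Meaning.Bad (g.snd.nth 0)
  | 10 => Meaning.BadPaths (g.snd.nth 0) (g.snd.nth 1)
  | 11 => Meaning.BadPath (g.snd.nth 0) (g.snd.nth 1) (g.snd.nth 2)
  | 12 => Meaning.NonContained (g.snd.nth 0) (g.snd.nth 1) (g.snd.nth 2)
  | 13 => V.Mem (g.snd.nth 0) (g.snd.nth 1)
  | 14 => g.snd.nth 0 ≠ g.snd.nth 1
  | 15 => Meaning.Test (g.snd.nth 0) (g.snd.nth 1)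
  | 16 => Meaning.RefuteTest (g.snd.nth 0) (g.snd.nth 1) (g.snd.nth 2)
  | 17 => Meaning.RefuteCont (g.snd.nth 0) (g.snd.nth 1)
  | 18 => Meaning.Refute (g.snd.nth 0) (g.snd.nth 1) (g.snd.nth 2)
  | 19 => Meaning.UpAtom (g.snd.nth 0) (g.snd.nth 1)
  | 20 => Meaning.UpAtoms (g.snd.nth 0) (g.snd.nth 1)
  | 21 => Meaning.Up (g.snd.nth 0) (g.snd.nth 1) (g.snd.nth 2)
  | 22 => Meaning.Chain (g.snd.nth 0) (g.snd.nth 1) (g.snd.nth 2)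
  | 23 => Meaning.Eval (g.snd.nth 0) (g.snd.nth 1) (g.snd.nth 2) (g.snd.nth 3)
  | 24 => Meaning.Filter (g.snd.nth 0) (g.snd.nth 1) (g.snd.nth 2)
  | _ => False

namespace Meaning

-- Soundness of the clauses for parsing and for non-containment.

section parse
variable {w r u v v' : V}

theorem reads_label_end : Reads encodeLabel labV (cons (Token.toV .endLabel) w) w nil := by
  intro l hl
  obtain ⟨l', rfl, rfl⟩ := wordV_eq_cons hl
  exact ⟨[], l', rfl, rfl, rfl⟩

theorem reads_label_bit (b : Bool) (h : Reads encodeLabel labV w r v) :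
    Reads encodeLabel labV (cons (Token.toV (.bit b)) w) r (cons (Token.toV (.bit b)) v) := by
  intro l hl
  obtain ⟨l', rfl, rfl⟩ := wordV_eq_cons hl
  obtain ⟨a, l'', rfl, rfl, rfl⟩ := h l' rfl
  exact ⟨b :: a, l'', rfl, rfl, rfl⟩

theorem reads_star :
    Reads NodeTest.encode NodeTest.toV (cons (Token.toV .star) w) w
      (cons (Token.toV .star) nil) := by
  intro l hl
  obtain ⟨l', rfl, rfl⟩ := wordV_eq_cons hl
  exact ⟨.wildcard, l', rfl, rfl, rfl⟩

theorem reads_test (h : Reads encodeLabel labV w r v) :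
    Reads NodeTest.encode NodeTest.toV w r (cons (Token.toV .endLabel) v) := by
  intro l hl
  obtain ⟨a, l', rfl, rfl, rfl⟩ := h l hl
  exact ⟨.label a, l', rfl, rfl, rfl⟩

theorem reads_base (a : Axis) (h : Reads NodeTest.encode NodeTest.toV w r v) :
    Reads LStep.encode LStep.toV (cons a.token.toV w) r (cons a.token.toV v) := by
  intro l hl
  obtain ⟨l', rfl, rfl⟩ := wordV_eq_cons hl
  obtain ⟨n, l'', rfl, rfl, rfl⟩ := h l' rfl
  exact ⟨.base a n, l'', by simp [LStep.encode], rfl, by simp [LStep.toV]⟩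

theorem reads_filter (h : Reads LStep.encode LStep.toV w u v)
    (h' : Reads FExpr.encode FExpr.toV u r v') :
    Reads LStep.encode LStep.toV (cons (Token.toV .filter) w) r
      (cons (Token.toV .filter) (cons v v')) := by
  intro l hl
  obtain ⟨l', rfl, rfl⟩ := wordV_eq_cons hl
  obtain ⟨s, l'', rfl, rfl, rfl⟩ := h l' rfl
  obtain ⟨e, l', rfl, rfl, rfl⟩ := h' l'' rfl
  exact ⟨.filter s e, l', by simp [LStep.encode], rfl, by simp [LStep.toV]⟩

theorem reads_step (h : Reads LStep.encode LStep.toV w r v) :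
    Reads LPath.encode LPath.toV w r v := by
  intro l hl
  obtain ⟨s, l', rfl, rfl, rfl⟩ := h l hl
  exact ⟨.step s, l', by simp [LPath.encode], rfl, by simp [LPath.toV]⟩

theorem reads_slash (h : Reads LPath.encode LPath.toV w u v)
    (h' : Reads LPath.encode LPath.toV u r v') :
    Reads LPath.encode LPath.toV (cons (Token.toV .slash) w) r
      (cons (Token.toV .slash) (cons v v')) := by
  intro l hl
  obtain ⟨l', rfl, rfl⟩ := wordV_eq_cons hl
  obtain ⟨p, l'', rfl, rfl, rfl⟩ := h l' rfl
  obtain ⟨q, l', rfl, rfl, rfl⟩ := h' l'' rfl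
  exact ⟨.seq p q, l', by simp [LPath.encode], rfl, by simp [LPath.toV]⟩

theorem reads_bar (h : Reads LPath.encode LPath.toV w u v)
    (h' : Reads LPath.encode LPath.toV u r v') :
    Reads LPath.encode LPath.toV (cons (Token.toV .bar) w) r
      (cons (Token.toV .bar) (cons v v')) := by
  intro l hl
  obtain ⟨l', rfl, rfl⟩ := wordV_eq_cons hl
  obtain ⟨p, l'', rfl, rfl, rfl⟩ := h l' rfl
  obtain ⟨q, l', rfl, rfl, rfl⟩ := h' l'' rfl
  exact ⟨.union p q, l', by simp [LPath.encode], rfl, by simp [LPath.toV]⟩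

theorem reads_path (h : Reads LPath.encode LPath.toV w r v) :
    Reads FExpr.encode FExpr.toV w r v := by
  intro l hl
  obtain ⟨s, l', rfl, rfl, rfl⟩ := h l hl
  exact ⟨.path s, l', by simp [FExpr.encode], rfl, by simp [FExpr.toV]⟩

theorem reads_or (h : Reads LPath.encode LPath.toV w u v)
    (h' : Reads LPath.encode LPath.toV u r v') :
    Reads FExpr.encode FExpr.toV (cons (Token.toV .or) w) r
      (cons (Token.toV .or) (cons v v')) := by
  intro l hl
  obtain ⟨l', rfl, rfl⟩ := wordV_eq_cons hl
  obtain ⟨p, l'', rfl, rfl, rfl⟩ := h l' rfl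
  obtain ⟨q, l', rfl, rfl, rfl⟩ := h' l'' rfl
  exact ⟨.or p q, l', by simp [FExpr.encode], rfl, by simp [FExpr.toV]⟩

theorem reads_alphabet_end :
    Reads encodeAlphabet alphV (cons (Token.toV .endAlphabet) w) w nil := by
  intro l hl
  obtain ⟨l', rfl, rfl⟩ := wordV_eq_cons hl
  exact ⟨[], l', rfl, rfl, rfl⟩

theorem reads_alphabet (h : Reads encodeLabel labV w u v)
    (h' : Reads encodeAlphabet alphV u r v') :
    Reads encodeAlphabet alphV w r (cons v v') := by
  intro l hl
  obtain ⟨a, l'', rfl, rfl, rfl⟩ := h l hl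
  obtain ⟨S, l', rfl, rfl, rfl⟩ := h' l'' rfl
  exact ⟨a :: S, l', by simp [encodeAlphabet], rfl, rfl⟩

theorem instance_of (h : Reads encodeAlphabet alphV w u v) (h' : Paths u) : Instance w := by
  intro l hl
  obtain ⟨S, l', rfl, rfl, rfl⟩ := h l hl
  obtain ⟨p, q, rfl⟩ := h' l' rfl
  exact ⟨S, p, q, rfl⟩

theorem paths_of (h : Reads LPath.encode LPath.toV w u v)
    (h' : Reads LPath.encode LPath.toV u nil v') : Paths w := by
  intro l hl
  obtain ⟨p, l', rfl, rfl, rfl⟩ := h l hl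
  obtain ⟨q, l'', rfl, hn, rfl⟩ := h' l' rfl
  obtain rfl := wordV_eq_nil hn
  exact ⟨p, q, by simp⟩

theorem bad_of (h : Reads encodeAlphabet alphV w u v) (h' : BadPaths u v) : Bad w := by
  intro l hl
  obtain ⟨S, l', rfl, rfl, rfl⟩ := h l hl
  obtain ⟨p, q, rfl, hS⟩ := h' l' rfl
  exact ⟨S, p, q, rfl, hS S rfl⟩

theorem badPaths_of {S : V} (h : Reads LPath.encode LPath.toV w u v) (h' : BadPath u S v) :
    BadPaths w S := by
  intro l hl
  obtain ⟨p, l', rfl, rfl, rfl⟩ := h l hl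
  obtain ⟨q, rfl, hS⟩ := h' l' rfl
  exact ⟨p, q, rfl, fun S' hS' => hS S' p hS' rfl⟩

theorem badPath_of {S p : V} (h : Reads LPath.encode LPath.toV w nil v)
    (h' : NonContained S p v) : BadPath w S p := by
  intro l hl
  obtain ⟨q, l', rfl, hn, rfl⟩ := h l hl
  obtain rfl := wordV_eq_nil hn
  exact ⟨q, by simp, fun S' p' hS' hp' => h' S' p' q hS' hp' rfl⟩

/-- The first goal supplies some tree with root state `x` that satisfies `p`; the refutation of `q`
applies to every tree with that root state, hence to this one. -/
theorem nonContained_of {S p q x : V} (h : Filter S p x) (h' : Refute x q nil) :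
    NonContained S p q := by
  rintro S' p' q' hS hp hq hcon
  obtain ⟨T, hT, hx, hpT⟩ := h S' (.path p') hS (by simpa [FExpr.toV] using hp)
  have hq' := h' T (.path q') [] hx (by simpa [FExpr.toV] using hq) rfl
  simp only [FExpr.Pre] at hpT hq'
  refine hq' (RT.matches_iff.1 (hcon T.toXML (fun v hv => ?_) (RT.matches_iff.2 hpT)))
  obtain ⟨U, hU⟩ := RT.mem_toXML.1 hv
  rw [RT.lab_toXML hU]
  exact hT v U hU

end parse

theorem test_star {a : V} : Test (cons (Token.toV .star) nil) a := by
  rintro (b | _) l h -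
  · simp [NodeTest.toV] at h
  · trivial

theorem test_label {a : V} : Test (cons (Token.toV .endLabel) a) a := by
  rintro (b | _) l h rfl
  · simp only [NodeTest.toV, V.cons.injEq, true_and] at h
    exact labV_injective h
  · trivial

-- Soundness of refutation from a state.

section refute
variable {y a G n k e e' : V}

theorem refuteTest_label (h : a ≠ n) :
    RefuteTest (cons a G) (cons (Token.toV .endLabel) n) k := by
  rintro T (b | _) l hT hn hk hb
  · simp only [NodeTest.toV, V.cons.injEq, true_and] at hn
    simp only [NodeTest.Holds] at hb
    have := hT.1
    simp only [V.fst_cons] at this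
    exact absurd (by rw [this, hn, hb]) h
  · simp [NodeTest.toV] at hn

theorem refuteTest_cont (h : RefuteCont y k) : RefuteTest y n k :=
  fun T _ l hT _ hk _ => h T l hT hk

theorem refuteCont_thn (h : Refute y e k) : RefuteCont y (cons (cons (num 1) e) k) := by
  rintro T (_ | ⟨p | f, l⟩) hT hk
  · simp [contV] at hk
  · simp only [contV, V.cons.injEq, true_and] at hk
    exact h T (.path p) l hT (by simpa [FExpr.toV] using hk.1) hk.2
  · simp [contV, num] at hk

theorem refuteCont_and (h : Refute y e nil) : RefuteCont y (cons (cons (num 2) e) k) := by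
  rintro T (_ | ⟨p | f, l⟩) hT hk
  · simp [contV] at hk
  · simp [contV, num] at hk
  · simp only [contV, V.cons.injEq, true_and] at hk
    exact fun hs => h T f [] hT hk.1 rfl hs.2

theorem refuteCont_and' (h : RefuteCont y k) : RefuteCont y (cons (cons (num 2) e) k) := by
  rintro T (_ | ⟨p | f, l⟩) hT hk
  · simp [contV] at hk
  · simp [contV, num] at hk
  · simp only [contV, V.cons.injEq, true_and] at hk
    exact fun hs => h T l hT hk.2 hs.1

theorem refute_or (h : Refute y e k) (h' : Refute y e' k) :
    Refute y (cons (Token.toV .or) (cons e e')) k := by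
  intro T f l hT hf hk
  obtain ⟨p, q, rfl, hpq⟩ := FExpr.toV_eq_or hf
  simp only [V.cons.injEq] at hpq
  have h1 := h T (.path p) l hT (by simpa [FExpr.toV] using hpq.1) hk
  have h2 := h' T (.path q) l hT (by simpa [FExpr.toV] using hpq.2) hk
  simp only [FExpr.Pre] at h1 h2 ⊢
  exact not_or.2 ⟨h1, h2⟩

theorem refute_bar (h : Refute y e k) (h' : Refute y e' k) :
    Refute y (cons (Token.toV .bar) (cons e e')) k := by
  intro T f l hT hf hk
  obtain ⟨p, q, rfl, hpq⟩ := FExpr.toV_eq_bar hf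
  simp only [V.cons.injEq] at hpq
  have h1 := h T (.path p) l hT (by simpa [FExpr.toV] using hpq.1) hk
  have h2 := h' T (.path q) l hT (by simpa [FExpr.toV] using hpq.2) hk
  simp only [FExpr.Pre, LPath.Pre] at h1 h2 ⊢
  exact not_or.2 ⟨h1, h2⟩

theorem refute_slash (h : Refute y e (cons (cons (num 1) e') k)) :
    Refute y (cons (Token.toV .slash) (cons e e')) k := by
  intro T f l hT hf hk
  obtain ⟨p, q, rfl, hpq⟩ := FExpr.toV_eq_slash hf
  simp only [V.cons.injEq] at hpq
  have h1 := h T (.path p) (.thn q :: l) hT (by simpa [FExpr.toV] using hpq.1)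
    (by simp [contV, hpq.2, hk])
  simpa only [FExpr.Pre, LPath.Pre, SatK] using h1

theorem refute_filter (h : Refute y e (cons (cons (num 2) e') k)) :
    Refute y (cons (Token.toV .filter) (cons e e')) k := by
  intro T f l hT hf hk
  obtain ⟨p, q, rfl, hpq⟩ := FExpr.toV_eq_filter hf
  simp only [V.cons.injEq] at hpq
  have h1 := h T (.path (.step p)) (.and q :: l) hT
    (by simpa [FExpr.toV, LPath.toV] using hpq.1) (by simp [contV, hpq.2, hk])
  simpa only [FExpr.Pre, LPath.Pre, LStep.Pre, SatK] using h1

theorem refute_self (h : RefuteTest y n k) : Refute y (cons (Token.toV .self) n) k := by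
  intro T f l hT hf hk
  obtain ⟨m, rfl, hm⟩ := FExpr.toV_eq_axis (a := .self) hf
  have := h T m l hT hm hk
  simp only [FExpr.Pre, LPath.Pre, LStep.Pre, RT.Rel]
  rintro ⟨_, rfl, h1, h2⟩
  exact this h1 h2

theorem refute_axis (ax : Axis) (hax : ax ≠ .self)
    (h : V.Mem (cons ax.token.toV (cons n k)) G) :
    Refute (cons a G) (cons ax.token.toV n) k := by
  rintro T f l hT hf rfl
  obtain ⟨m, rfl, rfl⟩ := FExpr.toV_eq_axis hf
  have := hT.2 ax m l hax h
  simpa only [FExpr.Pre, LPath.Pre] using this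

end refute

-- Soundness of the construction of countermodels from states.

section tree
variable {S S' x y z a G n g k e e' : V}

theorem upAtom_child (h : RefuteTest y n k) :
    UpAtom y (cons (Token.toV .child) (cons n k)) := by
  rintro T ax m l b hT - hg
  obtain ⟨rfl, rfl, rfl⟩ := atomV_inj (a := .child) hg
  simp only [LStep.Pre, RT.Rel, RT.Child, RT.children, List.mem_singleton]
  rintro ⟨_, rfl, h1, h2⟩
  exact h _ m l hT rfl rfl h1 h2

/-- A descendant of the new root is its only child, excluded by the refuted test, or a descendant of
that child, excluded by the listed atom. -/
theorem upAtom_descendant (h : RefuteTest (cons a G) n k)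
    (h' : V.Mem (cons (Token.toV .descendant) (cons n k)) G) :
    UpAtom (cons a G) (cons (Token.toV .descendant) (cons n k)) := by
  rintro T ax m l b hT - hg
  obtain ⟨rfl, rfl, rfl⟩ := atomV_inj (a := .descendant) hg
  simp only [LStep.Pre, RT.Rel]
  rintro ⟨c, hc, h1, h2⟩
  obtain ⟨d, hd, hdc⟩ := Relation.TransGen.head'_iff.1 hc
  simp only [RT.Child, RT.children, List.mem_singleton] at hd
  subst hd
  rcases Relation.reflTransGen_iff_eq_or_transGen.1 hdc with rfl | hdc
  · exact h _ m l hT rfl rfl h1 h2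
  · refine hT.2 .descendant m l (by simp) h' ?_
    simp only [LStep.Pre, RT.Rel]
    exact ⟨c, hdc, h1, h2⟩

theorem upAtoms_cons (h : UpAtom y g) (h' : UpAtoms y G) : UpAtoms y (cons g G) := by
  rintro g' (rfl | hg)
  · exact h
  · exact h' g' hg

theorem mem_alphV {S : List Label} (h : V.Mem a (alphV S)) : ∃ l ∈ S, a = labV l := by
  rw [alphV, V.mem_ofList] at h
  obtain ⟨l, hl, rfl⟩ := List.mem_map.1 h
  exact ⟨l, hl, rfl⟩

theorem labIn_node {S : List Label} {l : Label} {cs : List RT} :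
    LabIn S (.node l cs) ↔ l ∈ S ∧ ∀ c ∈ cs, LabIn S c := by
  constructor
  · refine fun h => ⟨h [] _ rfl, fun c hc v U hU => ?_⟩
    obtain ⟨i, hi⟩ := List.mem_iff_getElem?.1 hc
    exact h (i :: v) U (by simp [RT.sub, RT.children, hi, hU])
  · rintro ⟨h1, h2⟩ (_ | ⟨i, v⟩) U hU
    · simp only [RT.sub, Option.some.injEq] at hU
      subst hU
      exact h1
    · simp only [RT.sub, RT.children] at hU
      cases hc : cs[i]? with
      | none => simp [hc] at hU
      | some c =>
        simp only [hc, Option.bind_some] at hU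
        exact h2 c (List.mem_of_getElem? hc) v U hU

theorem up_of (h : V.Mem a S) (h' : UpAtoms y G) : Up S y (cons a G) := by
  rintro S' T rfl hT hy
  obtain ⟨l, hl, rfl⟩ := mem_alphV h
  refine ⟨.node l [T], labIn_node.2 ⟨hl, by simpa using hT⟩, ⟨rfl, ?_⟩, by
    simp [RT.Child, RT.children]⟩
  exact fun ax m k hax hm => h' _ hm T ax m k l hy hax rfl

theorem chain_up (h : Up S y x) : Chain S y x := by
  intro S' T hS hT hy
  obtain ⟨U, h1, h2, h3⟩ := h S' T hS hT hy
  exact ⟨U, h1, h2, .single h3⟩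

theorem chain_trans (h : Chain S y z) (h' : Chain S z x) : Chain S y x := by
  intro S' T hS hT hy
  obtain ⟨U, h1, h2, h3⟩ := h S' T hS hT hy
  obtain ⟨W, h4, h5, h6⟩ := h' S' U hS h1 h2
  exact ⟨W, h4, h5, Relation.TransGen.trans h6 h3⟩

theorem eval_axis {b x : V} (ax : Axis) (h : Test n b)
    (h' : ∀ S' T, S = alphV S' → LabIn S' T → StateOk (cons b G) T →
      Realizes S' x fun U => RT.Rel ax U T) :
    Eval S (cons ax.token.toV n) (cons b G) x := by
  intro S' p T hS hp hT hy
  obtain ⟨m, rfl, rfl⟩ := FExpr.toV_eq_axis hp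
  obtain ⟨U, h1, h2, h3⟩ := h' S' T hS hT hy
  refine ⟨U, h1, h2, fun K _ hK => ?_⟩
  simp only [FExpr.Pre, LPath.Pre, LStep.Pre]
  exact ⟨T, h3, h m T.lab rfl hy.1, hK⟩

theorem eval_self {b : V} (h : Test n b) :
    Eval S (cons (Token.toV .self) n) (cons b G) (cons b G) :=
  eval_axis .self h fun _ T _ hT hy => ⟨T, hT, hy, rfl⟩

theorem eval_slash (h : Eval S e' y z) (h' : Eval S e z x) :
    Eval S (cons (Token.toV .slash) (cons e e')) y x := by
  intro S' p T hS hp hT hy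
  obtain ⟨p1, p2, hm, hv⟩ := FExpr.toV_eq_slash hp
  subst hm
  simp only [V.cons.injEq] at hv
  obtain ⟨U, h1, h2, h3⟩ := h S' (.path p2) T hS (by simpa [FExpr.toV] using hv.2) hT hy
  obtain ⟨W, h4, h5, h6⟩ := h' S' (.path p1) U hS (by simpa [FExpr.toV] using hv.1) h1 h2
  refine ⟨W, h4, h5, fun K hK hKT => ?_⟩
  simp only [FExpr.Pre, LPath.Pre] at *
  exact h6 _ (p2.growClosed_pre hK) (h3 K hK hKT)

theorem eval_bar_left (h : Eval S e y x) :
    Eval S (cons (Token.toV .bar) (cons e e')) y x := by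
  intro S' p T hS hp hT hy
  obtain ⟨p1, p2, hm, hv⟩ := FExpr.toV_eq_bar hp
  subst hm
  simp only [V.cons.injEq] at hv
  obtain ⟨U, h1, h2, h3⟩ := h S' (.path p1) T hS (by simpa [FExpr.toV] using hv.1) hT hy
  refine ⟨U, h1, h2, fun K hK hKT => ?_⟩
  simp only [FExpr.Pre, LPath.Pre] at *
  exact .inl (h3 K hK hKT)

theorem eval_bar_right (h : Eval S e' y x) :
    Eval S (cons (Token.toV .bar) (cons e e')) y x := by
  intro S' p T hS hp hT hy
  obtain ⟨p1, p2, hm, hv⟩ := FExpr.toV_eq_bar hp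
  subst hm
  simp only [V.cons.injEq] at hv
  obtain ⟨U, h1, h2, h3⟩ := h S' (.path p2) T hS (by simpa [FExpr.toV] using hv.2) hT hy
  refine ⟨U, h1, h2, fun K hK hKT => ?_⟩
  simp only [FExpr.Pre, LPath.Pre] at *
  exact .inr (h3 K hK hKT)

/-- Trees whose roots have the same state can be merged at the root. -/
theorem eval_filter (h : Filter S e' y) (h' : Eval S e y x) :
    Eval S (cons (Token.toV .filter) (cons e e')) y x := by
  intro S' p T hS hp hT hy
  obtain ⟨s, f, hm, hv⟩ := FExpr.toV_eq_filter hp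
  subst hm
  simp only [V.cons.injEq] at hv
  obtain ⟨⟨b, ds⟩, h1, h2, h3⟩ := h S' f hS hv.2
  obtain ⟨a, cs⟩ := T
  -- The common state determines the label, so the two roots can be identified and their lists of
  -- children concatenated.
  obtain rfl : a = b := labV_injective (hy.1.symm.trans h2.1)
  have hlab : LabIn S' (.node a (cs ++ ds)) := by
    rw [labIn_node] at hT h1 ⊢
    refine ⟨hT.1, fun c hc => ?_⟩
    rcases List.mem_append.1 hc with hc | hc
    · exact hT.2 c hc
    · exact h1.2 c hc
  have hok : StateOk y (.node a (cs ++ ds)) := by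
    refine ⟨hy.1, fun ax m k hax hm => ?_⟩
    have g1 := hy.2 ax m k hax hm
    have g2 := h2.2 ax m k hax hm
    simp only [LStep.Pre] at g1 g2 ⊢
    rintro ⟨c, hc, hc'⟩
    rcases RT.rel_append hax hc with hc | hc
    · exact g1 ⟨c, hc, hc'⟩
    · exact g2 ⟨c, hc, hc'⟩
  obtain ⟨U, h4, h5, h6⟩ := h' S' (.path (.step s)) _ hS
    (by simpa [FExpr.toV, LPath.toV] using hv.1) hlab hok
  refine ⟨U, h4, h5, fun K hK hKT => ?_⟩
  have hf : GrowClosed (f.Pre fun _ => True) := f.growClosed_pre fun _ _ _ _ h => h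
  have := h6 (fun c => K c ∧ f.Pre (fun _ => True) c)
    (fun b cs' ds' h' h1 => ⟨hK b _ _ h' h1.1, hf b _ _ h' h1.2⟩)
    -- In the glued tree `K` is inherited from the left part and the filter from the right part.
    ⟨hK _ _ _ (List.subset_append_left _ _) hKT, hf _ _ _ (List.subset_append_right _ _) h3⟩
  simpa only [FExpr.Pre, LPath.Pre, LStep.Pre] using this

/-- The construction starts at a leaf, where every atom with a proper axis is false, so that any
list of atoms forms a correct state. -/
theorem filter_path {b : V} (h : Eval S e (cons b G) x) (h' : V.Mem b S) : Filter S e x := by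
  rintro S' f rfl rfl
  obtain ⟨l, hl, rfl⟩ := mem_alphV h'
  have hok : StateOk (cons (labV l) G) (.node l []) := by
    refine ⟨rfl, fun ax m k hax _ => ?_⟩
    simp only [LStep.Pre]
    rintro ⟨c, hc, -⟩
    cases ax with
    | self => exact hax rfl
    | child => simp [RT.Rel, RT.Child, RT.children] at hc
    | descendant =>
      obtain ⟨d, hd, -⟩ := Relation.TransGen.head'_iff.1 hc
      simp [RT.Child, RT.children] at hd
  obtain ⟨U, h1, h2, h3⟩ := h S' f _ rfl rfl (labIn_node.2 ⟨hl, by simp⟩) hok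
  exact ⟨U, h1, h2, h3 _ (fun _ _ _ _ h => h) trivial⟩

theorem filter_or_left (h : Filter S e x) :
    Filter S (cons (Token.toV .or) (cons e e')) x := by
  intro S' f hS hf
  obtain ⟨p, q, rfl, hpq⟩ := FExpr.toV_eq_or hf
  simp only [V.cons.injEq] at hpq
  obtain ⟨U, h1, h2, h3⟩ := h S' (.path p) hS (by simpa [FExpr.toV] using hpq.1)
  refine ⟨U, h1, h2, ?_⟩
  simp only [FExpr.Pre] at h3 ⊢
  exact .inl h3

theorem filter_or_right (h : Filter S e' x) :
    Filter S (cons (Token.toV .or) (cons e e')) x := by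
  intro S' f hS hf
  obtain ⟨p, q, rfl, hpq⟩ := FExpr.toV_eq_or hf
  simp only [V.cons.injEq] at hpq
  obtain ⟨U, h1, h2, h3⟩ := h S' (.path q) hS (by simpa [FExpr.toV] using hpq.2)
  refine ⟨U, h1, h2, ?_⟩
  simp only [FExpr.Pre] at h3 ⊢
  exact .inr h3

end tree

end Meaning

-- For a concrete clause the predicate number is a numeral and the arguments are entries of an
-- explicit list, so the meaning of an instance unfolds by computation to the matching lemma. The
-- other groups of clauses are treated alike.
open Meaning in
theorem meaning_parseClauses : ∀ c ∈ parseClauses, ∀ θ, Meaning (c.body₁.inst θ) →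
    Meaning (c.body₂.inst θ) → Meaning (c.head.inst θ) := by
  simp only [parseClauses, List.forall_mem_cons]
  exact ⟨fun _ _ _ => rfl, fun _ _ _ => reads_label_end, fun _ h _ => reads_label_bit false h,
    fun _ h _ => reads_label_bit true h, fun _ _ _ => reads_star, fun _ h _ => reads_test h,
    fun _ h _ => reads_base .self h, fun _ h _ => reads_base .child h,
    fun _ h _ => reads_base .descendant h, fun _ h h' => reads_filter h h',
    fun _ h _ => reads_step h, fun _ h h' => reads_slash h h', fun _ h h' => reads_bar h h',
    fun _ h _ => reads_path h, fun _ h h' => reads_or h h', fun _ _ _ => reads_alphabet_end,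
    fun _ h h' => reads_alphabet h h', fun _ h h' => instance_of h h',
    fun _ h h' => paths_of h h', by simp⟩

open Meaning in
theorem meaning_mainClauses : ∀ c ∈ mainClauses, ∀ θ, Meaning (c.body₁.inst θ) →
    Meaning (c.body₂.inst θ) → Meaning (c.head.inst θ) := by
  simp only [mainClauses, List.forall_mem_cons]
  exact ⟨fun _ h h' => bad_of h h', fun _ h h' => badPaths_of h h',
    fun _ h h' => badPath_of h h', fun _ h h' => nonContained_of h h', by simp⟩

open Meaning in
theorem meaning_testClauses : ∀ c ∈ testClauses, ∀ θ, Meaning (c.body₁.inst θ) →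
    Meaning (c.body₂.inst θ) → Meaning (c.head.inst θ) := by
  simp only [testClauses, List.forall_mem_cons]
  exact ⟨fun _ _ _ => .inl rfl, fun _ h _ => .inr h, fun _ _ _ => V.noConfusion,
    fun _ _ _ => V.noConfusion, fun _ h _ h' => h (V.cons.inj h').1,
    fun _ h _ h' => h (V.cons.inj h').2, fun _ _ _ => test_star, fun _ _ _ => test_label,
    by simp⟩

open Meaning in
theorem meaning_refuteClauses : ∀ c ∈ refuteClauses, ∀ θ, Meaning (c.body₁.inst θ) →
    Meaning (c.body₂.inst θ) → Meaning (c.head.inst θ) := by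
  simp only [refuteClauses, List.forall_mem_cons]
  exact ⟨fun _ h _ => refuteTest_label h, fun _ h _ => refuteTest_cont h,
    fun _ h _ => refuteCont_thn h, fun _ h _ => refuteCont_and h,
    fun _ h _ => refuteCont_and' h, fun _ h h' => refute_or h h', fun _ h h' => refute_bar h h',
    fun _ h _ => refute_slash h, fun _ h _ => refute_filter h, fun _ h _ => refute_self h,
    fun _ h _ => refute_axis .child (by simp) h,
    fun _ h _ => refute_axis .descendant (by simp) h, by simp⟩

open Meaning in
theorem meaning_treeClauses : ∀ c ∈ treeClauses, ∀ θ, Meaning (c.body₁.inst θ) →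
    Meaning (c.body₂.inst θ) → Meaning (c.head.inst θ) := by
  simp only [treeClauses, List.forall_mem_cons]
  exact ⟨fun _ h _ => upAtom_child h, fun _ h h' => upAtom_descendant h h',
    fun _ _ _ _ h => h.elim, fun _ h h' => upAtoms_cons h h', fun _ h h' => up_of h h',
    fun _ h _ => chain_up h, fun _ h h' => chain_trans h h', fun _ h _ => eval_self h,
    fun _ h h' => eval_axis .child h h', fun _ h h' => eval_axis .descendant h h',
    fun _ h h' => eval_slash h h', fun _ h _ => eval_bar_left h, fun _ h _ => eval_bar_right h,
    fun _ h h' => eval_filter h h', fun _ h h' => filter_path h h',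
    fun _ h _ => filter_or_left h, fun _ h _ => filter_or_right h, by simp⟩

theorem meaning_clauses : ∀ c ∈ clauses, ∀ θ, Meaning (c.body₁.inst θ) →
    Meaning (c.body₂.inst θ) → Meaning (c.head.inst θ) := by
  intro c hc
  simp only [clauses, List.mem_append] at hc
  rcases hc with (((hc | hc) | hc) | hc) | hc
  exacts [meaning_parseClauses c hc, meaning_mainClauses c hc, meaning_testClauses c hc,
    meaning_refuteClauses c hc, meaning_treeClauses c hc]

theorem meaning_of_solve {M : ℕ} {g : V} (h : solve clauses M g = true) : Meaning g :=
  solve_sound (D := Meaning) (by simp [Meaning, len]) rfl meaning_clauses h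

/-! ### Derivations of bounded height -/

/-- `g` has a derivation of height at most `n` with values of size at most `M`. -/
def Der (M n : ℕ) (g : V) : Prop := ∃ k ≤ n, Drv clauses M k g

theorem Der.mono {M n n' : ℕ} {g : V} (h : Der M n g) (hn : n ≤ n') : Der M n' g := by
  obtain ⟨k, hk, h⟩ := h
  exact ⟨k, hk.trans hn, h⟩

theorem Der.triv {M n : ℕ} : Der M n tt := ⟨0, Nat.zero_le _, .axm⟩

theorem parseClauses_subset : parseClauses ⊆ clauses := fun c hc => by simp [clauses, hc]
theorem mainClauses_subset : mainClauses ⊆ clauses := fun c hc => by simp [clauses, hc]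
theorem testClauses_subset : testClauses ⊆ clauses := fun c hc => by simp [clauses, hc]
theorem refuteClauses_subset : refuteClauses ⊆ clauses := fun c hc => by simp [clauses, hc]
theorem treeClauses_subset : treeClauses ⊆ clauses := fun c hc => by simp [clauses, hc]

theorem V.size_ofList_le {l : List V} {b : ℕ} (h : ∀ v ∈ l, v.size ≤ b) :
    (V.ofList l).size ≤ l.length * (b + 1) + 1 := by
  induction l with
  | nil => simp [V.ofList]
  | cons a l ih =>
    have h1 := h a (by simp)
    have h2 := ih fun v hv => h v (by simp [hv])
    simp only [V.ofList, size_cons, List.length_cons, add_mul, one_mul]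
    omega

/-- Six values of size at most `b` form a substitution of size at most `6 * b + 7`, and the `60`
clauses account for another `122`; the constant `200` covers both. -/
theorem Der.intro {M b n : ℕ} (hM : 6 * b + 200 ≤ M) {cs : List Clause} (hcs : cs ⊆ clauses)
    (i : ℕ) {c : Clause} (hi : cs[i]? = some c) (vs : List V) (hl : vs.length ≤ 6)
    (hs : ∀ v ∈ vs, v.size ≤ b) (h₁ : Der M n (c.body₁.inst (V.ofList vs)))
    (h₂ : Der M n (c.body₂.inst (V.ofList vs))) : Der M (n + 1) (c.head.inst (V.ofList vs)) := by
  have hlen : clauses.length = 60 := rfl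
  obtain ⟨k₁, hk₁, h₁⟩ := h₁
  obtain ⟨k₂, hk₂, h₂⟩ := h₂
  have ht : ⟨.cons .nil .nil, .cons .nil .nil, .cons .nil .nil⟩ ∈ clauses :=
    parseClauses_subset (by simp [parseClauses])
  have h3 := V.size_ofList_le hs
  have h4 : vs.length * (b + 1) ≤ 6 * (b + 1) := Nat.mul_le_mul_right _ hl
  exact ⟨n + 1, le_rfl, .step (hcs (List.mem_of_getElem? hi)) (by omega)
    (h₁.mono_height ht (by omega) hk₁) (h₂.mono_height ht (by omega) hk₂)⟩

/-! ### Derivability of parsing goals -/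

theorem Token.size_toV_le (t : Token) : t.toV.size ≤ 23 := by
  have := t.idx_le
  simp [Token.toV]; omega

theorem size_wordV_le (l : List Token) : (wordV l).size ≤ 24 * l.length + 1 := by
  induction l with
  | nil => simp
  | cons t l ih =>
    have := t.size_toV_le
    simp; omega

theorem size_labV_le (a : Label) : (labV a).size ≤ 24 * a.length + 1 := by
  have := size_wordV_le (a.map Token.bit)
  rwa [List.length_map] at this

theorem length_encodeLabel (a : Label) : (encodeLabel a).length = a.length + 1 := by
  simp [encodeLabel]

theorem NodeTest.size_toV_le (n : NodeTest) : n.toV.size ≤ 25 * n.encode.length := by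
  cases n with
  | label a =>
    have := size_labV_le a
    have := Token.size_toV_le .endLabel
    simp [NodeTest.toV, NodeTest.encode, length_encodeLabel]; omega
  | wildcard => simp [NodeTest.toV, NodeTest.encode, Token.toV, Token.idx]

mutual
theorem LPath.size_toV_le : ∀ p : LPath, p.toV.size ≤ 25 * p.encode.length
  | .step s => by
    simpa only [LPath.toV, LPath.encode] using s.size_toV_le
  | .seq p q => by
    have := p.size_toV_le
    have := q.size_toV_le
    simp [LPath.toV, LPath.encode, Token.toV, Token.idx]; omega
  | .union p q => by
    have := p.size_toV_le
    have := q.size_toV_le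
    simp [LPath.toV, LPath.encode, Token.toV, Token.idx]; omega
theorem LStep.size_toV_le : ∀ s : LStep, s.toV.size ≤ 25 * s.encode.length
  | .base a n => by
    have := n.size_toV_le
    cases a <;> simp [LStep.toV, LStep.encode, Axis.token, Token.toV, Token.idx] <;> omega
  | .filter s e => by
    have := s.size_toV_le
    have := e.size_toV_le
    simp [LStep.toV, LStep.encode, Token.toV, Token.idx]; omega
theorem FExpr.size_toV_le : ∀ e : FExpr, e.toV.size ≤ 25 * e.encode.length
  | .path p => by
    simpa only [FExpr.toV, FExpr.encode] using p.size_toV_le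
  | .or p q => by
    have := p.size_toV_le
    have := q.size_toV_le
    simp [FExpr.toV, FExpr.encode, Token.toV, Token.idx]; omega
end

theorem size_alphV_le (S : List Label) : (alphV S).size ≤ 24 * (encodeAlphabet S).length := by
  induction S with
  | nil => simp [alphV, V.ofList, encodeAlphabet]
  | cons a S ih =>
    have := size_labV_le a
    simp [alphV, V.ofList, encodeAlphabet, length_encodeLabel] at ih ⊢
    omega

theorem length_le_alphabet (S : List Label) : S.length ≤ (encodeAlphabet S).length := by
  induction S with
  | nil => simp
  | cons a S ih =>
    simp [encodeAlphabet, length_encodeLabel] at ih ⊢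
    omega

section parse
variable {M b L : ℕ}

theorem der_label (hM : 6 * b + 200 ≤ M) (hb : 25 * L + 25 ≤ b) (a : Label) (r : List Token)
    (h : a.length + r.length ≤ L) :
    Der M (a.length + 1) (goal 1 [wordV (encodeLabel a ++ r), wordV r, labV a]) := by
  have hr := size_wordV_le r
  induction a with
  | nil =>
    exact Der.intro hM parseClauses_subset 1 rfl [wordV r] (by simp)
      (by simp at h ⊢; omega) Der.triv Der.triv
  | cons c a ih =>
    simp only [List.length_cons] at h
    have h1 := size_wordV_le (encodeLabel a ++ r)
    have h2 := size_labV_le a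
    simp only [List.length_append, length_encodeLabel] at h1
    have hs : ∀ v ∈ [wordV (encodeLabel a ++ r), wordV r, labV a], v.size ≤ b := by
      simp; omega
    cases c
    · exact Der.intro hM parseClauses_subset 2 rfl _ (by simp) hs (ih (by omega)) Der.triv
    · exact Der.intro hM parseClauses_subset 3 rfl _ (by simp) hs (ih (by omega)) Der.triv

theorem der_nodeTest (hM : 6 * b + 200 ≤ M) (hb : 25 * L + 25 ≤ b) (n : NodeTest)
    (r : List Token) (h : n.encode.length + r.length ≤ L) :
    Der M (n.encode.length + 1) (goal 2 [wordV (n.encode ++ r), wordV r, n.toV]) := by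
  have hr := size_wordV_le r
  cases n with
  | wildcard =>
    exact Der.intro hM parseClauses_subset 4 rfl [wordV r] (by simp)
      (by simp; omega) Der.triv Der.triv
  | label a =>
    simp only [NodeTest.encode, length_encodeLabel] at h ⊢
    have h1 := size_wordV_le (encodeLabel a ++ r)
    have h2 := size_labV_le a
    simp only [List.length_append, length_encodeLabel] at h1
    exact Der.intro hM parseClauses_subset 5 rfl [wordV (encodeLabel a ++ r), wordV r, labV a]
      (by simp) (by simp; omega) (der_label hM hb a r (by omega)) Der.triv

mutual
-- The offsets `0`, `1`, `2` in the heights for steps, paths and filters pay for the unit clauses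
-- from step to path to filter; the four levels allotted to the leading token of a compound
-- expression pay for the rest.
theorem der_lpath (hM : 6 * b + 200 ≤ M) (hb : 25 * L + 25 ≤ b) : ∀ (p : LPath) (r : List Token),
    p.encode.length + r.length ≤ L →
    Der M (4 * p.encode.length + 1) (goal 4 [wordV (p.encode ++ r), wordV r, p.toV])
  | .step s, r, h => by
    have hr := size_wordV_le r
    simp only [LPath.encode, LPath.toV] at h ⊢
    have h1 := size_wordV_le (s.encode ++ r)
    have h2 := s.size_toV_le
    simp only [List.length_append] at h1
    exact Der.intro hM parseClauses_subset 10 rfl [wordV (s.encode ++ r), wordV r, s.toV]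
      (by simp) (by simp; omega) (der_lstep hM hb s r h) Der.triv
  | .seq p q, r, h => by
    have hr := size_wordV_le r
    simp only [LPath.encode, LPath.toV, List.length_cons, List.length_append, List.cons_append,
      List.append_assoc] at h ⊢
    have h1 := size_wordV_le (p.encode ++ (q.encode ++ r))
    have h2 := size_wordV_le (q.encode ++ r)
    have h3 := p.size_toV_le
    have h4 := q.size_toV_le
    simp only [List.length_append] at h1 h2
    exact (Der.intro hM parseClauses_subset 11 rfl
      [wordV (p.encode ++ (q.encode ++ r)), wordV (q.encode ++ r), wordV r, p.toV, q.toV]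
      (by simp) (by simp; omega)
      ((der_lpath hM hb p (q.encode ++ r) (by simp; omega)).mono
        (n' := 4 * (p.encode.length + q.encode.length) + 1) (by omega))
      ((der_lpath hM hb q r (by omega)).mono (by omega))).mono (by omega)
  | .union p q, r, h => by
    have hr := size_wordV_le r
    simp only [LPath.encode, LPath.toV, List.length_cons, List.length_append, List.cons_append,
      List.append_assoc] at h ⊢
    have h1 := size_wordV_le (p.encode ++ (q.encode ++ r))
    have h2 := size_wordV_le (q.encode ++ r)
    have h3 := p.size_toV_le
    have h4 := q.size_toV_le
    simp only [List.length_append] at h1 h2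
    exact (Der.intro hM parseClauses_subset 12 rfl
      [wordV (p.encode ++ (q.encode ++ r)), wordV (q.encode ++ r), wordV r, p.toV, q.toV]
      (by simp) (by simp; omega)
      ((der_lpath hM hb p (q.encode ++ r) (by simp; omega)).mono
        (n' := 4 * (p.encode.length + q.encode.length) + 1) (by omega))
      ((der_lpath hM hb q r (by omega)).mono (by omega))).mono (by omega)
theorem der_lstep (hM : 6 * b + 200 ≤ M) (hb : 25 * L + 25 ≤ b) : ∀ (s : LStep) (r : List Token),
    s.encode.length + r.length ≤ L →
    Der M (4 * s.encode.length) (goal 3 [wordV (s.encode ++ r), wordV r, s.toV])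
  | .base a n, r, h => by
    have hr := size_wordV_le r
    simp only [LStep.encode, LStep.toV, List.length_cons, List.cons_append] at h ⊢
    have h1 := size_wordV_le (n.encode ++ r)
    have h2 := n.size_toV_le
    simp only [List.length_append] at h1
    have hn := der_nodeTest hM hb n r (by omega)
    have hs : ∀ v ∈ [wordV (n.encode ++ r), wordV r, n.toV], v.size ≤ b := by simp; omega
    cases a
    · exact (Der.intro hM parseClauses_subset 6 rfl _ (by simp) hs hn Der.triv).mono (by omega)
    · exact (Der.intro hM parseClauses_subset 7 rfl _ (by simp) hs hn Der.triv).mono (by omega)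
    · exact (Der.intro hM parseClauses_subset 8 rfl _ (by simp) hs hn Der.triv).mono (by omega)
  | .filter s e, r, h => by
    have hr := size_wordV_le r
    simp only [LStep.encode, LStep.toV, List.length_cons, List.length_append, List.cons_append,
      List.append_assoc] at h ⊢
    have h1 := size_wordV_le (s.encode ++ (e.encode ++ r))
    have h2 := size_wordV_le (e.encode ++ r)
    have h3 := s.size_toV_le
    have h4 := e.size_toV_le
    simp only [List.length_append] at h1 h2
    exact (Der.intro hM parseClauses_subset 9 rfl
      [wordV (s.encode ++ (e.encode ++ r)), wordV (e.encode ++ r), wordV r, s.toV, e.toV]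
      (by simp) (by simp; omega)
      ((der_lstep hM hb s (e.encode ++ r) (by simp; omega)).mono
        (n' := 4 * (s.encode.length + e.encode.length) + 2) (by omega))
      ((der_fexpr hM hb e r (by omega)).mono (by omega))).mono (by omega)
theorem der_fexpr (hM : 6 * b + 200 ≤ M) (hb : 25 * L + 25 ≤ b) : ∀ (e : FExpr) (r : List Token),
    e.encode.length + r.length ≤ L →
    Der M (4 * e.encode.length + 2) (goal 5 [wordV (e.encode ++ r), wordV r, e.toV])
  | .path p, r, h => by
    have hr := size_wordV_le r
    simp only [FExpr.encode, FExpr.toV] at h ⊢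
    have h1 := size_wordV_le (p.encode ++ r)
    have h2 := p.size_toV_le
    simp only [List.length_append] at h1
    exact Der.intro hM parseClauses_subset 13 rfl [wordV (p.encode ++ r), wordV r, p.toV]
      (by simp) (by simp; omega) (der_lpath hM hb p r h) Der.triv
  | .or p q, r, h => by
    have hr := size_wordV_le r
    simp only [FExpr.encode, FExpr.toV, List.length_cons, List.length_append, List.cons_append,
      List.append_assoc] at h ⊢
    have h1 := size_wordV_le (p.encode ++ (q.encode ++ r))
    have h2 := size_wordV_le (q.encode ++ r)
    have h3 := p.size_toV_le
    have h4 := q.size_toV_le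
    simp only [List.length_append] at h1 h2
    exact (Der.intro hM parseClauses_subset 14 rfl
      [wordV (p.encode ++ (q.encode ++ r)), wordV (q.encode ++ r), wordV r, p.toV, q.toV]
      (by simp) (by simp; omega)
      ((der_lpath hM hb p (q.encode ++ r) (by simp; omega)).mono
        (n' := 4 * (p.encode.length + q.encode.length) + 1) (by omega))
      ((der_lpath hM hb q r (by omega)).mono (by omega))).mono (by omega)
end

theorem der_alphabet (hM : 6 * b + 200 ≤ M) (hb : 25 * L + 25 ≤ b) (S : List Label)
    (r : List Token) (h : (encodeAlphabet S).length + r.length ≤ L) :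
    Der M (encodeAlphabet S).length
      (goal 6 [wordV (encodeAlphabet S ++ r), wordV r, alphV S]) := by
  have hr := size_wordV_le r
  induction S with
  | nil =>
    exact Der.intro hM parseClauses_subset 15 rfl [wordV r] (by simp) (by simp; omega)
      Der.triv Der.triv
  | cons a S ih =>
    have e : encodeAlphabet (a :: S) = encodeLabel a ++ encodeAlphabet S := by
      simp [encodeAlphabet]
    simp only [e, List.length_append, length_encodeLabel, List.append_assoc] at h ⊢
    have h1 := size_wordV_le (encodeLabel a ++ (encodeAlphabet S ++ r))
    have h2 := size_wordV_le (encodeAlphabet S ++ r)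
    have h3 := size_labV_le a
    have h4 := size_alphV_le S
    simp only [List.length_append, length_encodeLabel] at h1 h2
    have hpos : 1 ≤ (encodeAlphabet S).length := by simp [encodeAlphabet]
    exact (Der.intro hM parseClauses_subset 16 rfl
      [wordV (encodeLabel a ++ (encodeAlphabet S ++ r)), wordV (encodeAlphabet S ++ r), wordV r,
        labV a, alphV S]
      (by simp) (by simp; omega)
      ((der_label hM hb a (encodeAlphabet S ++ r) (by simp; omega)).mono
        (n' := a.length + (encodeAlphabet S).length) (by omega))
      ((ih (by omega)).mono (by omega))).mono (by omega)

theorem der_instance (hM : 6 * b + 200 ≤ M) (hb : 25 * L + 25 ≤ b) (S : List Label)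
    (p q : LPath) (h : (encodeInstance S p q).length ≤ L) :
    Der M (5 * L + 5) (goal 7 [wordV (encodeInstance S p q)]) := by
  simp only [encodeInstance, List.length_append] at h ⊢
  have h1 := size_wordV_le (encodeAlphabet S ++ (p.encode ++ q.encode))
  have h2 := size_wordV_le (p.encode ++ q.encode)
  have h3 := size_wordV_le q.encode
  have h4 := size_alphV_le S
  have h5 := p.size_toV_le
  have h6 := q.size_toV_le
  simp only [List.length_append] at h1 h2
  have hq := der_lpath hM hb q [] (by simp; omega)
  rw [List.append_nil] at hq
  have hpq : Der M (5 * L + 3) (goal 8 [wordV (p.encode ++ q.encode)]) :=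
    (Der.intro hM parseClauses_subset 18 rfl
      [wordV (p.encode ++ q.encode), wordV q.encode, p.toV, q.toV] (by simp) (by simp; omega)
      ((der_lpath hM hb p q.encode (by omega)).mono (n' := 5 * L + 2) (by omega))
      (hq.mono (by omega))).mono (by omega)
  exact (Der.intro hM parseClauses_subset 17 rfl
    [wordV (encodeAlphabet S ++ (p.encode ++ q.encode)), wordV (p.encode ++ q.encode), alphV S]
    (by simp) (by simp; omega)
    ((der_alphabet hM hb S _ (by simp; omega)).mono (n' := 5 * L + 3) (by omega)) hpq).mono
    (by omega)

theorem der_bad (hM : 6 * b + 200 ≤ M) (hb : 25 * L + 25 ≤ b) (S : List Label)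
    (p q : LPath) (h : (encodeInstance S p q).length ≤ L) {n : ℕ} (hn : 5 * L + 5 ≤ n)
    (hpq : Der M n (goal 12 [alphV S, p.toV, q.toV])) :
    Der M (n + 3) (goal 9 [wordV (encodeInstance S p q)]) := by
  simp only [encodeInstance, List.length_append] at h ⊢
  have h1 := size_wordV_le (encodeAlphabet S ++ (p.encode ++ q.encode))
  have h2 := size_wordV_le (p.encode ++ q.encode)
  have h3 := size_wordV_le q.encode
  have h4 := size_alphV_le S
  have h5 := p.size_toV_le
  have h6 := q.size_toV_le
  simp only [List.length_append] at h1 h2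
  have hq := der_lpath hM hb q [] (by simp; omega)
  rw [List.append_nil] at hq
  have g1 : Der M (n + 1) (goal 11 [wordV q.encode, alphV S, p.toV]) :=
    Der.intro hM mainClauses_subset 2 rfl [nil, wordV q.encode, alphV S, p.toV, q.toV] (by simp)
      (by simp; omega) (hq.mono (by omega)) hpq
  have g2 : Der M (n + 2) (goal 10 [wordV (p.encode ++ q.encode), alphV S]) :=
    Der.intro hM mainClauses_subset 1 rfl
      [wordV (p.encode ++ q.encode), wordV q.encode, alphV S, p.toV] (by simp)
      (by simp; omega) ((der_lpath hM hb p q.encode (by omega)).mono (by omega)) g1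
  exact Der.intro hM mainClauses_subset 0 rfl
    [wordV (encodeAlphabet S ++ (p.encode ++ q.encode)), wordV (p.encode ++ q.encode), alphV S]
    (by simp) (by simp; omega)
    ((der_alphabet hM hb S _ (by simp; omega)).mono (by omega)) g2

end parse

/-! ### Atoms of an expression -/

/-- The typed version of `atomV`. -/
abbrev Atom := Axis × NodeTest × List Item

def Atom.toV (g : Atom) : V := atomV g.1 g.2.1 g.2.2

mutual
-- These are the steps that a refutation with continuation `k` can meet, each with the continuation
-- it then has. A filter starts anew with the empty continuation, as it does not influence where the
-- path goes on.
def LPath.atoms : LPath → List Item → List Atom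
  | .step s, k => s.atoms k
  | .seq p q, k => p.atoms (.thn q :: k) ++ q.atoms k
  | .union p q, k => p.atoms k ++ q.atoms k
def LStep.atoms : LStep → List Item → List Atom
  | .base a n, k => [(a, n, k)]
  | .filter s e, k => s.atoms (.and e :: k) ++ e.atoms []
def FExpr.atoms : FExpr → List Item → List Atom
  | .path p, k => p.atoms k
  | .or p q, k => p.atoms k ++ q.atoms k
end

def contAtoms : List Item → List Atom
  | [] => []
  | .thn p :: k => p.atoms k ++ contAtoms k
  | .and e :: k => e.atoms [] ++ contAtoms k

mutual
-- With `k = []` this is the closure property of `Adequate`: refuting the continuation of an atom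
-- never leads outside the list.
theorem LPath.contAtoms_of_mem : ∀ (p : LPath) (k : List Item), ∀ g ∈ p.atoms k,
    ∀ h ∈ contAtoms g.2.2, h ∈ p.atoms k ∨ h ∈ contAtoms k
  | .step s, k, g, hg, h, hh => by
    simp only [LPath.atoms] at hg ⊢
    exact s.contAtoms_of_mem k g hg h hh
  | .seq p q, k, g, hg, h, hh => by
    simp only [LPath.atoms, List.mem_append] at hg ⊢
    rcases hg with hg | hg
    · have := p.contAtoms_of_mem _ g hg h hh
      simp only [contAtoms, List.mem_append] at this
      tauto
    · have := q.contAtoms_of_mem _ g hg h hh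
      tauto
  | .union p q, k, g, hg, h, hh => by
    simp only [LPath.atoms, List.mem_append] at hg ⊢
    rcases hg with hg | hg
    · have := p.contAtoms_of_mem _ g hg h hh
      tauto
    · have := q.contAtoms_of_mem _ g hg h hh
      tauto
theorem LStep.contAtoms_of_mem : ∀ (s : LStep) (k : List Item), ∀ g ∈ s.atoms k,
    ∀ h ∈ contAtoms g.2.2, h ∈ s.atoms k ∨ h ∈ contAtoms k
  | .base a n, k, g, hg, h, hh => by
    simp only [LStep.atoms, List.mem_singleton] at hg
    subst hg
    exact .inr hh
  | .filter s e, k, g, hg, h, hh => by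
    simp only [LStep.atoms, List.mem_append] at hg ⊢
    rcases hg with hg | hg
    · have := s.contAtoms_of_mem _ g hg h hh
      simp only [contAtoms, List.mem_append] at this
      tauto
    · have := e.contAtoms_of_mem _ g hg h hh
      simp only [contAtoms, List.not_mem_nil] at this
      tauto
theorem FExpr.contAtoms_of_mem : ∀ (e : FExpr) (k : List Item), ∀ g ∈ e.atoms k,
    ∀ h ∈ contAtoms g.2.2, h ∈ e.atoms k ∨ h ∈ contAtoms k
  | .path p, k, g, hg, h, hh => by
    simp only [FExpr.atoms] at hg ⊢
    exact p.contAtoms_of_mem k g hg h hh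
  | .or p q, k, g, hg, h, hh => by
    simp only [FExpr.atoms, List.mem_append] at hg ⊢
    rcases hg with hg | hg
    · have := p.contAtoms_of_mem _ g hg h hh
      tauto
    · have := q.contAtoms_of_mem _ g hg h hh
      tauto
end

mutual
-- Pushing an operand onto the continuation costs less than the token in front of it, so atoms do
-- not outgrow the expression.
theorem LPath.size_atom_le : ∀ (p : LPath) (k : List Item), ∀ g ∈ p.atoms k,
    g.toV.size ≤ p.toV.size + (contV k).size + 1
  | .step s, k, g, hg => by
    simp only [LPath.atoms, LPath.toV] at hg ⊢
    exact s.size_atom_le k g hg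
  | .seq p q, k, g, hg => by
    simp only [LPath.atoms, List.mem_append] at hg
    rcases hg with hg | hg
    · have := p.size_atom_le _ g hg
      simp [LPath.toV, contV, Token.toV, Token.idx] at this ⊢
      omega
    · have := q.size_atom_le _ g hg
      simp [LPath.toV]
      omega
  | .union p q, k, g, hg => by
    simp only [LPath.atoms, List.mem_append] at hg
    rcases hg with hg | hg
    · have := p.size_atom_le _ g hg
      simp [LPath.toV]
      omega
    · have := q.size_atom_le _ g hg
      simp [LPath.toV]
      omega
theorem LStep.size_atom_le : ∀ (s : LStep) (k : List Item), ∀ g ∈ s.atoms k,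
    g.toV.size ≤ s.toV.size + (contV k).size + 1
  | .base a n, k, g, hg => by
    simp only [LStep.atoms, List.mem_singleton] at hg
    subst hg
    simp [Atom.toV, atomV, LStep.toV]
    omega
  | .filter s e, k, g, hg => by
    simp only [LStep.atoms, List.mem_append] at hg
    rcases hg with hg | hg
    · have := s.size_atom_le _ g hg
      simp [LStep.toV, contV, Token.toV, Token.idx] at this ⊢
      omega
    · have := e.size_atom_le _ g hg
      simp [LStep.toV, contV] at this ⊢
      omega
theorem FExpr.size_atom_le : ∀ (e : FExpr) (k : List Item), ∀ g ∈ e.atoms k,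
    g.toV.size ≤ e.toV.size + (contV k).size + 1
  | .path p, k, g, hg => by
    simp only [FExpr.atoms, FExpr.toV] at hg ⊢
    exact p.size_atom_le k g hg
  | .or p q, k, g, hg => by
    simp only [FExpr.atoms, List.mem_append] at hg
    rcases hg with hg | hg
    · have := p.size_atom_le _ g hg
      simp [FExpr.toV]
      omega
    · have := q.size_atom_le _ g hg
      simp [FExpr.toV]
      omega
end

mutual
theorem LPath.length_atoms_le : ∀ (p : LPath) (k : List Item), (p.atoms k).length ≤ p.toV.size
  | .step s, k => by
    simpa only [LPath.atoms, LPath.toV] using s.length_atoms_le k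
  | .seq p q, k => by
    have := p.length_atoms_le (.thn q :: k)
    have := q.length_atoms_le k
    simp [LPath.atoms, LPath.toV]
    omega
  | .union p q, k => by
    have := p.length_atoms_le k
    have := q.length_atoms_le k
    simp [LPath.atoms, LPath.toV]
    omega
theorem LStep.length_atoms_le : ∀ (s : LStep) (k : List Item), (s.atoms k).length ≤ s.toV.size
  | .base a n, k => by
    simp [LStep.atoms, LStep.toV]
  | .filter s e, k => by
    have := s.length_atoms_le (.and e :: k)
    have := e.length_atoms_le []
    simp [LStep.atoms, LStep.toV]
    omega
theorem FExpr.length_atoms_le : ∀ (e : FExpr) (k : List Item), (e.atoms k).length ≤ e.toV.size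
  | .path p, k => by
    simpa only [FExpr.atoms, FExpr.toV] using p.length_atoms_le k
  | .or p q, k => by
    have := p.length_atoms_le k
    have := q.length_atoms_le k
    simp [FExpr.atoms, FExpr.toV]
    omega
end

/-! ### The states of the vertices of a tree -/

namespace XMLTree

/-- A continuation is satisfied at a vertex. -/
def SatK (t : XMLTree) : List Item → Vertex → Prop
  | [], _ => True
  | .thn p :: k, v => ∃ w, p.Sem t v w ∧ t.SatK k w
  | .and e :: k, v => t.SatK k v ∧ e.Holds t v

/-- The atom `g` is true at `v`. -/
def Sat (t : XMLTree) (g : Atom) (v : Vertex) : Prop :=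
  ∃ w, (LStep.base g.1 g.2.1).Sem t v w ∧ t.SatK g.2.2 w

open Classical in
/-- The atoms from `A` with a proper axis which are false at `v`. -/
noncomputable def falseAtoms (t : XMLTree) (A : List Atom) (v : Vertex) : List Atom :=
  A.filter fun g => g.1 ≠ .self ∧ ¬ t.Sat g v

theorem mem_falseAtoms {t : XMLTree} {A : List Atom} {v : Vertex} {g : Atom} :
    g ∈ t.falseAtoms A v ↔ g ∈ A ∧ g.1 ≠ .self ∧ ¬ t.Sat g v := by
  simp [falseAtoms]

/-- The state of the vertex `v`. -/
noncomputable def state (t : XMLTree) (A : List Atom) (v : Vertex) : V :=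
  cons (labV (t.lab v)) (V.ofList ((t.falseAtoms A v).map Atom.toV))

end XMLTree

def FExpr.Leads (t : XMLTree) (K : Vertex → Prop) (v : Vertex) : FExpr → Prop
  | .path p => ∃ w, p.Sem t v w ∧ K w
  | .or p q => (∃ w, p.Sem t v w ∧ K w) ∨ ∃ w, q.Sem t v w ∧ K w

theorem FExpr.leads_true {t : XMLTree} {v : Vertex} {e : FExpr} :
    e.Leads t (fun _ => True) v ↔ e.Holds t v := by
  cases e <;> simp [FExpr.Leads, FExpr.Holds]

/-- Bounds for the derivations about the states of `t`. -/
structure Adequate (M b : ℕ) (S : List Label) (t : XMLTree) (A : List Atom) : Prop where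
  hM : 6 * b + 200 ≤ M
  labelled : t.LabelledIn S
  size_alphV : (alphV S).size ≤ b
  length_S : S.length ≤ b
  length_A : A.length ≤ b
  size_state : ∀ v ∈ t.dom, (t.state A v).size ≤ b
  size_atom : ∀ g ∈ A, g.toV.size ≤ b
  closed : ∀ g ∈ A, contAtoms g.2.2 ⊆ A

theorem V.length_le_size_ofList (l : List V) : l.length ≤ (V.ofList l).size := by
  induction l with
  | nil => simp
  | cons a l ih => simp [V.ofList]; omega

theorem V.size_le_size_ofList {l : List V} {v : V} (h : v ∈ l) : v.size ≤ (V.ofList l).size := by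
  induction l with
  | nil => simp at h
  | cons a l ih =>
    rcases List.mem_cons.1 h with rfl | h
    · simp [V.ofList]; omega
    · have := ih h
      simp [V.ofList]; omega

-- Derivability of membership, inequality and node tests.

section tests
variable {M b : ℕ}

theorem der_mem (hM : 6 * b + 200 ≤ M) {a : V} {l : List V} (h : a ∈ l)
    (hb : (V.ofList l).size ≤ b) : Der M l.length (goal 13 [a, V.ofList l]) := by
  have ha := V.size_le_size_ofList h
  induction l with
  | nil => simp at h
  | cons c l ih =>
    simp only [V.ofList, size_cons] at hb
    rcases List.mem_cons.1 h with rfl | h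
    · exact (Der.intro hM testClauses_subset 0 rfl [a, V.ofList l] (by simp) (by simp; omega)
        Der.triv Der.triv).mono (n := 0 + 1) (by simp)
    · have ha' := V.size_le_size_ofList h
      exact Der.intro hM testClauses_subset 1 rfl [a, c, V.ofList l] (by simp) (by simp; omega)
        (ih h (by omega) ha') Der.triv

theorem der_ne (hM : 6 * b + 200 ≤ M) {u v : V} (h : u ≠ v) (hu : u.size ≤ b) (hv : v.size ≤ b) :
    Der M u.size (goal 14 [u, v]) := by
  induction u generalizing v with
  | nil =>
    cases v with
    | nil => exact absurd rfl h
    | cons c d =>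
      simp only [size_cons] at hv
      exact Der.intro hM testClauses_subset 2 rfl [c, d] (by simp) (by simp; omega)
        Der.triv Der.triv
  | cons u₁ u₂ ih₁ ih₂ =>
    simp only [size_cons] at hu ⊢
    cases v with
    | nil =>
      exact (Der.intro hM testClauses_subset 3 rfl [u₁, u₂] (by simp) (by simp; omega)
        Der.triv Der.triv).mono (n := 0 + 1) (by omega)
    | cons v₁ v₂ =>
      simp only [size_cons] at hv
      by_cases h₁ : u₁ = v₁
      · have h₂ : u₂ ≠ v₂ := fun h₂ => h (by rw [h₁, h₂])
        exact (Der.intro hM testClauses_subset 5 rfl [u₁, u₂, v₁, v₂] (by simp)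
          (by simp; omega) (ih₂ (v := v₂) h₂ (by omega) (by omega)) Der.triv).mono (by omega)
      · exact (Der.intro hM testClauses_subset 4 rfl [u₁, u₂, v₁, v₂] (by simp)
          (by simp; omega) (ih₁ (v := v₁) h₁ (by omega) (by omega)) Der.triv).mono (by omega)

theorem der_test (hM : 6 * b + 200 ≤ M) {m : NodeTest} {a : Label} (h : m.Holds a)
    (ha : (labV a).size ≤ b) : Der M 1 (goal 15 [m.toV, labV a]) := by
  cases m with
  | wildcard =>
    exact Der.intro hM testClauses_subset 6 rfl [labV a] (by simp) (by simpa using ha)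
      Der.triv Der.triv
  | label c =>
    obtain rfl : a = c := h
    exact Der.intro hM testClauses_subset 7 rfl [labV a] (by simp) (by simpa using ha)
      Der.triv Der.triv

end tests

-- Derivability of refutations from the state of a vertex.

section tree
variable {M b : ℕ} {S : List Label} {t : XMLTree} {A : List Atom}

theorem Adequate.size_lab (h : Adequate M b S t A) {v : Vertex} (hv : v ∈ t.dom) :
    (labV (t.lab v)).size + (V.ofList ((t.falseAtoms A v).map Atom.toV)).size + 1 ≤ b := by
  have := h.size_state v hv
  simp only [XMLTree.state, size_cons] at this
  omega

theorem Adequate.der_mem_state (h : Adequate M b S t A) {v : Vertex} (hv : v ∈ t.dom) {g : Atom}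
    (hg : g ∈ A) (hs : g.1 ≠ .self) (hn : ¬ t.Sat g v) :
    Der M b (goal 13 [g.toV, V.ofList ((t.falseAtoms A v).map Atom.toV)]) := by
  have h1 := h.size_lab hv
  have h2 := V.length_le_size_ofList ((t.falseAtoms A v).map Atom.toV)
  exact (der_mem h.hM (List.mem_map.2 ⟨g, XMLTree.mem_falseAtoms.2 ⟨hg, hs, hn⟩, rfl⟩)
    (by omega)).mono (by omega)

theorem Adequate.der_refuteTest (h : Adequate M b S t A) {v : Vertex} (hv : v ∈ t.dom)
    (m : NodeTest) (k : List Item) (hk : ¬ (m.Holds (t.lab v) ∧ t.SatK k v))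
    (hm : m.toV.size ≤ b) (hks : (contV k).size ≤ b) {n : ℕ} (hn : b ≤ n)
    (hd : ¬ t.SatK k v → Der M n (goal 17 [t.state A v, contV k])) :
    Der M (n + 1) (goal 16 [t.state A v, m.toV, contV k]) := by
  have h1 := h.size_lab hv
  have h2 := h.size_state v hv
  by_cases hh : m.Holds (t.lab v)
  · exact Der.intro h.hM refuteClauses_subset 1 rfl [t.state A v, m.toV, contV k]
      (by simp) (by simp; omega) (hd fun hk' => hk ⟨hh, hk'⟩) Der.triv
  · cases m with
    | wildcard => exact absurd trivial hh
    | label a =>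
      simp only [NodeTest.toV, size_cons] at hm
      have hne : labV (t.lab v) ≠ labV a := fun e => hh (labV_injective e)
      exact Der.intro h.hM refuteClauses_subset 0 rfl
        [labV (t.lab v), V.ofList ((t.falseAtoms A v).map Atom.toV), labV a, contV k]
        (by simp) (by simp; omega)
        ((der_ne h.hM hne (by omega) (by omega)).mono (by omega)) Der.triv

/-- The induction is on the total size of what remains to be refuted. It decreases even when an
operand moves to the continuation, because the tag `1` or `2` is smaller than the token it replaces.
A step along a proper axis ends the descent, its atom being listed in the state. Each unit of size
costs at most two levels, and `b` pays for the final membership or inequality. -/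
theorem Adequate.der_refute (h : Adequate M b S t A) : ∀ n ≤ b,
    (∀ (k : List Item) (v : Vertex), v ∈ t.dom → contAtoms k ⊆ A → ¬ t.SatK k v →
      (contV k).size ≤ n → Der M (2 * n + b) (goal 17 [t.state A v, contV k])) ∧
    ∀ (e : FExpr) (k : List Item) (v : Vertex), v ∈ t.dom → e.atoms k ⊆ A → contAtoms k ⊆ A →
      ¬ e.Leads t (t.SatK k) v → e.toV.size + (contV k).size ≤ n →
      Der M (2 * n + b) (goal 18 [t.state A v, e.toV, contV k]) := by
  intro n
  induction n with
  | zero =>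
    intro _
    constructor
    · intro k v _ _ _ hs
      have := (contV k).size_pos
      omega
    · intro e k v _ _ _ _ hs
      have := (contV k).size_pos
      omega
  | succ n ih =>
    intro hn
    obtain ⟨ih₁, ih₂⟩ := ih (by omega)
    have ih₃ : ∀ (p : LPath) (k : List Item) (v : Vertex), v ∈ t.dom → p.atoms k ⊆ A →
        contAtoms k ⊆ A → ¬ (∃ w, p.Sem t v w ∧ t.SatK k w) → p.toV.size + (contV k).size ≤ n →
        Der M (2 * n + b) (goal 18 [t.state A v, p.toV, contV k]) := by
      intro p k v hv ha hc hl hs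
      have := ih₂ (.path p) k v hv
      simp only [FExpr.atoms, FExpr.toV, FExpr.Leads] at this
      exact this ha hc hl hs
    have e1 : 2 * (n + 1) + b = 2 * n + b + 1 + 1 := by omega
    rw [e1]
    constructor
    · intro k v hv hc hk hs
      have h2 := h.size_state v hv
      refine Der.mono ?_ (Nat.le_succ _)
      rcases k with _ | ⟨p | e, k⟩
      · exact absurd trivial hk
      · simp only [contAtoms, List.append_subset] at hc
        simp only [contV, size_cons] at hs
        have hd := ih₃ p k v hv hc.1 hc.2 hk (by omega)
        exact Der.intro h.hM refuteClauses_subset 2 rfl [t.state A v, p.toV, contV k]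
          (by simp) (by simp; omega) hd Der.triv
      · simp only [contAtoms, List.append_subset] at hc
        simp only [contV, size_cons] at hs
        have hs' : ∀ w ∈ [t.state A v, e.toV, contV k], w.size ≤ b := by simp; omega
        by_cases he : e.Holds t v
        · exact Der.intro h.hM refuteClauses_subset 4 rfl _ (by simp) hs'
            (ih₁ k v hv hc.2 (fun hk' => hk ⟨hk', he⟩) (by omega)) Der.triv
        · have hk0 := (contV k).size_pos
          have hd := ih₂ e [] v hv hc.1 (by simp [contAtoms])
            (fun hl => he (FExpr.leads_true.1 hl)) (by simp [contV]; omega)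
          exact Der.intro h.hM refuteClauses_subset 3 rfl _ (by simp) hs' hd Der.triv
    · intro e k v hv ha hc hl hs
      have h1 := h.size_lab hv
      have h2 := h.size_state v hv
      rcases e with p | ⟨p, q⟩
      rcases p with s | ⟨p, q⟩ | ⟨p, q⟩
      rcases s with ⟨a, m⟩ | ⟨s, f⟩
      · simp only [FExpr.atoms, LPath.atoms, LStep.atoms, List.cons_subset] at ha
        simp only [FExpr.toV, LPath.toV, LStep.toV, size_cons] at hs ⊢
        simp only [FExpr.Leads, LPath.Sem] at hl
        have hd : a ≠ .self → Der M b (goal 13 [atomV a m k,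
            V.ofList ((t.falseAtoms A v).map Atom.toV)]) :=
          fun ne => h.der_mem_state hv (g := (a, m, k)) ha.1 ne hl
        cases a with
        | self =>
          refine Der.intro h.hM refuteClauses_subset 9 rfl [t.state A v, m.toV, contV k]
            (by simp) (by simp; omega) (h.der_refuteTest hv m k ?_ (by omega) (by omega)
              (by omega) fun hk => ih₁ k v hv hc hk (by omega)) Der.triv
          exact fun hh => hl ⟨v, ⟨hv, hv, rfl, hh.1⟩, hh.2⟩
        | child =>
          exact (Der.intro h.hM refuteClauses_subset 10 rfl
            [labV (t.lab v), V.ofList ((t.falseAtoms A v).map Atom.toV), m.toV, contV k]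
            (by simp) (by simp; omega) (hd (by simp)) Der.triv).mono (by omega)
        | descendant =>
          exact (Der.intro h.hM refuteClauses_subset 11 rfl
            [labV (t.lab v), V.ofList ((t.falseAtoms A v).map Atom.toV), m.toV, contV k]
            (by simp) (by simp; omega) (hd (by simp)) Der.triv).mono (by omega)
      · simp only [FExpr.atoms, LPath.atoms, LStep.atoms, List.append_subset] at ha
        simp only [FExpr.toV, LPath.toV, LStep.toV, size_cons, Token.toV, size_num,
          Token.idx] at hs
        simp only [FExpr.toV, LPath.toV, LStep.toV]
        have hd := ih₃ (.step s) (.and f :: k) v hv (by simpa only [LPath.atoms] using ha.1)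
          (by simp only [contAtoms, List.append_subset]; exact ⟨ha.2, hc⟩)
          (fun ⟨w, hw, hk, hf⟩ => hl ⟨w, by simpa only [LPath.Sem, LStep.Sem] using ⟨hw, hf⟩, hk⟩)
          (by simp [contV, LPath.toV]; omega)
        simp only [LPath.toV] at hd
        exact (Der.intro h.hM refuteClauses_subset 8 rfl
          [t.state A v, s.toV, f.toV, contV k] (by simp) (by simp; omega) hd Der.triv).mono
          (by omega)
      · simp only [FExpr.atoms, LPath.atoms, List.append_subset] at ha
        simp only [FExpr.toV, LPath.toV, size_cons, Token.toV, size_num, Token.idx] at hs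
        simp only [FExpr.toV, LPath.toV]
        have hd := ih₃ p (.thn q :: k) v hv ha.1
          (by simp only [contAtoms, List.append_subset]; exact ⟨ha.2, hc⟩)
          (fun ⟨w, hw, w', hw', hk⟩ => hl ⟨w', by simpa only [LPath.Sem] using ⟨w, hw, hw'⟩, hk⟩)
          (by simp [contV]; omega)
        exact (Der.intro h.hM refuteClauses_subset 7 rfl
          [t.state A v, p.toV, q.toV, contV k] (by simp) (by simp; omega) hd Der.triv).mono
          (by omega)
      · simp only [FExpr.atoms, LPath.atoms, List.append_subset] at ha
        simp only [FExpr.toV, LPath.toV, size_cons] at hs ⊢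
        have hd₁ := ih₃ p k v hv ha.1 hc
          (fun ⟨w, hw, hk⟩ => hl ⟨w, by simp only [LPath.Sem]; exact .inl hw, hk⟩) (by omega)
        have hd₂ := ih₃ q k v hv ha.2 hc
          (fun ⟨w, hw, hk⟩ => hl ⟨w, by simp only [LPath.Sem]; exact .inr hw, hk⟩) (by omega)
        exact (Der.intro h.hM refuteClauses_subset 6 rfl
          [t.state A v, p.toV, q.toV, contV k] (by simp) (by simp; omega) hd₁ hd₂).mono
          (by omega)
      · simp only [FExpr.atoms, List.append_subset] at ha
        simp only [FExpr.toV, size_cons] at hs ⊢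
        have hd₁ := ih₃ p k v hv ha.1 hc (fun hw => hl (.inl hw)) (by omega)
        have hd₂ := ih₃ q k v hv ha.2 hc (fun hw => hl (.inr hw)) (by omega)
        exact (Der.intro h.hM refuteClauses_subset 5 rfl
          [t.state A v, p.toV, q.toV, contV k] (by simp) (by simp; omega) hd₁ hd₂).mono
          (by omega)

end tree

/-! ### Walks -/

/-- A walk longer than the number of points repeats a point, and the part in between can be cut out.
The repetition is sought among positions from `1` on, so that a walk of positive length with the
same end points remains. -/
theorem exists_short_walk {α : Type*} {R : α → α → Prop} {F : Finset α} (n : ℕ) (f : ℕ → α)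
    (hn : 1 ≤ n) (hR : ∀ i < n, R (f i) (f (i + 1))) (hF : ∀ i ≤ n, f i ∈ F) :
    ∃ (m : ℕ) (g : ℕ → α), 1 ≤ m ∧ m ≤ F.card ∧ g 0 = f 0 ∧ g m = f n ∧
      (∀ i < m, R (g i) (g (i + 1))) ∧ ∀ i ≤ m, g i ∈ F := by
  induction n using Nat.strong_induction_on generalizing f with
  | _ n ih =>
    by_cases hc : n ≤ F.card
    · exact ⟨n, f, hn, hc, rfl, rfl, hR, hF⟩
    have hp : ∃ i ∈ Finset.Icc 1 n, ∃ j ∈ Finset.Icc 1 n, i ≠ j ∧ f i = f j := by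
      refine Finset.exists_ne_map_eq_of_card_lt_of_maps_to (t := F) (by simpa using hc) ?_
      intro i hi
      exact hF i (by simp at hi; exact hi.2)
    have hp' : ∃ i j, 1 ≤ i ∧ i < j ∧ j ≤ n ∧ f i = f j := by
      obtain ⟨i, hi, j, hj, ne, e⟩ := hp
      simp only [Finset.mem_Icc] at hi hj
      rcases lt_or_gt_of_ne ne with h | h
      · exact ⟨i, j, hi.1, h, hj.2, e⟩
      · exact ⟨j, i, hj.1, h, hi.2, e.symm⟩
    obtain ⟨i, j, hi, hij, hj, e⟩ := hp'
    obtain ⟨m, g, h1, h2, h3, h4, h5, h6⟩ :=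
      ih (n - (j - i)) (by omega) (fun k => if k ≤ i then f k else f (k + (j - i))) (by omega)
        (fun k hk => by
          rcases lt_trichotomy k i with h | h | h
          · simpa [h.le, Nat.succ_le_of_lt h] using hR k (by omega)
          · subst h
            have := hR j (by omega)
            have e2 : k + 1 + (j - k) = j + 1 := by omega
            simpa [e2, e] using this
          · have := hR (k + (j - i)) (by omega)
            have e2 : k + 1 + (j - i) = k + (j - i) + 1 := by omega
            simpa [not_le.2 h, show ¬ k + 1 ≤ i by omega, e2] using this)
        (fun k hk => by
          split_ifs
          · exact hF _ (by omega)
          · exact hF _ (by omega))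
    refine ⟨m, g, h1, h2, by simpa using h3, ?_, h5, h6⟩
    rw [h4]
    by_cases h : n - (j - i) ≤ i
    · have e2 : n - (j - i) = i := by omega
      have e3 : j = n := by omega
      rw [if_pos h, e2, e, e3]
    · rw [if_neg h]
      congr 1
      omega

/-- The walk is split at its midpoint, so a derivation for exponentially many steps adds only `K +
1` levels. -/
theorem der_chain_of_walk {M b n : ℕ} (hM : 6 * b + 200 ≤ M) {s : V} (hs : s.size ≤ b) (K : ℕ) :
    ∀ (m : ℕ) (f : ℕ → V), 1 ≤ m → m ≤ 2 ^ K → (∀ i ≤ m, (f i).size ≤ b) →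
      (∀ i < m, Der M n (goal 21 [s, f i, f (i + 1)])) →
      Der M (n + K + 1) (goal 22 [s, f 0, f m]) := by
  have base : ∀ f : ℕ → V, (∀ i ≤ 1, (f i).size ≤ b) →
      (∀ i < 1, Der M n (goal 21 [s, f i, f (i + 1)])) →
      Der M (n + 1) (goal 22 [s, f 0, f 1]) := by
    intro f hf hd
    have h0 := hf 0 (by omega)
    have h1 := hf 1 (by omega)
    exact Der.intro hM treeClauses_subset 5 rfl [s, f 0, f 1] (by simp) (by simp; omega)
      (hd 0 (by omega)) Der.triv
  induction K with
  | zero =>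
    intro m f h1 h2 hf hd
    obtain rfl : m = 1 := by simp at h2; omega
    exact base f hf hd
  | succ K ih =>
    intro m f h1 h2 hf hd
    rw [pow_succ] at h2
    by_cases hm : m = 1
    · subst hm
      exact (base f hf hd).mono (by omega)
    · have d1 := ih (m / 2) f (by omega) (by omega) (fun i hi => hf i (by omega))
        fun i hi => hd i (by omega)
      have d2 := ih (m - m / 2) (fun i => f (m / 2 + i)) (by omega) (by omega)
        (fun i hi => hf _ (by omega)) fun i hi => hd (m / 2 + i) (by omega)
      have e : m / 2 + (m - m / 2) = m := by omega
      simp only [e, add_zero] at d2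
      have h0 := hf 0 (by omega)
      have h3 := hf (m / 2) (by omega)
      have h4 := hf m le_rfl
      exact Der.intro hM treeClauses_subset 6 rfl [s, f 0, f m, f (m / 2)] (by simp)
        (by simp; omega) d1 d2

/-! ### Derivability of the states of a tree -/

theorem XMLTree.mem_of_append {t : XMLTree} {u w : Vertex} (h : u ++ w ∈ t.dom) : u ∈ t.dom := by
  induction w using List.reverseRecOn with
  | nil => simpa using h
  | append_singleton w i ih => exact ih (t.parent_mem _ i (by simpa using h))

section tree
variable {M b : ℕ} {S : List Label} {t : XMLTree} {A : List Atom}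

/-- Falsity at `u` concerns every child of `u`, in particular the one considered; the other children
can be forgotten, as in the tree with a single child. -/
theorem Adequate.der_upAtom (h : Adequate M b S t A) {u : Vertex} {i : ℕ}
    (hv : u ++ [i] ∈ t.dom) {g : Atom} (hg : g ∈ A) (hs : g.1 ≠ .self) (hn : ¬ t.Sat g u) :
    Der M (3 * b + 2) (goal 19 [t.state A (u ++ [i]), g.toV]) := by
  obtain ⟨a, m, k⟩ := g
  have hu := t.parent_mem u i hv
  have h1 := h.size_lab hv
  have h2 := h.size_state _ hv
  have h3 := h.size_atom _ hg
  simp only [Atom.toV, atomV, size_cons] at h3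
  have hd : a.Rel u (u ++ [i]) →
      Der M (3 * b + 1) (goal 16 [t.state A (u ++ [i]), m.toV, contV k]) := by
    intro hr
    refine h.der_refuteTest hv m k (fun hh => hn ⟨_, ⟨hu, hv, hr, hh.1⟩, hh.2⟩) (by omega)
      (by omega) (by omega) fun hk => ?_
    exact ((h.der_refute b le_rfl).1 k _ hv (h.closed _ hg) hk (by omega)).mono (by omega)
  cases a with
  | self => exact absurd rfl hs
  | child =>
    exact Der.intro h.hM treeClauses_subset 0 rfl [t.state A (u ++ [i]), m.toV, contV k]
      (by simp) (by simp; omega) (hd ⟨i, rfl⟩) Der.triv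
  | descendant =>
    have hn' : ¬ t.Sat (.descendant, m, k) (u ++ [i]) := by
      rintro ⟨w, ⟨-, hw, ⟨x, -, rfl⟩, hh⟩, hk⟩
      exact hn ⟨_, ⟨hu, hw, ⟨[i] ++ x, by simp, by simp⟩, hh⟩, hk⟩
    exact Der.intro h.hM treeClauses_subset 1 rfl
      [V.ofList ((t.falseAtoms A (u ++ [i])).map Atom.toV), m.toV, contV k,
        labV (t.lab (u ++ [i]))]
      (by simp) (by simp; omega) (hd ⟨[i], by simp, rfl⟩)
      ((h.der_mem_state hv hg hs hn').mono (by omega))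

theorem Adequate.der_upAtoms (h : Adequate M b S t A) {u : Vertex} {i : ℕ}
    (hv : u ++ [i] ∈ t.dom) (l : List Atom) (hl : l ⊆ t.falseAtoms A u)
    (hs : (V.ofList (l.map Atom.toV)).size ≤ b) :
    Der M (3 * b + 3 + l.length) (goal 20 [t.state A (u ++ [i]), V.ofList (l.map Atom.toV)]) := by
  have h2 := h.size_state _ hv
  induction l with
  | nil =>
    exact (Der.intro h.hM treeClauses_subset 2 rfl [t.state A (u ++ [i])]
      (by simp) (by simp; omega) Der.triv Der.triv).mono (n := 0 + 1) (by omega)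
  | cons g l ih =>
    simp only [List.cons_subset] at hl
    simp only [List.map_cons, V.ofList, size_cons] at hs
    obtain ⟨hg, hga, hgn⟩ := XMLTree.mem_falseAtoms.1 hl.1
    exact Der.intro h.hM treeClauses_subset 3 rfl
      [t.state A (u ++ [i]), g.toV, V.ofList (l.map Atom.toV)] (by simp) (by simp; omega)
      ((h.der_upAtom hv hg hga hgn).mono (n' := 3 * b + 3 + l.length) (by omega))
      (ih hl.2 (by omega))

theorem Adequate.der_label_mem (h : Adequate M b S t A) {v : Vertex} (hv : v ∈ t.dom) :
    Der M b (goal 13 [labV (t.lab v), alphV S]) := by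
  refine (der_mem h.hM (List.mem_map_of_mem (h.labelled v hv)) h.size_alphV).mono ?_
  simpa using h.length_S

theorem Adequate.der_up (h : Adequate M b S t A) {u : Vertex} {i : ℕ}
    (hv : u ++ [i] ∈ t.dom) :
    Der M (4 * b + 4) (goal 21 [alphV S, t.state A (u ++ [i]), t.state A u]) := by
  have hu := t.parent_mem u i hv
  have h1 := h.size_lab hu
  have h2 := h.size_state _ hv
  have h3 := h.size_alphV
  have h4 : (t.falseAtoms A u).length ≤ b := (List.length_filter_le _ _).trans h.length_A
  exact Der.intro h.hM treeClauses_subset 4 rfl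
    [alphV S, t.state A (u ++ [i]), labV (t.lab u), V.ofList ((t.falseAtoms A u).map Atom.toV)]
    (by simp) (by simp; omega) ((h.der_label_mem hu).mono (by omega))
    ((h.der_upAtoms hv _ (List.Subset.refl _) (by omega)).mono (by omega))

/-- A state is a label from `S` and a sublist of `A`, which leaves `S.length * 2 ^ A.length`
possibilities. -/
theorem Adequate.exists_states (h : Adequate M b S t A) :
    ∃ F : Finset V, F.card ≤ 2 ^ (2 * b) ∧ (∀ v ∈ t.dom, t.state A v ∈ F) ∧
      ∀ x ∈ F, x.size ≤ b := by
  classical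
  let l : List V := (S.product A.sublists).map
    fun x => cons (labV x.1) (V.ofList (x.2.map Atom.toV))
  refine ⟨l.toFinset.filter fun x => x.size ≤ b, ?_, fun v hv => ?_, fun x hx => ?_⟩
  · calc _ ≤ l.toFinset.card := Finset.card_filter_le _ _
      _ ≤ l.length := List.toFinset_card_le _
      _ = S.length * 2 ^ A.length := by simp [l, List.product, List.length_flatMap]
      _ ≤ 2 ^ b * 2 ^ b := Nat.mul_le_mul (h.length_S.trans Nat.lt_two_pow_self.le)
          (Nat.pow_le_pow_right (by omega) h.length_A)
      _ = 2 ^ (2 * b) := by rw [← pow_add, two_mul]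
  · refine Finset.mem_filter.2 ⟨List.mem_toFinset.2 (List.mem_map.2
      ⟨(t.lab v, t.falseAtoms A v), ?_, rfl⟩), h.size_state v hv⟩
    exact List.mem_product.2 ⟨h.labelled v hv, List.mem_sublists.2 List.filter_sublist⟩
  · exact (Finset.mem_filter.1 hx).2

theorem Adequate.der_chain (h : Adequate M b S t A) {u w : Vertex} (hw : w ≠ [])
    (hv : u ++ w ∈ t.dom) :
    Der M (6 * b + 5) (goal 22 [alphV S, t.state A (u ++ w), t.state A u]) := by
  obtain ⟨F, hF, hF₁, hF₂⟩ := h.exists_states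
  have hmem : ∀ j, u ++ w.take j ∈ t.dom := fun j =>
    XMLTree.mem_of_append (w := w.drop j) (by simpa using hv)
  obtain ⟨m, g, h1, h2, h3, h4, h5, h6⟩ := exists_short_walk (F := F)
    (R := fun x y => Der M (4 * b + 4) (goal 21 [alphV S, x, y])) w.length
    -- The walk climbs from `u ++ w` to `u`, because predicate 21 passes from a child to its parent.
    (fun i => t.state A (u ++ w.take (w.length - i))) (List.length_pos_iff.2 hw)
    (fun i hi => by
      have e : u ++ w.take (w.length - i) =
          u ++ w.take (w.length - (i + 1)) ++ [w[w.length - (i + 1)]] := by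
        have : w.length - i = w.length - (i + 1) + 1 := by omega
        rw [this, List.take_succ_eq_append_getElem (by omega), List.append_assoc]
      have hm := hmem (w.length - i)
      simp only [e] at hm ⊢
      exact h.der_up hm)
    (fun i _ => hF₁ _ (hmem _))
  have := der_chain_of_walk h.hM h.size_alphV (2 * b) m g h1 (h2.trans hF)
    (fun i hi => hF₂ _ (h6 i hi)) h5
  simp only [h3, h4, Nat.sub_zero, List.take_length, Nat.sub_self, List.take_zero,
    List.append_nil] at this
  exact this.mono (by omega)

theorem Adequate.der_holds_path (h : Adequate M b S t A) {p : LPath} {v w : Vertex}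
    (hv : v ∈ t.dom) (hw : p.Sem t v w) (hp : p.toV.size ≤ b)
    (hd : Der M (2 * p.toV.size + 6 * b + 6)
      (goal 23 [alphV S, p.toV, t.state A w, t.state A v])) :
    Der M (2 * p.toV.size + 6 * b + 7) (goal 24 [alphV S, p.toV, t.state A v]) := by
  have hw' := p.mem_dom_of_sem hw
  have h1 := h.size_state v hv
  have h2 := h.size_lab hw'
  have h4 := h.size_alphV
  exact Der.intro h.hM treeClauses_subset 14 rfl
    [alphV S, p.toV, t.state A v, labV (t.lab w), V.ofList ((t.falseAtoms A w).map Atom.toV)]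
    (by simp) (by simp; omega) hd ((h.der_label_mem hw').mono (by omega))

mutual
-- The values of the intermediate variables are the true states of the vertices of `t` met on the
-- way. The summand `6 * b + 6` is the height of a descendant chain plus one; the rest is linear in
-- the expression.
theorem LPath.der_eval (h : Adequate M b S t A) : ∀ (p : LPath) (u v : Vertex), u ∈ t.dom →
    p.Sem t u v → p.toV.size ≤ b →
    Der M (2 * p.toV.size + 6 * b + 6) (goal 23 [alphV S, p.toV, t.state A v, t.state A u])
  | .step s, u, v, hu, hs, hp => by
    simp only [LPath.Sem, LPath.toV] at hs hp ⊢
    exact s.der_eval h u v hu hs hp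
  | .seq p q, u, v, hu, hs, hp => by
    simp only [LPath.Sem] at hs
    obtain ⟨w, hs₁, hs₂⟩ := hs
    have hw := p.mem_dom_of_sem hs₁
    have h1 := h.size_state u hu
    have h2 := h.size_state v (q.mem_dom_of_sem hs₂)
    have h3 := h.size_state w hw
    have h4 := h.size_alphV
    simp only [LPath.toV, size_cons] at hp ⊢
    have d1 := p.der_eval h u w hu hs₁ (by omega)
    have d2 := q.der_eval h w v hw hs₂ (by omega)
    exact (Der.intro h.hM treeClauses_subset 10 rfl
      [alphV S, p.toV, q.toV, t.state A v, t.state A u, t.state A w] (by simp) (by simp; omega)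
      (d2.mono (n' := 2 * (p.toV.size + q.toV.size) + 6 * b + 6) (by omega))
      (d1.mono (by omega))).mono (by omega)
  | .union p q, u, v, hu, hs, hp => by
    have h1 := h.size_state u hu
    have h2 := h.size_state v (LPath.mem_dom_of_sem _ hs)
    have h4 := h.size_alphV
    simp only [LPath.Sem] at hs
    simp only [LPath.toV, size_cons] at hp ⊢
    have hsz : ∀ x ∈ [alphV S, p.toV, q.toV, t.state A v, t.state A u], x.size ≤ b := by
      simp; omega
    rcases hs with hs | hs
    · exact (Der.intro h.hM treeClauses_subset 11 rfl _ (by simp) hsz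
        (p.der_eval h u v hu hs (by omega)) Der.triv).mono (by omega)
    · exact (Der.intro h.hM treeClauses_subset 12 rfl _ (by simp) hsz
        (q.der_eval h u v hu hs (by omega)) Der.triv).mono (by omega)
theorem LStep.der_eval (h : Adequate M b S t A) : ∀ (s : LStep) (u v : Vertex), u ∈ t.dom →
    s.Sem t u v → s.toV.size ≤ b →
    Der M (2 * s.toV.size + 6 * b + 6) (goal 23 [alphV S, s.toV, t.state A v, t.state A u])
  | .base a n, u, v, hu, hs, hp => by
    simp only [LStep.Sem] at hs
    obtain ⟨-, hv, hr, hh⟩ := hs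
    simp only [LStep.toV, size_cons] at hp ⊢
    have h1 := h.size_state u hu
    have h2 := h.size_lab hv
    have h3 := h.size_alphV
    have ht := der_test h.hM hh (by omega)
    cases a with
    | self =>
      obtain rfl : v = u := hr
      exact (Der.intro h.hM treeClauses_subset 7 rfl
        [alphV S, n.toV, labV (t.lab v), V.ofList ((t.falseAtoms A v).map Atom.toV)] (by simp)
        (by simp; omega) ht Der.triv).mono (by omega)
    | child =>
      obtain ⟨i, rfl⟩ := hr
      exact (Der.intro h.hM treeClauses_subset 8 rfl
        [alphV S, n.toV, labV (t.lab (u ++ [i])),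
          V.ofList ((t.falseAtoms A (u ++ [i])).map Atom.toV), t.state A u] (by simp)
        (by simp; omega) (ht.mono (n' := 6 * b + 5) (by omega))
        ((h.der_up hv).mono (by omega))).mono (by omega)
    | descendant =>
      obtain ⟨w, hw, rfl⟩ := hr
      exact (Der.intro h.hM treeClauses_subset 9 rfl
        [alphV S, n.toV, labV (t.lab (u ++ w)),
          V.ofList ((t.falseAtoms A (u ++ w)).map Atom.toV), t.state A u] (by simp)
        (by simp; omega) (ht.mono (n' := 6 * b + 5) (by omega))
        (h.der_chain hw hv)).mono (by omega)
  | .filter s e, u, v, hu, hs, hp => by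
    simp only [LStep.Sem] at hs
    obtain ⟨hs, he⟩ := hs
    have hv := s.mem_dom_of_sem hs
    have h1 := h.size_state u hu
    have h2 := h.size_state v hv
    have h4 := h.size_alphV
    simp only [LStep.toV, size_cons] at hp ⊢
    have d1 := s.der_eval h u v hu hs (by omega)
    have d2 := e.der_holds h v hv he (by omega)
    exact (Der.intro h.hM treeClauses_subset 13 rfl
      [alphV S, s.toV, e.toV, t.state A v, t.state A u] (by simp) (by simp; omega)
      (d2.mono (n' := 2 * (s.toV.size + e.toV.size) + 6 * b + 7) (by omega))
      (d1.mono (by omega))).mono (by omega)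
theorem FExpr.der_holds (h : Adequate M b S t A) : ∀ (e : FExpr) (v : Vertex), v ∈ t.dom →
    e.Holds t v → e.toV.size ≤ b →
    Der M (2 * e.toV.size + 6 * b + 7) (goal 24 [alphV S, e.toV, t.state A v])
  | .path p, v, hv, hh, hp => by
    simp only [FExpr.Holds] at hh
    obtain ⟨w, hw⟩ := hh
    simp only [FExpr.toV] at hp ⊢
    exact h.der_holds_path hv hw hp (p.der_eval h v w hv hw hp)
  | .or p q, v, hv, hh, hp => by
    simp only [FExpr.Holds] at hh
    have h1 := h.size_state v hv
    have h4 := h.size_alphV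
    simp only [FExpr.toV, size_cons] at hp ⊢
    have hsz : ∀ x ∈ [alphV S, p.toV, q.toV, t.state A v], x.size ≤ b := by
      simp; omega
    rcases hh with ⟨w, hh⟩ | ⟨w, hh⟩
    · have d := h.der_holds_path hv hh (by omega) (p.der_eval h v w hv hh (by omega))
      exact (Der.intro h.hM treeClauses_subset 15 rfl _ (by simp) hsz d Der.triv).mono (by omega)
    · have d := h.der_holds_path hv hh (by omega) (q.der_eval h v w hv hh (by omega))
      exact (Der.intro h.hM treeClauses_subset 16 rfl _ (by simp) hsz d Der.triv).mono (by omega)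
end

end tree

-- Countermodels yield derivations within quadratic bounds.

theorem length_lab_le {S : List Label} {a : Label} (h : a ∈ S) :
    a.length ≤ (encodeAlphabet S).length := by
  induction S with
  | nil => simp at h
  | cons c S ih =>
    simp only [encodeAlphabet, List.flatMap_cons, List.append_assoc, List.length_append,
      length_encodeLabel] at ih ⊢
    rcases List.mem_cons.1 h with rfl | h
    · omega
    · have := ih h
      omega

/-- The constant `700` bounds the size of a state: a label of length at most `L`, and at most `25 *
L` atoms of size at most `25 * L + 2`. -/
theorem der_nonContained {M b L : ℕ} (hM : 6 * b + 200 ≤ M) (hb : 700 * ((L + 1) * (L + 1)) ≤ b)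
    {S : List Label} {p q : LPath} (hL : (encodeInstance S p q).length ≤ L)
    (hn : ¬ ContainedOver S p q) : Der M (8 * b + 8) (goal 12 [alphV S, p.toV, q.toV]) := by
  simp only [ContainedOver, not_forall] at hn
  obtain ⟨t, ht, ⟨v, hp⟩, hq⟩ := hn
  simp only [encodeInstance, List.length_append] at hL
  have hb' : 700 * (L * L) + 1400 * L + 700 ≤ b := by linarith
  have hS := size_alphV_le S
  have hS' := length_le_alphabet S
  have hps := p.size_toV_le
  have hqs := q.size_toV_le
  have hA := q.length_atoms_le []
  have hg : ∀ g ∈ q.atoms [], g.toV.size ≤ 25 * L + 2 := fun g hg => by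
    have := q.size_atom_le [] g hg
    simp [contV] at this
    omega
  have had : Adequate M b S t (q.atoms []) := {
    hM := hM
    labelled := ht
    size_alphV := by omega
    length_S := by omega
    length_A := by omega
    size_state := fun v hv => by
      have h1 := size_labV_le (t.lab v)
      have h2 := V.size_ofList_le (l := (t.falseAtoms (q.atoms []) v).map Atom.toV)
        (b := 25 * L + 2) (by
          intro x hx
          obtain ⟨g, hg', rfl⟩ := List.mem_map.1 hx
          exact hg g (XMLTree.mem_falseAtoms.1 hg').1)
      have h3 : ((t.falseAtoms (q.atoms []) v).map Atom.toV).length ≤ 25 * L := by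
        have : (t.falseAtoms (q.atoms []) v).length ≤ (q.atoms []).length :=
          List.length_filter_le _ _
        rw [List.length_map]
        omega
      have h4 : (t.lab v).length ≤ L := by
        have := length_lab_le (ht v hv)
        omega
      have h5 := Nat.mul_le_mul_right (25 * L + 2 + 1) h3
      have h6 : 25 * L * (25 * L + 2 + 1) = 625 * (L * L) + 75 * L := by ring
      simp only [XMLTree.state, size_cons]
      omega
    size_atom := fun g hg' => by
      have := hg g hg'
      omega
    closed := fun g hg' x hx => by
      have := q.contAtoms_of_mem [] g hg' x hx
      simpa [contAtoms] using this }
  have hr := t.root_mem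
  have d1 : Der M (2 * p.toV.size + 6 * b + 7) (goal 24 [alphV S, p.toV, t.state _ []]) :=
    had.der_holds_path hr hp (by omega) (p.der_eval had [] v hr hp (by omega))
  have d2 := (had.der_refute b le_rfl).2 (.path q) [] [] hr
    (by simp [FExpr.atoms]) (by simp [contAtoms])
    (fun ⟨w, hw, _⟩ => hq ⟨w, hw⟩) (by simp [FExpr.toV, contV]; omega)
  simp only [FExpr.toV] at d2
  have h1 := had.size_state [] hr
  exact Der.intro hM mainClauses_subset 3 rfl [alphV S, p.toV, q.toV, t.state _ []] (by simp)
    (by simp; omega) (d1.mono (n' := 8 * b + 7) (by omega)) (d2.mono (by omega))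

/-! ### Deciding containment -/

theorem Der.solve {M n : ℕ} {g : V} (hM : 200 ≤ M) (h : Der M n g) (hn : n ≤ M) :
    solve clauses M g = true := by
  obtain ⟨k, hk, h⟩ := h
  have hlen : clauses.length = 60 := rfl
  exact game_of_drv (h.mono_height (parseClauses_subset (by simp [parseClauses])) (by omega)
    (hk.trans hn))

/-- Goal 7 is needed because goal 9 also fails on words that encode no instance. Unique readability
identifies the instance found by goal 9 with the given one. The factor `7200` leaves room for both
`6 * b + 200` and the height `8 * b + 11`, with `b` as chosen in the proof. -/
theorem mem_XFContainment_iff {w : List Token} {M : ℕ}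
    (hM : 7200 * ((w.length + 1) * (w.length + 1)) ≤ M) :
    w ∈ XFContainment ↔ solve clauses M (goal 7 [wordV w]) = true ∧
      ¬ solve clauses M (goal 9 [wordV w]) = true := by
  have hb' : 7200 * ((w.length + 1) * (w.length + 1)) =
      7200 * (w.length * w.length) + 14400 * w.length + 7200 := by ring
  have hb'' : 700 * ((w.length + 1) * (w.length + 1)) =
      700 * (w.length * w.length) + 1400 * w.length + 700 := by ring
  obtain ⟨b, hb⟩ : ∃ b, b = 700 * ((w.length + 1) * (w.length + 1)) := ⟨_, rfl⟩
  have hM₁ : 6 * b + 200 ≤ M := by omega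
  constructor
  · rintro ⟨S, p, q, rfl, hc⟩
    refine ⟨(der_instance hM₁ (by omega) S p q le_rfl).solve (by omega) (by omega), fun h => ?_⟩
    obtain ⟨S', p', q', e, hn⟩ := (meaning_of_solve h : Meaning.Bad _) _ rfl
    obtain ⟨rfl, rfl, rfl⟩ := encodeInstance_inj e
    exact hn hc
  · rintro ⟨h₁, h₂⟩
    obtain ⟨S, p, q, rfl⟩ := (meaning_of_solve h₁ : Meaning.Instance _) _ rfl
    refine ⟨S, p, q, rfl, ?_⟩
    by_contra hn
    exact h₂ ((der_bad hM₁ (by omega) S p q le_rfl (by omega)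
      (der_nonContained hM₁ hb.ge le_rfl hn)).solve (by omega) (by omega))

/-- The bound on height and size used on the input `x`. -/
def bound (c : ℕ) (x : V) : ℕ := c * ((x.len + 1) * (x.len + 1))

def accept (c : ℕ) (x : V) : V :=
  if ofBool (solve clauses (bound c x) (goal 7 [x])) = nil then nil
  else if ofBool (solve clauses (bound c x) (goal 9 [x])) = nil then tt else nil

theorem psf_accept (c : ℕ) : PSF (accept c) := by
  have hu : PSF fun x => cons nil x := psf_nil.cons psf_id
  have hm : PSF fun x => num ((num c).len * (num ((cons nil x).len * (cons nil x).len)).len) :=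
    psf_mul (psf_const _) (psf_mul hu hu)
  have hg : ∀ i, PSF fun x => ofBool (solve clauses (bound c x) (goal i [x])) := fun i => by
    have := psf_solve clauses hm ((psf_const (num i)).cons (psf_id.cons psf_nil))
    simpa [len, bound, goal, V.ofList] using this
  exact (hg 7).ite psf_nil ((hg 9).ite (psf_const tt) psf_nil)

theorem len_wordV (w : List Token) : (wordV w).len = w.length := by
  induction w with
  | nil => rfl
  | cons t w ih => simp [len, ih]

theorem accept_wordV (w : List Token) : accept 7200 (wordV w) ≠ nil ↔ w ∈ XFContainment := by
  rw [mem_XFContainment_iff (M := bound 7200 (wordV w)) (by rw [bound, len_wordV]), accept]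
  cases solve clauses (bound 7200 (wordV w)) (goal 7 [wordV w]) <;>
    cases solve clauses (bound 7200 (wordV w)) (goal 9 [wordV w]) <;> simp [ofBool, tt]

/-! ### Reading the input -/

/-- Push a numeral, the minimum of `n` and `f` of the state, onto the main stack. -/
def Prog.pushNum (f : Option Token → ℕ) : ℕ → Prog
  | 0 => .push .main fun _ => .bit false
  | n + 1 => .seq (pushNum f n) (.ite (fun v => n < f v)
      (.seq (.push .main fun _ => .bit false) (.push .main fun _ => .bit true)) .skip)

theorem run_pushNum {B : ℕ} {f : Option Token → ℕ} {v : Option Token} {m x : List Token} (n : ℕ)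
    (hB : m.length + x.length + 2 * n + 1 ≤ B) :
    Run B (.pushNum f n) v (sto true [] m [] x []) v
      (sto true [] ((num (min (f v) n)).enc ++ m) [] x []) := by
  induction n with
  | zero =>
    refine .push' (by simp [num, enc]) ?_ ?_ <;> rw [space_sto] <;> simp [num, enc] <;> omega
  | succ n ih =>
    refine .seq (ih (by omega)) ?_
    by_cases h : n < f v
    · have e1 : min (f v) n = n := by omega
      have e2 : min (f v) (n + 1) = n + 1 := by omega
      rw [e1, e2]
      refine .ite_true (by simpa using h) (.seq
        (.push' (S' := sto true [] (.bit false :: ((num n).enc ++ m)) [] x []) (by simp) ?_ ?_)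
        (.push' (by simp [num, enc]) ?_ ?_)) <;> rw [space_sto] <;> simp [num] <;> omega
    · have e1 : min (f v) (n + 1) = min (f v) n := by omega
      rw [e1]
      refine .ite_false (by simpa using h) (.skip ?_)
      rw [space_sto]
      simp
      omega

/-- Push the term `wordV` of the input onto the main stack. -/
def Prog.read : Prog :=
  .seq (.drain .inp (.push (.tmp true) topTok)) (.seq (.push .main fun _ => .bit false)
    (.drain (.tmp true) (.seq (.pushNum (fun v => (topTok v).idx) 11)
      (.push .main fun _ => .bit true))))

/-- A list is built from its end, so the input is first reversed onto a temporary stack; its last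
token is then on top. -/
theorem run_read {B : ℕ} (w : List Token) (hB : 25 * w.length + 30 ≤ B) :
    Run B .read none (initSto w) none (stk (wordV w).enc) := by
  have hi : initSto w = sto true w [] [] [] [] := by
    funext k
    cases k <;> simp [initSto, sto]
  rw [hi]
  refine .seq (v' := none) (S' := sto true [] [] [] w.reverse []) ?_ (.seq (v' := none)
    (S' := sto true [] [.bit false] [] w.reverse []) ?_ ?_)
  · have := run_drain (B := B) (k := .inp) (p := .push (.tmp true) topTok)
      (F := fun l acc => sto true l [] [] acc []) (n := w.length)
      (by simp) (by simp) ?_ ?_ w [] none (by simp)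
    · simpa using this
    · intro l acc h
      rw [space_sto]; simp; omega
    · intro t l acc h
      refine .push' (by simp [topTok]) ?_ ?_ <;> rw [space_sto] <;> simp <;> omega
  · refine .push' (by simp) ?_ ?_ <;> rw [space_sto] <;> simp <;> omega
  · have := run_drain (B := B) (k := .tmp true) (p := .seq
        (.pushNum (fun v => (topTok v).idx) 11) (.push .main fun _ => .bit true))
      (F := fun l acc => sto true [] (wordV acc).enc [] l []) (n := w.length)
      (by simp) (by simp) ?_ ?_ w.reverse [] none (by simp)
    · simpa [enc] using this
    · intro l acc h
      have := size_wordV_le acc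
      rw [space_sto]; simp; omega
    · intro t l acc h
      have h1 := size_wordV_le acc
      have h2 := t.idx_le
      have hr := run_pushNum (B := B) (f := fun v => (topTok v).idx) (v := some t)
        (m := (wordV acc).enc) (x := l) 11 (by simp; omega)
      have e : min (topTok (some t)).idx 11 = t.idx := by simpa [topTok] using h2
      rw [e] at hr
      refine .seq hr (.push' (by simp [enc, Token.toV]) ?_ ?_) <;> rw [space_sto] <;>
        simp [Token.toV] <;> omega

end XPathContainment

theorem theorem3p5 :
    XPathContainment.InPSPACE XPathContainment.XFContainment := by
  open XPathContainment in
  obtain ⟨c, P, hc⟩ := psf_accept 7200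
  refine inPSPACE_of_run (.seq .read (.seq c.prog (.pop .main))) _
    (25 * Polynomial.X + 30 + P.comp (24 * Polynomial.X + 1)) fun w => ?_
  have hsz : P.eval (wordV w).size ≤ P.eval (24 * w.length + 1) :=
    eval_le_eval P (size_wordV_le w)
  have he := hc (wordV w)
  obtain ⟨v, hv⟩ := he.run [] none
  simp only [List.append_nil, List.length_nil, add_zero] at hv
  have hs : (25 * Polynomial.X + 30 + P.comp (24 * Polynomial.X + 1)).eval w.length =
      25 * w.length + 30 + P.eval (24 * w.length + 1) := by simp
  rw [hs]
  have hy := he.size_le.2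
  -- The last pop brings the first symbol of the result into the state; it is `bit true` exactly
  -- when the result is not `nil`.
  refine ⟨_, _, .seq (run_read w (by omega)) (.seq (hv.mono (by omega))
    (.pop' rfl rfl ?_ ?_)), ?_⟩
  · rw [space_sto]; simp; omega
  · simp only [sto_main, sto_update_main]
    rw [space_sto]; simp; omega
  · rw [← accept_wordV]
    cases accept 7200 (wordV w) <;> simp [V.enc]
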